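/- **Setting.** Let $M$ be a compact oriented smooth $3$-manifold with (possibly empty) boundary, and let $\iota:\partial M\to M$ be the inclusion of its boundary, with the induced orientation (outward vector first). For $X=M$ or $X=\partial M$ let $\mathcal F_X=\Omega^\bullet(X)[1]\oplus\Omega^\bullet(X)[1]\ni(\mathsf A,\mathsf B)$, a $\mathbb Z$-graded vector space (the $k$-form part of a field has ghost number $1-k$, hence total degree $1$) regarded as a $\mathbb Z$-graded manifold, and let $\delta$ be the de Rham differential on $\mathcal F_X$. Functions, differential forms, vector fields and maps on such a graded vector space $V$ are understood through its functor of points $\Lambda\mapsto(V\otimes\Lambda)_0$, $\Lambda$ a graded-commutative real algebra; a differential form is a function on $T[1]V$. Products of fields with coefficients in $\Lambda$ follow the sign rule for total degree, $\int_X$ is the integral of the top-degree part, and derivatives are taken as coefficients, on the right, of a parameter $\varepsilon$ (for $\delta$: $f(x+\delta x\,\varepsilon,\delta x)=f(x,\delta x)+(\delta f)(x,\delta x)\,\varepsilon$ with $\varepsilon$ of degree $-1$). Put $$\omega_M=\int_M\delta\mathsf A\wedge\delta\mathsf B,\qquad \mathcal S_M=\int_M\mathsf B\wedge \mathrm d\mathsf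 A,\qquad Q_M=\int_M \mathrm d\mathsf A\frac{\delta}{\delta\mathsf A}+\mathrm d\mathsf B\frac{\delta}{\delta\mathsf B},\qquad \pi_M=\iota^*:\mathcal F_M\to\mathcal F_{\partial M},$$ $$\omega^\partial=\int_{\partial M}\delta\mathsf A\wedge\delta\mathsf B,\qquad \alpha^\partial=\int_{\partial M}\mathsf B\wedge\delta\mathsf A,\qquad Q^\partial=\int_{\partial M} \mathrm d\mathsf A\frac{\delta}{\delta\mathsf A}+\mathrm d\mathsf B\frac{\delta}{\delta\mathsf B}.$$ **Definitions.** A symplectic form is a closed, weakly nondegenerate $2$-form. A *BFV manifold* $(\mathcal F,\omega,Q)$ is a $\mathbb Z$-graded manifold with an exact symplectic form $\omega=\delta\alpha$ of degree $0$ and a degree $+1$ vector field $Q$ with $L_Q\omega=0$ and $Q^2=0$. A *BV-BFV manifold* over a BFV manifold $(\mathcal F^\partial,\omega^\partial=\delta\alpha^\partial,Q^\partial)$ is a quintuple $(\mathcal F,\omega,Q,\mathcal S,\pi)$ of a $\mathbb Z$-graded manifold $\mathcal F$, a symplectic form $\omega$ of degree $-1$, a degree $+1$ vector field $Q$ with $Q^2=0$,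 a degree $0$ function $\mathcal S$, and a surjective submersion $\pi:\mathcal F\to\mathcal F^\partial$ (submersion: the differential of $\pi$ is surjective at every point) such that $\delta\pi(Q)=Q^\partial$ and $\iota_Q\omega=\delta\mathcal S+\pi^*\alpha^\partial$. **Claim.** $(\mathcal F_{\partial M},\omega^\partial,Q^\partial)$ is a BFV manifold, with $\omega^\partial=\delta\alpha^\partial$, and $(\mathcal F_M,\omega_M,Q_M,\mathcal S_M,\pi_M)$ is a BV-BFV manifold over it. In particular $$\iota_{Q_M}\omega_M=\delta\mathcal S_M+\pi_M^*\alpha^\partial .$$ -/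

import Mathlib

open Set Function
open scoped Manifold ContDiff TensorProduct DirectSum Topology

namespace BF

noncomputable section

universe u v

set_option linter.unusedSectionVars false

section Coeff
variable {E : Type*} [NormedAddCommGroup E] [NormedSpace ℝ E] [FiniteDimensional ℝ E]
  {F : Type*} [NormedAddCommGroup F] [NormedSpace ℝ F]

/-- In finite dimension a form-valued map is smooth iff all its coefficients are. -/
theorem contDiffWithinAt_form_iff {k : ℕ} {f : F → E [⋀^Fin k]→L[ℝ] ℝ} {s : Set F} {x : F} :
    ContDiffWithinAt ℝ ∞ f s x ↔ ∀ v : Fin k → E, ContDiffWithinAt ℝ ∞ (fun y => f y v) s x := by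
  classical
  constructor
  · intro hf v
    exact (ContinuousAlternatingMap.apply ℝ E ℝ v).contDiff.comp_contDiffWithinAt hf
  · intro hf
    let b := Module.finBasis ℝ E
    let L : (E [⋀^Fin k]→L[ℝ] ℝ) →ₗ[ℝ] ((Fin k → Fin (Module.finrank ℝ E)) → ℝ) :=
      { toFun := fun a r => a (fun i => b (r i))
        map_add' := fun _ _ => rfl
        map_smul' := fun _ _ => rfl }
    have hL : LinearMap.ker L = ⊥ := by
      rw [LinearMap.ker_eq_bot]
      intro a a' h
      apply ContinuousAlternatingMap.toAlternatingMap_injective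
      apply AlternatingMap.coe_multilinearMap_injective
      refine Module.Basis.ext_multilinear (fun _ => b) (fun r => ?_)
      exact congrFun h r
    obtain ⟨G, hG⟩ := LinearMap.exists_leftInverse_of_injective L hL
    have h1 : ContDiffWithinAt ℝ ∞ (fun y => L (f y)) s x :=
      contDiffWithinAt_pi.2 fun r => hf _
    have h2 : ContDiffWithinAt ℝ ∞ (fun y => LinearMap.toContinuousLinearMap G (L (f y))) s x :=
      (LinearMap.toContinuousLinearMap G).contDiff.comp_contDiffWithinAt h1
    have h3 : (fun y => LinearMap.toContinuousLinearMap G (L (f y))) = f := by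
      funext y
      exact LinearMap.congr_fun hG (f y)
    rwa [h3] at h2

theorem contDiffOn_form_iff {k : ℕ} {f : F → E [⋀^Fin k]→L[ℝ] ℝ} {s : Set F} :
    ContDiffOn ℝ ∞ f s ↔ ∀ v : Fin k → E, ContDiffOn ℝ ∞ (fun y => f y v) s :=
  ⟨fun h v x hx => contDiffWithinAt_form_iff.1 (h x hx) v,
    fun h x hx => contDiffWithinAt_form_iff.2 fun v => h v x hx⟩

/-- Pointwise pullback of a smooth form by a smooth family of linear maps is smooth. -/
theorem contDiffWithinAt_formComp {E' : Type*} [NormedAddCommGroup E'] [NormedSpace ℝ E']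
    [FiniteDimensional ℝ E'] {k : ℕ} {f : F → E' [⋀^Fin k]→L[ℝ] ℝ} {g : F → E →L[ℝ] E'}
    {s : Set F} {x : F} (hf : ContDiffWithinAt ℝ ∞ f s x) (hg : ContDiffWithinAt ℝ ∞ g s x) :
    ContDiffWithinAt ℝ ∞ (fun y => (f y).compContinuousLinearMap (g y)) s x := by
  classical
  rw [contDiffWithinAt_form_iff]
  intro v
  let b := Module.finBasis ℝ E'
  have key : ∀ y, (f y).compContinuousLinearMap (g y) v =
      ∑ r : Fin k → Fin (Module.finrank ℝ E'),
        (∏ i, LinearMap.toContinuousLinearMap (b.coord (r i)) (g y (v i))) *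
          f y (fun i => b (r i)) := by
    intro y
    have e1 : (fun i => g y (v i)) = fun i => ∑ j, b.coord j (g y (v i)) • b j := by
      funext i
      exact (b.sum_repr (g y (v i))).symm
    have e2 : (f y).compContinuousLinearMap (g y) v = f y (fun i => g y (v i)) := rfl
    rw [e2, e1]
    have e3 := (f y).toMultilinearMap.map_sum
      (g := fun (i : Fin k) (j : Fin (Module.finrank ℝ E')) => b.coord j (g y (v i)) • b j)
    refine e3.trans (Finset.sum_congr rfl fun r _ => ?_)
    have e4 := (f y).toMultilinearMap.map_smul_univ (fun i => b.coord (r i) (g y (v i)))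
      (fun i => b (r i))
    exact e4
  simp_rw [key]
  refine ContDiffWithinAt.sum fun r _ => ContDiffWithinAt.mul ?_ ?_
  · refine contDiffWithinAt_prod fun i _ => ?_
    exact (LinearMap.toContinuousLinearMap (b.coord (r i))).contDiff.comp_contDiffWithinAt
      (hg.clm_apply contDiffWithinAt_const)
  · exact contDiffWithinAt_form_iff.1 hf _

end Coeff

section Forms

variable {E : Type*} [NormedAddCommGroup E] [NormedSpace ℝ E]
  {H : Type*} [TopologicalSpace H] (I : ModelWithCorners ℝ E H)
  {M : Type*} [TopologicalSpace M] [ChartedSpace H M]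

/-- The coordinate change from the chart at `x₀` to the chart at `z`. -/
def trans (x₀ z : M) : E → E := extChartAt I z ∘ (extChartAt I x₀).symm

/-- The expression in the chart at `x₀` of a field of alternating `k`-forms on the tangent spaces,
i.e. its pullback along the inverse of the chart. (The tangent space at `z` is the model
space `E`, identified with it by means of the chart at `z`.) -/
def localRep {k : ℕ} (α : M → E [⋀^Fin k]→L[ℝ] ℝ) (x₀ : M) (y : E) :
    E [⋀^Fin k]→L[ℝ] ℝ :=
  (α ((extChartAt I x₀).symm y)).compContinuousLinearMap
    (fderivWithin ℝ (trans I x₀ ((extChartAt I x₀).symm y)) (range I) y)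

theorem mapsTo_trans (x₀ z : M) : MapsTo (trans I x₀ z) (range I) (range I) := by
  intro y _
  exact ⟨chartAt H z ((extChartAt I x₀).symm y), rfl⟩

theorem contDiffWithinAt_trans [IsManifold I ∞ M] {x₀ z : M} {y : E}
    (hy : y ∈ (extChartAt I x₀).target)
    (hz : (extChartAt I x₀).symm y ∈ (extChartAt I z).source) :
    ContDiffWithinAt ℝ ∞ (trans I x₀ z) (range I) y := by
  apply contDiffWithinAt_ext_coord_change
  simp only [PartialEquiv.trans_source, PartialEquiv.symm_source, mem_inter_iff, mem_preimage]
  exact ⟨hy, hz⟩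

theorem eventually_mem_source {x₀ z : M} {y : E} (hy : y ∈ (extChartAt I x₀).target)
    (hz : (extChartAt I x₀).symm y ∈ (extChartAt I z).source) :
    ∀ᶠ y' in 𝓝[range I] y, y' ∈ (extChartAt I x₀).target ∧
      (extChartAt I x₀).symm y' ∈ (extChartAt I z).source := by
  have h1 : (extChartAt I x₀).target ∈ 𝓝[range I] y := extChartAt_target_mem_nhdsWithin_of_mem hy
  have h2 : ContinuousWithinAt (extChartAt I x₀).symm (range I) y :=
    ((continuousOn_extChartAt_symm x₀) y hy).mono_of_mem_nhdsWithin h1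
  exact Filter.Eventually.and h1
    (h2 ((isOpen_extChartAt_source (I := I) z).mem_nhds hz))

theorem trans_comp_eventuallyEq {x₀ z w : M} {y : E} (hy : y ∈ (extChartAt I x₀).target)
    (hz : (extChartAt I x₀).symm y ∈ (extChartAt I z).source) :
    trans I x₀ w =ᶠ[𝓝[range I] y] trans I z w ∘ trans I x₀ z := by
  filter_upwards [eventually_mem_source I hy hz] with y' h
  simp only [trans, Function.comp_apply]
  rw [(extChartAt I z).left_inv h.2]

/-- Change of chart for local expressions of forms. -/
theorem localRep_trans [IsManifold I ∞ M] {k : ℕ}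
    (α : M → E [⋀^Fin k]→L[ℝ] ℝ) {x₀ z : M} {y : E}
    (hy : y ∈ (extChartAt I x₀).target)
    (hz : (extChartAt I x₀).symm y ∈ (extChartAt I z).source) :
    localRep I α x₀ y = (localRep I α z (trans I x₀ z y)).compContinuousLinearMap
      (fderivWithin ℝ (trans I x₀ z) (range I) y) := by
  have hyr : y ∈ range I := extChartAt_target_subset_range x₀ hy
  have hp : (extChartAt I z).symm (trans I x₀ z y) = (extChartAt I x₀).symm y := by
    simp only [trans, Function.comp_apply]
    rw [(extChartAt I z).left_inv hz]
  have hu : UniqueDiffWithinAt ℝ (range I) y := I.uniqueDiffOn y hyr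
  have ht : trans I x₀ z y ∈ (extChartAt I z).target := (extChartAt I z).map_source hz
  have hd : ∀ p : M, p = (extChartAt I x₀).symm y →
      fderivWithin ℝ (trans I x₀ p) (range I) y =
      (fderivWithin ℝ (trans I z p) (range I) (trans I x₀ z y)).comp
        (fderivWithin ℝ (trans I x₀ z) (range I) y) := by
    intro p hpp
    have hm : (extChartAt I z).symm (trans I x₀ z y) ∈ (extChartAt I p).source := by
      rw [hp, ← hpp]; exact mem_extChartAt_source p
    rw [(trans_comp_eventuallyEq I hy hz).fderivWithin_eq_of_mem hyr]
    exact fderivWithin_comp y ((contDiffWithinAt_trans I ht hm).differentiableWithinAt (by simp))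
      ((contDiffWithinAt_trans I hy hz).differentiableWithinAt (by simp))
      (mapsTo_trans I x₀ z) hu
  unfold localRep
  rw [hp, hd _ rfl]
  rfl

/-- In the chart at a point, the local expression at that point is the form itself. -/
theorem localRep_self {k : ℕ} (α : M → E [⋀^Fin k]→L[ℝ] ℝ) (x : M) :
    localRep I α x (extChartAt I x x) = α x := by
  have hp : (extChartAt I x).symm (extChartAt I x x) = x := extChartAt_to_inv x
  have hyr : extChartAt I x x ∈ range I := mem_range_self _
  have h1 : fderivWithin ℝ (trans I x x) (range I) (extChartAt I x x)
      = ContinuousLinearMap.id ℝ E := by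
    have : trans I x x =ᶠ[𝓝[range I] (extChartAt I x x)] id := by
      filter_upwards [extChartAt_target_mem_nhdsWithin (I := I) x] with y hy
      exact (extChartAt I x).right_inv hy
    rw [this.fderivWithin_eq_of_mem hyr]
    exact fderivWithin_id (I.uniqueDiffOn _ hyr)
  unfold localRep
  rw [hp, h1]
  rfl

variable (M)

/-- Smooth differential `k`-forms on a manifold `M` (possibly with boundary). -/
structure DForm (k : ℕ) where
  toFun : M → E [⋀^Fin k]→L[ℝ] ℝ
  smooth : ∀ x₀ : M, ContDiffOn ℝ ∞ (localRep I toFun x₀) (extChartAt I x₀).target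

variable {M} {I}

namespace DForm
variable {k l m : ℕ}

theorem ext' {α β : DForm I M k} (h : ∀ x, α.toFun x = β.toFun x) : α = β := by
  cases α; cases β; congr; exact funext h

theorem localRep_add (α β : M → E [⋀^Fin k]→L[ℝ] ℝ) (x₀ : M) :
    localRep I (fun x => α x + β x) x₀ = localRep I α x₀ + localRep I β x₀ := rfl

theorem localRep_smul (c : ℝ) (α : M → E [⋀^Fin k]→L[ℝ] ℝ) (x₀ : M) :
    localRep I (fun x => c • α x) x₀ = c • localRep I α x₀ := rfl

instance : Zero (DForm I M k) := ⟨⟨fun _ => 0, fun _ => contDiffOn_const (c := 0)⟩⟩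
instance : Add (DForm I M k) :=
  ⟨fun α β => ⟨fun x => α.toFun x + β.toFun x, fun x₀ => (α.smooth x₀).add (β.smooth x₀)⟩⟩
instance : SMul ℝ (DForm I M k) :=
  ⟨fun c α => ⟨fun x => c • α.toFun x, fun x₀ => (α.smooth x₀).const_smul c⟩⟩
instance : Neg (DForm I M k) :=
  ⟨fun α => ⟨fun x => - α.toFun x, fun x₀ => (α.smooth x₀).neg⟩⟩

instance : AddCommGroup (DForm I M k) where
  add_assoc _ _ _ := ext' fun _ => add_assoc _ _ _
  zero_add _ := ext' fun _ => zero_add _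
  add_zero _ := ext' fun _ => add_zero _
  add_comm _ _ := ext' fun _ => add_comm _ _
  neg_add_cancel _ := ext' fun _ => neg_add_cancel _
  nsmul := nsmulRec
  zsmul := zsmulRec

instance : Module ℝ (DForm I M k) where
  one_smul _ := ext' fun _ => one_smul _ _
  mul_smul _ _ _ := ext' fun _ => mul_smul _ _ _
  smul_zero _ := ext' fun _ => smul_zero _
  smul_add _ _ _ := ext' fun _ => smul_add _ _ _
  add_smul _ _ _ := ext' fun _ => add_smul _ _ _
  zero_smul _ := ext' fun _ => zero_smul _ _

variable [IsManifold I ∞ M]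

/-- The exterior derivative, computed at each point in the chart at this point. -/
def dFun (α : DForm I M k) (x : M) : E [⋀^Fin (k + 1)]→L[ℝ] ℝ :=
  extDerivWithin (localRep I α.toFun x) (range I) (extChartAt I x x)

theorem contDiffWithinAt_localRep (α : DForm I M k) {x₀ : M} {y : E}
    (hy : y ∈ (extChartAt I x₀).target) :
    ContDiffWithinAt ℝ ∞ (localRep I α.toFun x₀) (range I) y :=
  (α.smooth x₀ y hy).mono_of_mem_nhdsWithin (extChartAt_target_mem_nhdsWithin_of_mem hy)

/-- In every chart, the exterior derivative is the exterior derivative of the local expression. -/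
theorem localRep_dFun (α : DForm I M k) {x₀ : M} {y : E} (hy : y ∈ (extChartAt I x₀).target) :
    localRep I α.dFun x₀ y = extDerivWithin (localRep I α.toFun x₀) (range I) y := by
  have hyr : y ∈ range I := extChartAt_target_subset_range x₀ hy
  set z := (extChartAt I x₀).symm y with hzdef
  have hz : (extChartAt I x₀).symm y ∈ (extChartAt I z).source := mem_extChartAt_source z
  have hτ : trans I x₀ z y = extChartAt I z z := rfl
  have ht : trans I x₀ z y ∈ (extChartAt I z).target := (extChartAt I z).map_source hz
  have h1 : localRep I α.toFun x₀ =ᶠ[𝓝[range I] y] fun y' =>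
      (localRep I α.toFun z (trans I x₀ z y')).compContinuousLinearMap
      (fderivWithin ℝ (trans I x₀ z) (range I) y') := by
    filter_upwards [eventually_mem_source I hy hz] with y' h
    exact localRep_trans I α.toFun h.1 h.2
  rw [h1.extDerivWithin_eq_of_mem hyr]
  rw [extDerivWithin_pullback (t := range I) (r := 2)
    ((α.contDiffWithinAt_localRep ht).differentiableWithinAt (by simp))
    ((contDiffWithinAt_trans I hy hz).of_le ENat.LEInfty.out) (by simp) I.uniqueDiffOn
    (I.range_subset_closure_interior hyr) hyr (mapsTo_trans I x₀ z)]
  rfl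

/-- The exterior derivative of differential forms. -/
def d : DForm I M k →ₗ[ℝ] DForm I M (k + 1) where
  toFun α := ⟨α.dFun, fun x₀ => by
    refine ContDiffOn.congr (f := extDerivWithin (localRep I α.toFun x₀) (range I)) ?_
      (fun y hy => α.localRep_dFun hy)
    intro y hy
    have h := (α.contDiffWithinAt_localRep hy).fderivWithin_right (m := ∞) I.uniqueDiffOn
      (by simp) (extChartAt_target_subset_range x₀ hy)
    exact ((ContinuousAlternatingMap.alternatizeUncurryFinCLM ℝ E ℝ).contDiff.comp_contDiffWithinAt
      h).mono (extChartAt_target_subset_range x₀)⟩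
  map_add' α β := ext' fun x => by
    have hr : extChartAt I x x ∈ range I := mem_range_self _
    exact extDerivWithin_add (I.uniqueDiffOn _ hr)
      ((α.contDiffWithinAt_localRep (mem_extChartAt_target x)).differentiableWithinAt (by simp))
      ((β.contDiffWithinAt_localRep (mem_extChartAt_target x)).differentiableWithinAt (by simp))
  map_smul' c α := ext' fun x => by
    have hr : extChartAt I x x ∈ range I := mem_range_self _
    exact extDerivWithin_smul c (localRep I α.toFun x) (I.uniqueDiffOn _ hr)

end DForm

end Forms

section Wedge

variable {E : Type*} [NormedAddCommGroup E] [NormedSpace ℝ E]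
  {H : Type*} [TopologicalSpace H] {I : ModelWithCorners ℝ E H}
  {M : Type*} [TopologicalSpace M] [ChartedSpace H M] {k l m : ℕ}

/-- The tensor product `v ↦ a (v₁, …, v_k) * b (v_{k+1}, …, v_{k+l})`. -/
def tensorForm (h : k + l = m) (a : E [⋀^Fin k]→L[ℝ] ℝ) (b : E [⋀^Fin l]→L[ℝ] ℝ) :
    ContinuousMultilinearMap ℝ (fun _ : Fin m => E) ℝ where
  toMultilinearMap := (LinearMap.mul' ℝ ℝ).compMultilinearMap
    ((a.toMultilinearMap.domCoprod b.toMultilinearMap).domDomCongr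
      (finSumFinEquiv.trans (finCongr h)))
  cont := by
    change Continuous fun v : Fin m → E =>
      a (fun i => v (finCongr h (finSumFinEquiv (Sum.inl i)))) *
      b (fun i => v (finCongr h (finSumFinEquiv (Sum.inr i))))
    exact (a.cont.comp (continuous_pi fun i => continuous_apply _)).mul
      (b.cont.comp (continuous_pi fun i => continuous_apply _))

theorem tensorForm_apply (h : k + l = m) (a : E [⋀^Fin k]→L[ℝ] ℝ) (b : E [⋀^Fin l]→L[ℝ] ℝ)
    (v : Fin m → E) : tensorForm h a b v =
      a (fun i => v (Fin.cast h (Fin.castAdd l i))) * b (fun j => v (Fin.cast h (Fin.natAdd k j))) :=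
  rfl

/-- The wedge product of alternating forms:
`(a ∧ b) v = (k! l!)⁻¹ ∑ σ, sign σ * a (v_{σ 1}, …, v_{σ k}) * b (v_{σ (k+1)}, …, v_{σ (k+l)})`. -/
def wedgeAlt (h : k + l = m) (a : E [⋀^Fin k]→L[ℝ] ℝ) (b : E [⋀^Fin l]→L[ℝ] ℝ) :
    E [⋀^Fin m]→L[ℝ] ℝ :=
  ((k.factorial * l.factorial : ℝ)⁻¹) • (tensorForm h a b).alternatization

theorem wedgeAlt_apply (h : k + l = m) (a : E [⋀^Fin k]→L[ℝ] ℝ) (b : E [⋀^Fin l]→L[ℝ] ℝ)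
    (v : Fin m → E) : wedgeAlt h a b v = (k.factorial * l.factorial : ℝ)⁻¹ *
      ∑ σ : Equiv.Perm (Fin m), ((Equiv.Perm.sign σ : ℤ) : ℝ) *
        (a (fun i => v (σ (Fin.cast h (Fin.castAdd l i)))) *
          b (fun j => v (σ (Fin.cast h (Fin.natAdd k j))))) := by
  simp only [wedgeAlt, ContinuousAlternatingMap.smul_apply,
    ContinuousMultilinearMap.alternatization_apply_apply, smul_eq_mul, tensorForm_apply,
    Function.comp_apply]
  congr 1
  refine Finset.sum_congr rfl fun σ _ => ?_
  rw [Units.smul_def, zsmul_eq_mul]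

/-- The wedge product of differential forms of degrees `k` and `l`, with `k + l = m`. -/
def DForm.wedge [FiniteDimensional ℝ E] (h : k + l = m) :
    DForm I M k →ₗ[ℝ] DForm I M l →ₗ[ℝ] DForm I M m :=
  LinearMap.mk₂ ℝ
    (fun α β => ⟨fun x => wedgeAlt h (α.toFun x) (β.toFun x), fun x₀ => by
      rw [contDiffOn_form_iff]
      intro v
      have e : (fun y => localRep I (fun x => wedgeAlt h (α.toFun x) (β.toFun x)) x₀ y v) =
          fun y => wedgeAlt h (localRep I α.toFun x₀ y) (localRep I β.toFun x₀ y) v := by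
        funext y
        simp only [localRep, ContinuousAlternatingMap.compContinuousLinearMap_apply,
          wedgeAlt_apply, Function.comp_def]
      rw [e]
      simp only [wedgeAlt_apply]
      refine contDiffOn_const.mul (ContDiffOn.sum fun σ _ => contDiffOn_const.mul
        (ContDiffOn.mul (contDiffOn_form_iff.1 (α.smooth x₀) _)
          (contDiffOn_form_iff.1 (β.smooth x₀) _)))⟩)
    (fun α α' β => DForm.ext' fun x => ContinuousAlternatingMap.ext fun v => by
      change wedgeAlt h (α.toFun x + α'.toFun x) (β.toFun x) v =
        wedgeAlt h (α.toFun x) (β.toFun x) v + wedgeAlt h (α'.toFun x) (β.toFun x) v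
      simp only [wedgeAlt_apply, ContinuousAlternatingMap.add_apply, add_mul, mul_add,
        Finset.sum_add_distrib])
    (fun c α β => DForm.ext' fun x => ContinuousAlternatingMap.ext fun v => by
      change wedgeAlt h (c • α.toFun x) (β.toFun x) v =
        c * wedgeAlt h (α.toFun x) (β.toFun x) v
      simp only [wedgeAlt_apply, ContinuousAlternatingMap.smul_apply, smul_eq_mul]
      rw [mul_left_comm, Finset.mul_sum, Finset.mul_sum, Finset.mul_sum]
      exact Finset.sum_congr rfl fun _ _ => by ring)
    (fun α β β' => DForm.ext' fun x => ContinuousAlternatingMap.ext fun v => by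
      change wedgeAlt h (α.toFun x) (β.toFun x + β'.toFun x) v =
        wedgeAlt h (α.toFun x) (β.toFun x) v + wedgeAlt h (α.toFun x) (β'.toFun x) v
      simp only [wedgeAlt_apply, ContinuousAlternatingMap.add_apply, mul_add,
        Finset.sum_add_distrib])
    (fun c α β => DForm.ext' fun x => ContinuousAlternatingMap.ext fun v => by
      change wedgeAlt h (α.toFun x) (c • β.toFun x) v =
        c * wedgeAlt h (α.toFun x) (β.toFun x) v
      simp only [wedgeAlt_apply, ContinuousAlternatingMap.smul_apply, smul_eq_mul]
      rw [mul_left_comm, Finset.mul_sum, Finset.mul_sum, Finset.mul_sum]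
      exact Finset.sum_congr rfl fun _ _ => by ring)

end Wedge

section Pullback

variable {E : Type*} [NormedAddCommGroup E] [NormedSpace ℝ E] [FiniteDimensional ℝ E]
  {H : Type*} [TopologicalSpace H] {I : ModelWithCorners ℝ E H}
  {M : Type*} [TopologicalSpace M] [ChartedSpace H M] [IsManifold I ∞ M]
  {E' : Type*} [NormedAddCommGroup E'] [NormedSpace ℝ E'] [FiniteDimensional ℝ E']
  {H' : Type*} [TopologicalSpace H'] {J : ModelWithCorners ℝ E' H'}
  {N : Type*} [TopologicalSpace N] [ChartedSpace H' N] [IsManifold J ∞ N] {k : ℕ}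

variable (I J) in
/-- The differential `df_p : T_p N → T_{f p} M`, as a linear map of the model spaces. -/
def tangentMapAt (f : N → M) (p : N) : E' →L[ℝ] E := mfderiv J I f p

/-- A smooth map in charts. -/
theorem contDiffWithinAt_chartMap {f : N → M} (hf : ContMDiff J I ∞ f) {p₀ : N} {x₀ : M} {y : E'}
    (hy : y ∈ (extChartAt J p₀).target)
    (hx : f ((extChartAt J p₀).symm y) ∈ (extChartAt I x₀).source) :
    ContDiffWithinAt ℝ ∞ (extChartAt I x₀ ∘ f ∘ (extChartAt J p₀).symm) (range J) y := by
  have h1 : (extChartAt J p₀).symm y ∈ (chartAt H' p₀).source := by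
    rw [← extChartAt_source J]; exact (extChartAt J p₀).map_target hy
  rw [extChartAt_source] at hx
  have h := ((contMDiffAt_iff_of_mem_source h1 hx).1 (hf _)).2
  rwa [(extChartAt J p₀).right_inv hy] at h

theorem eventually_chartMap {f : N → M} (hf : ContMDiff J I ∞ f) {p₀ : N} {x₀ : M} {y : E'}
    (hy : y ∈ (extChartAt J p₀).target)
    (hx : f ((extChartAt J p₀).symm y) ∈ (extChartAt I x₀).source) :
    ∀ᶠ y' in 𝓝[range J] y, y' ∈ (extChartAt J p₀).target ∧
      f ((extChartAt J p₀).symm y') ∈ (extChartAt I x₀).source := by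
  have h1 : (extChartAt J p₀).target ∈ 𝓝[range J] y := extChartAt_target_mem_nhdsWithin_of_mem hy
  have h2 : ContinuousWithinAt (f ∘ (extChartAt J p₀).symm) (range J) y :=
    hf.continuous.continuousAt.comp_continuousWithinAt
      (((continuousOn_extChartAt_symm p₀) y hy).mono_of_mem_nhdsWithin h1)
  exact Filter.Eventually.and h1
    (h2 ((isOpen_extChartAt_source (I := I) x₀).mem_nhds hx))

/-- The local expression of a pullback is the pullback of the local expression. -/
theorem localRep_pullback {f : N → M} (hf : ContMDiff J I ∞ f) (α : M → E [⋀^Fin k]→L[ℝ] ℝ)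
    {p₀ : N} {x₀ : M} {y : E'} (hy : y ∈ (extChartAt J p₀).target)
    (hx : f ((extChartAt J p₀).symm y) ∈ (extChartAt I x₀).source) :
    localRep J (fun p => (α (f p)).compContinuousLinearMap (tangentMapAt I J f p)) p₀ y =
      (localRep I α x₀ ((extChartAt I x₀ ∘ f ∘ (extChartAt J p₀).symm) y)).compContinuousLinearMap
        (fderivWithin ℝ (extChartAt I x₀ ∘ f ∘ (extChartAt J p₀).symm) (range J) y) := by
  have hyr : y ∈ range J := extChartAt_target_subset_range p₀ hy
  have hu : UniqueDiffWithinAt ℝ (range J) y := J.uniqueDiffOn y hyr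
  have hsF : MapsTo (extChartAt I x₀ ∘ f ∘ (extChartAt J p₀).symm) (range J) (range I) :=
    fun y' _ => ⟨chartAt H x₀ (f ((extChartAt J p₀).symm y')), rfl⟩
  have hp : (extChartAt I x₀).symm ((extChartAt I x₀ ∘ f ∘ (extChartAt J p₀).symm) y) =
      f ((extChartAt J p₀).symm y) := (extChartAt I x₀).left_inv hx
  have ht : (extChartAt I x₀ ∘ f ∘ (extChartAt J p₀).symm) y ∈ (extChartAt I x₀).target :=
    (extChartAt I x₀).map_source hx
  have hF := (contDiffWithinAt_chartMap hf hy hx).differentiableWithinAt (by simp)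
  have hd : ∀ q z, q = (extChartAt J p₀).symm y → z = f q →
      (tangentMapAt I J f q).comp (fderivWithin ℝ (trans J p₀ q) (range J) y) =
      (fderivWithin ℝ (trans I x₀ z) (range I)
        ((extChartAt I x₀ ∘ f ∘ (extChartAt J p₀).symm) y)).comp
        (fderivWithin ℝ (extChartAt I x₀ ∘ f ∘ (extChartAt J p₀).symm) (range J) y) := by
    intro q z hq hz
    have hqs : (extChartAt J p₀).symm y ∈ (extChartAt J q).source := by
      rw [← hq]; exact mem_extChartAt_source q
    have hty : trans J p₀ q y = extChartAt J q q := by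
      simp only [trans, Function.comp_apply]; rw [← hq]
    have hzs : (extChartAt I x₀).symm ((extChartAt I x₀ ∘ f ∘ (extChartAt J p₀).symm) y) ∈
        (extChartAt I z).source := by
      rw [hp, ← hq, ← hz]; exact mem_extChartAt_source z
    have hmd : MDifferentiableAt J I f q := (hf q).mdifferentiableAt (by simp)
    have hG : DifferentiableWithinAt ℝ (writtenInExtChartAt J I q f) (range J)
        (trans J p₀ q y) := by
      rw [hty]; exact hmd.differentiableWithinAt_writtenInExtChartAt
    have e1 : tangentMapAt I J f q =
        fderivWithin ℝ (writtenInExtChartAt J I q f) (range J) (trans J p₀ q y) := by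
      rw [hty]; exact hmd.mfderiv
    rw [e1, ← fderivWithin_comp y hG
      ((contDiffWithinAt_trans J hy hqs).differentiableWithinAt (by simp)) (mapsTo_trans J p₀ q) hu,
      ← fderivWithin_comp y ((contDiffWithinAt_trans I ht hzs).differentiableWithinAt (by simp))
      hF hsF hu]
    refine Filter.EventuallyEq.fderivWithin_eq_of_mem ?_ hyr
    filter_upwards [eventually_mem_source J hy hqs, eventually_chartMap hf hy hx] with y' h1 h2
    simp only [writtenInExtChartAt, trans, Function.comp_apply]
    rw [(extChartAt J q).left_inv h1.2, (extChartAt I x₀).left_inv h2.2, hz]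
  unfold localRep
  rw [hp]
  have h := hd _ _ rfl rfl
  ext v
  simp only [ContinuousAlternatingMap.compContinuousLinearMap_apply]
  congr 1
  funext i
  exact DFunLike.congr_fun h (v i)

theorem pullback_smooth_aux (f : N → M) (hf : ContMDiff J I ∞ f) (α : DForm I M k) {p₀ : N}
    {y : E'} (hy : y ∈ (extChartAt J p₀).target) :
    ContDiffWithinAt ℝ ∞
      (localRep J (fun p => (α.toFun (f p)).compContinuousLinearMap (tangentMapAt I J f p)) p₀)
      (extChartAt J p₀).target y := by
  have hyr : y ∈ range J := extChartAt_target_subset_range p₀ hy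
  set x₀ := f ((extChartAt J p₀).symm y) with hx₀
  have hx : f ((extChartAt J p₀).symm y) ∈ (extChartAt I x₀).source := mem_extChartAt_source x₀
  have hsF : MapsTo (extChartAt I x₀ ∘ f ∘ (extChartAt J p₀).symm) (range J) (range I) :=
    fun y' _ => ⟨chartAt H x₀ (f ((extChartAt J p₀).symm y')), rfl⟩
  have ht : (extChartAt I x₀ ∘ f ∘ (extChartAt J p₀).symm) y ∈ (extChartAt I x₀).target :=
    (extChartAt I x₀).map_source hx
  have hF := contDiffWithinAt_chartMap hf hy hx
  have h1 := (α.contDiffWithinAt_localRep ht).comp y hF hsF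
  have h2 := hF.fderivWithin_right (m := ∞) J.uniqueDiffOn (by simp) hyr
  refine ((contDiffWithinAt_formComp h1 h2).congr_of_eventuallyEq_of_mem ?_ hyr).mono
    (extChartAt_target_subset_range p₀)
  filter_upwards [eventually_chartMap hf hy hx] with y' h
  exact localRep_pullback hf α.toFun h.1 h.2

/-- The pullback `f^* α` of a differential form along a smooth map. -/
def DForm.pullback (f : N → M) (hf : ContMDiff J I ∞ f) : DForm I M k →ₗ[ℝ] DForm J N k where
  toFun α := ⟨fun p => (α.toFun (f p)).compContinuousLinearMap (tangentMapAt I J f p), by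
    intro p₀ y hy
    exact pullback_smooth_aux f hf α hy⟩
  map_add' _ _ := rfl
  map_smul' _ _ := rfl

end Pullback
section Integral

variable {n : ℕ} {H : Type*} [TopologicalSpace H]
  (I : ModelWithCorners ℝ (EuclideanSpace ℝ (Fin n)) H)
  (M : Type*) [TopologicalSpace M] [ChartedSpace H M]

/-- The atlas of preferred charts is oriented: all coordinate changes have positive Jacobian
determinant. Integration of top forms uses the orientation given by such an atlas. -/
def IsOrientedAtlas : Prop :=
  ∀ (x₀ x₁ : M), ∀ y ∈ (extChartAt I x₀).target,
    (extChartAt I x₀).symm y ∈ (extChartAt I x₁).source →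
      0 < (fderivWithin ℝ (trans I x₀ x₁) (range I) y).det

variable [IsManifold I ∞ M] [T2Space M] [CompactSpace M]

/-- A smooth partition of unity subordinate to the cover by the domains of the charts. -/
def chartPartition : SmoothPartitionOfUnity M I M univ :=
  (SmoothPartitionOfUnity.exists_isSubordinate_chartAt_source I M).choose

theorem chartPartition_isSubordinate :
    (chartPartition I M).IsSubordinate (fun x => (chartAt H x).source) :=
  (SmoothPartitionOfUnity.exists_isSubordinate_chartAt_source I M).choose_spec

variable {I M}

/-- The integrand of `ρ_c • α` in the chart at `c`. -/
def chartIntegrand (α : DForm I M n) (c : M) (y : EuclideanSpace ℝ (Fin n)) : ℝ :=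
  chartPartition I M c ((extChartAt I c).symm y) *
    localRep I α.toFun c y (fun i => EuclideanSpace.single i 1)

theorem integrableOn_chartIntegrand (α : DForm I M n) (c : M) :
    MeasureTheory.IntegrableOn (chartIntegrand α c) (extChartAt I c).target := by
  set K : Set (EuclideanSpace ℝ (Fin n)) :=
    extChartAt I c '' tsupport (chartPartition I M c) with hK
  have hsub : tsupport (chartPartition I M c) ⊆ (extChartAt I c).source := by
    rw [extChartAt_source]; exact chartPartition_isSubordinate I M c
  have hKt : K ⊆ (extChartAt I c).target := by
    rintro _ ⟨x, hx, rfl⟩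
    exact (extChartAt I c).map_source (hsub hx)
  have hKc : IsCompact K :=
    (isClosed_tsupport _).isCompact.image_of_continuousOn ((continuousOn_extChartAt c).mono hsub)
  have hcont : ContinuousOn (chartIntegrand α c) (extChartAt I c).target := by
    refine ContinuousOn.mul ?_ ?_
    · exact (chartPartition I M c).contMDiff.continuous.comp_continuousOn (continuousOn_extChartAt_symm c)
    · exact (contDiffOn_form_iff.1 (α.smooth c) _).continuousOn
  have hmeas : MeasurableSet (extChartAt I c).target := by
    rw [extChartAt_target]
    exact (((chartAt H c).open_target.preimage I.continuous_symm).measurableSet).inter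
      I.isClosed_range.measurableSet
  refine ((hcont.mono hKt).integrableOn_compact hKc).of_forall_sdiff_eq_zero hmeas ?_
  rintro y ⟨hy, hyK⟩
  have : chartPartition I M c ((extChartAt I c).symm y) = 0 := by
    by_contra h
    exact hyK ⟨(extChartAt I c).symm y, subset_tsupport _ h, (extChartAt I c).right_inv hy⟩
  rw [chartIntegrand, this, zero_mul]

theorem finite_support_integral (α : DForm I M n) :
    (support fun c => ∫ y in (extChartAt I c).target, chartIntegrand α c y).Finite := by
  refine ((chartPartition I M).locallyFinite.finite_nonempty_of_compact).subset ?_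
  intro c hc
  by_contra h
  apply hc
  have h0 : ∀ x, chartPartition I M c x = 0 := by
    intro x
    by_contra hx
    exact h ⟨x, hx⟩
  simp [chartIntegrand, h0]

/-- The integral `∫_M α` of a top degree form over a compact manifold with an oriented atlas. -/
def integral : DForm I M n →ₗ[ℝ] ℝ where
  toFun α := ∑ᶠ c : M, ∫ y in (extChartAt I c).target, chartIntegrand α c y
  map_add' α β := by
    rw [← finsum_add_distrib (finite_support_integral α) (finite_support_integral β)]
    refine finsum_congr fun c => ?_
    rw [← MeasureTheory.integral_add (integrableOn_chartIntegrand α c)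
      (integrableOn_chartIntegrand β c)]
    congr 1
    funext y
    exact mul_add _ _ _
  map_smul' r α := by
    rw [RingHom.id_apply, smul_finsum]
    refine finsum_congr fun c => ?_
    rw [← MeasureTheory.integral_smul]
    congr 1
    funext y
    exact mul_left_comm _ _ _

end Integral

section Graded

/-- Graded-commutative `ℤ`-graded real algebras, used as algebras of parameters. -/
structure GCAlg where
  carrier : Type
  [ring : Ring carrier]
  [algebra : Algebra ℝ carrier]
  gr : ℤ → Submodule ℝ carrier
  [graded : GradedAlgebra gr]
  comm : ∀ (i j : ℤ) (a b : carrier), a ∈ gr i → b ∈ gr j →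
    a * b = ((i * j).negOnePow : ℤ) • (b * a)

instance : CoeSort GCAlg Type := ⟨GCAlg.carrier⟩
instance (Λ : GCAlg) : Ring Λ := Λ.ring
instance (Λ : GCAlg) : Algebra ℝ Λ := Λ.algebra
instance (Λ : GCAlg) : GradedAlgebra Λ.gr := Λ.graded

/-- Degree preserving algebra homomorphisms. -/
structure GCAlg.Hom (Λ Λ' : GCAlg) where
  toAlgHom : Λ →ₐ[ℝ] Λ'
  map_gr : ∀ (i : ℤ) (a : Λ), a ∈ Λ.gr i → toAlgHom a ∈ Λ'.gr i

/-- The linear map `λ ↦ (-1)^(l * |λ|) λ`. -/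
def GCAlg.sign (Λ : GCAlg) (l : ℤ) : Λ →ₗ[ℝ] Λ :=
  (DirectSum.toModule ℝ ℤ Λ fun i => ((i * l).negOnePow : ℤ) • (Λ.gr i).subtype) ∘ₗ
    (DirectSum.decomposeLinearEquiv Λ.gr).toLinearMap

/-- A `ℤ`-graded real vector space, possibly infinite dimensional. It is regarded as a (linear)
`ℤ`-graded manifold through its functor of points, see `GVect.points`. A linear coordinate on
the part of degree `i` has degree (ghost number) `-i`. -/
structure GVect where
  carrier : Type u
  [addCommGroup : AddCommGroup carrier]
  [module : Module ℝ carrier]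
  gr : ℤ → Submodule ℝ carrier
  internal : DirectSum.IsInternal gr

instance : CoeSort GVect.{u} (Type u) := ⟨GVect.carrier⟩
instance (V : GVect.{u}) : AddCommGroup V := V.addCommGroup
instance (V : GVect.{u}) : Module ℝ V := V.module

namespace GVect

/-- The elements of total degree `d` of `V ⊗ Λ`. For `d = 0` these are the points of the graded
manifold `V` with values in `Λ`. As `V` is linear, the elements of degree `d` are also the tangent
vectors of degree `d` at any point; the pairs `(x, ξ)` of elements of degrees `0` and `1` are the
`Λ`-valued points of the shifted tangent bundle `T[1]V`, the functions on which are the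
differential forms on `V`, with `ξ = δx`. -/
def points (V : GVect.{u}) (Λ : GCAlg) (d : ℤ) : Submodule ℝ (V ⊗[ℝ] Λ) :=
  Submodule.span ℝ {t | ∃ i : ℤ, ∃ v ∈ V.gr i, ∃ a ∈ Λ.gr (d - i), t = v ⊗ₜ[ℝ] a}

/-- The change of parameters `V ⊗ Λ → V ⊗ Λ'`. -/
def map (V : GVect.{u}) {Λ Λ' : GCAlg} (φ : GCAlg.Hom Λ Λ') : V ⊗[ℝ] Λ →ₗ[ℝ] V ⊗[ℝ] Λ' :=
  φ.toAlgHom.toLinearMap.lTensor V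

/-- The right multiplication `x ↦ x ε` on `V ⊗ Λ`. -/
def rmul (V : GVect.{u}) {Λ : GCAlg} (x : V ⊗[ℝ] Λ) (ε : Λ) : V ⊗[ℝ] Λ :=
  (LinearMap.mulRight ℝ ε).lTensor V x

end GVect

open GVect

/-- Families of maps sending `x ∈ V ⊗ Λ`, `ξ = δx ∈ V ⊗ Λ` to an element of `Λ`: the raw data of
a differential form on `V`. Only the values for `x` of degree `0` and `ξ` of degree `1` matter. -/
abbrev FormData (V : GVect.{u}) := ∀ Λ : GCAlg, V ⊗[ℝ] Λ → V ⊗[ℝ] Λ → Λ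

/-- The raw data of a vector field on `V`, or of a map from `V` to `W`. -/
abbrev MapData (V : GVect.{u}) (W : GVect.{v}) := ∀ Λ : GCAlg, V ⊗[ℝ] Λ → W ⊗[ℝ] Λ

/-- `f` is a differential `k`-form of degree (ghost number) `n` on `V`: a function on `T[1]V`, that
is, a natural family of maps from the `Λ`-valued points of `T[1]V` to `Λ`, which has total degree
`n + k` and is homogeneous of degree `k` in `ξ = δx`. The `0`-forms are the functions on `V`. -/
structure IsForm (V : GVect.{u}) (k : ℕ) (n : ℤ) (f : FormData V) : Prop where
  degree : ∀ (Λ : GCAlg), ∀ x ∈ V.points Λ 0, ∀ ξ ∈ V.points Λ 1, f Λ x ξ ∈ Λ.gr (n + k)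
  natural : ∀ (Λ Λ' : GCAlg) (φ : GCAlg.Hom Λ Λ'), ∀ x ∈ V.points Λ 0, ∀ ξ ∈ V.points Λ 1,
    f Λ' (V.map φ x) (V.map φ ξ) = φ.toAlgHom (f Λ x ξ)
  homogeneous : ∀ (Λ : GCAlg) (t : ℝ), ∀ x ∈ V.points Λ 0, ∀ ξ ∈ V.points Λ 1,
    f Λ x (t • ξ) = t ^ k • f Λ x ξ

/-- `X` is a vector field of degree `n` on `V`. -/
structure IsVectorField (V : GVect.{u}) (n : ℤ) (X : MapData V V) : Prop where
  degree : ∀ (Λ : GCAlg), ∀ x ∈ V.points Λ 0, X Λ x ∈ V.points Λ n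
  natural : ∀ (Λ Λ' : GCAlg) (φ : GCAlg.Hom Λ Λ'), ∀ x ∈ V.points Λ 0,
    X Λ' (V.map φ x) = V.map φ (X Λ x)

/-- `p` is a map of graded manifolds from `V` to `W`. -/
structure IsGradedMap (V : GVect.{u}) (W : GVect.{v}) (p : MapData V W) : Prop where
  degree : ∀ (Λ : GCAlg), ∀ x ∈ V.points Λ 0, p Λ x ∈ W.points Λ 0
  natural : ∀ (Λ Λ' : GCAlg) (φ : GCAlg.Hom Λ Λ'), ∀ x ∈ V.points Λ 0,
    p Λ' (V.map φ x) = W.map φ (p Λ x)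

/-- `g = δ f`. The de Rham differential `δ` is the vector field `x ↦ ξ`, `ξ ↦ 0` on `T[1]V`, that
is, `f (x + ξ ε, ξ) = f (x, ξ) + (δ f) (x, ξ) ε` for every parameter `ε` of degree `-1` (such an
`ε` has square zero). As one may adjoin a free odd `ε` to any `Λ`, this determines `g`. -/
def IsDifferential (V : GVect.{u}) (f g : FormData V) : Prop :=
  ∀ (Λ : GCAlg), ∀ x ∈ V.points Λ 0, ∀ ξ ∈ V.points Λ 1, ∀ ε ∈ Λ.gr (-1),
    f Λ (x + V.rmul ξ ε) ξ = f Λ x ξ + g Λ x ξ * ε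

/-- `g = ι_Q f`, where `Q` is a vector field of degree `1`. The contraction `ι_Q` is the vector
field `x ↦ 0`, `ξ ↦ Q x` of degree `0` on `T[1]V`, that is,
`f (x, ξ + (Q x) ε) = f (x, ξ) + (ι_Q f) (x, ξ) ε` for `ε` of degree `0` with `ε² = 0`. -/
def IsContraction (V : GVect.{u}) (Q : MapData V V) (f g : FormData V) : Prop :=
  ∀ (Λ : GCAlg), ∀ x ∈ V.points Λ 0, ∀ ξ ∈ V.points Λ 1, ∀ ε ∈ Λ.gr 0, ε * ε = 0 →
    f Λ x (ξ + V.rmul (Q Λ x) ε) = f Λ x ξ + g Λ x ξ * ε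

/-- `g = L_Q f := ι_Q δ f - δ ι_Q f`, for a vector field `Q` of degree `1` and a `(k + 1)`-form `f`
of degree `n`. -/
def IsLieDerivative (V : GVect.{u}) (Q : MapData V V) (k : ℕ) (n : ℤ) (f g : FormData V) : Prop :=
  ∃ df idf qf dqf : FormData V,
    IsForm V (k + 2) n df ∧ IsDifferential V f df ∧
    IsForm V (k + 1) (n + 1) idf ∧ IsContraction V Q df idf ∧
    IsForm V k (n + 1) qf ∧ IsContraction V Q f qf ∧
    IsForm V (k + 1) (n + 1) dqf ∧ IsDifferential V qf dqf ∧
    ∀ (Λ : GCAlg), ∀ x ∈ V.points Λ 0, ∀ ξ ∈ V.points Λ 1,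
      g Λ x ξ = idf Λ x ξ - dqf Λ x ξ

/-- The zero form. -/
def zeroForm (V : GVect.{u}) : FormData V := fun _ _ _ => 0

/-- A 2-form is (weakly) nondegenerate if a tangent vector `v` at a point `x` is zero as soon as
the value of the form on the pair `(ξ, v)` (the polarization of the quadratic map
`ξ ↦ ω (x, ξ)`) vanishes for all tangent vectors `ξ` at `x`, after every extension of parameters. -/
def IsNondegenerate (V : GVect.{u}) (ωV : FormData V) : Prop :=
  ∀ (Λ : GCAlg), ∀ x ∈ V.points Λ 0, ∀ v ∈ V.points Λ 1,
    (∀ (Λ' : GCAlg) (φ : GCAlg.Hom Λ Λ'), ∀ ξ ∈ V.points Λ' 1,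
      ωV Λ' (V.map φ x) (ξ + V.map φ v) - ωV Λ' (V.map φ x) ξ - ωV Λ' (V.map φ x) (V.map φ v) = 0) →
    v = 0

/-- Symplectic forms of degree `n`: closed nondegenerate 2-forms. -/
structure IsSymplectic (V : GVect.{u}) (n : ℤ) (ωV : FormData V) : Prop where
  isForm : IsForm V 2 n ωV
  closed : IsDifferential V ωV (zeroForm V)
  nondegenerate : IsNondegenerate V ωV

/-- Cohomological vector fields: `Q` has degree `1` and `Q² = 0`. The condition says that the
derivative of `Q` along itself vanishes: `Q (x + (Q x) ε) = Q x` for `ε` of degree `-1`. -/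
structure IsCohomological (V : GVect.{u}) (Q : MapData V V) : Prop where
  isVectorField : IsVectorField V 1 Q
  sq_zero : ∀ (Λ : GCAlg), ∀ x ∈ V.points Λ 0, ∀ ε ∈ Λ.gr (-1),
    Q Λ (x + V.rmul (Q Λ x) ε) = Q Λ x

/-- `dp` is the differential `T[1]V → T[1]W`, `(x, ξ) ↦ (p x, dp (x, ξ))`, of the map `p`. -/
structure IsTangentMap (V : GVect.{u}) (W : GVect.{v}) (p : MapData V W)
    (dp : ∀ Λ : GCAlg, V ⊗[ℝ] Λ → V ⊗[ℝ] Λ → W ⊗[ℝ] Λ) : Prop where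
  degree : ∀ (Λ : GCAlg), ∀ x ∈ V.points Λ 0, ∀ ξ ∈ V.points Λ 1, dp Λ x ξ ∈ W.points Λ 1
  natural : ∀ (Λ Λ' : GCAlg) (φ : GCAlg.Hom Λ Λ'), ∀ x ∈ V.points Λ 0, ∀ ξ ∈ V.points Λ 1,
    dp Λ' (V.map φ x) (V.map φ ξ) = W.map φ (dp Λ x ξ)
  deriv : ∀ (Λ : GCAlg), ∀ x ∈ V.points Λ 0, ∀ ξ ∈ V.points Λ 1, ∀ ε ∈ Λ.gr (-1),
    p Λ (x + V.rmul ξ ε) = p Λ x + W.rmul (dp Λ x ξ) ε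

/-- BFV manifolds `(V, ωV, Q)`, with the chosen primitive `α` of `ωV = δα`. The field
`lie` says that `L_Q ωV = 0`. -/
structure IsBFVManifold (V : GVect.{u}) (ωV α : FormData V) (Q : MapData V V) : Prop where
  symplectic : IsSymplectic V 0 ωV
  primitive_isForm : IsForm V 1 0 α
  exact : IsDifferential V α ωV
  cohomological : IsCohomological V Q
  lie : IsLieDerivative V Q 1 0 ωV (zeroForm V)

/-- BV-BFV manifolds `(V, ωV, Q, S, p)` over a BFV manifold `(W, ωW = δ αW, QW)`. The fields
`surjective` and `structure_eqs` say that `p` is surjective and, with `dp` the differential of `p`,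
that `p` is a submersion, that `dp (Q) = QW`, and that `ι_Q ωV = δ S + p^* αW`. -/
structure IsBVBFVManifold (V : GVect.{u}) (ωV : FormData V) (Q : MapData V V) (S : FormData V)
    (W : GVect.{v}) (p : MapData V W) (ωW αW : FormData W) (QW : MapData W W) : Prop where
  base : IsBFVManifold W ωW αW QW
  symplectic : IsSymplectic V (-1) ωV
  cohomological : IsCohomological V Q
  action_isFunction : IsForm V 0 0 S
  isGradedMap : IsGradedMap V W p
  surjective : ∀ (Λ : GCAlg), ∀ y ∈ W.points Λ 0, ∃ x ∈ V.points Λ 0, p Λ x = y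
  structure_eqs : ∃ dp, IsTangentMap V W p dp ∧
    (∀ (Λ : GCAlg), ∀ x ∈ V.points Λ 0, ∀ η ∈ W.points Λ 1, ∃ ξ ∈ V.points Λ 1, dp Λ x ξ = η) ∧
    (∀ (Λ : GCAlg), ∀ x ∈ V.points Λ 0, dp Λ x (Q Λ x) = QW Λ (p Λ x)) ∧
    ∃ dS, IsForm V 1 0 dS ∧ IsDifferential V S dS ∧
      IsContraction V Q ωV (fun Λ x ξ => dS Λ x ξ + αW Λ (p Λ x) (dp Λ x ξ))

end Graded

section BFTheory

variable {n : ℕ} {H : Type*} [TopologicalSpace H]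
  (I : ModelWithCorners ℝ (EuclideanSpace ℝ (Fin n)) H)
  (M : Type u) [TopologicalSpace M] [ChartedSpace H M]

/-- The space `Ω^•(M)` of inhomogeneous differential forms. -/
abbrev Forms : Type u := ⨁ k : ℕ, DForm I M k

/-- The part of degree `j` of the shifted space of forms `Ω^•(M)[1]`: forms of degree `j + 1`. -/
def shiftedForms (j : ℤ) : Submodule ℝ (Forms I M) where
  carrier := {α | ∀ k : ℕ, (k : ℤ) ≠ j + 1 → α k = 0}
  zero_mem' := fun _ _ => rfl
  add_mem' := fun {a b} ha hb k hk => by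
    rw [DirectSum.add_apply, ha k hk, hb k hk, add_zero]
  smul_mem' := fun c a ha k hk => by
    rw [DirectSum.smul_apply, ha k hk, smul_zero]

theorem isInternal_shiftedForms_prod :
    DirectSum.IsInternal fun j : ℤ => (shiftedForms I M j).prod (shiftedForms I M j) := by
  rw [DirectSum.isInternal_submodule_iff_iSupIndep_and_iSup_eq_top]
  constructor
  · intro j
    rw [Submodule.disjoint_def]
    intro x hx hx'
    let P : Submodule ℝ (Forms I M × Forms I M) :=
      { carrier := {y | ∀ k : ℕ, (k : ℤ) = j + 1 → y.1 k = 0 ∧ y.2 k = 0}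
        zero_mem' := fun _ _ => ⟨rfl, rfl⟩
        add_mem' := fun {a b} ha hb k hk => by
          rw [Prod.fst_add, Prod.snd_add, DirectSum.add_apply, DirectSum.add_apply,
            (ha k hk).1, (ha k hk).2, (hb k hk).1, (hb k hk).2, add_zero]
          exact ⟨rfl, rfl⟩
        smul_mem' := fun c a ha k hk => by
          rw [Prod.smul_fst, Prod.smul_snd, DirectSum.smul_apply, DirectSum.smul_apply,
            (ha k hk).1, (ha k hk).2, smul_zero]
          exact ⟨rfl, rfl⟩ }
    have hP : (⨆ i, ⨆ (_ : i ≠ j), (shiftedForms I M i).prod (shiftedForms I M i)) ≤ P := by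
      refine iSup_le fun i => iSup_le fun hi y hy k hk => ?_
      have hne : (k : ℤ) ≠ i + 1 := by omega
      exact ⟨hy.1 k hne, hy.2 k hne⟩
    have hxP := hP hx'
    refine Prod.ext (DFinsupp.ext fun k => ?_) (DFinsupp.ext fun k => ?_)
    · by_cases hk : (k : ℤ) = j + 1
      · exact (hxP k hk).1
      · exact hx.1 k hk
    · by_cases hk : (k : ℤ) = j + 1
      · exact (hxP k hk).2
      · exact hx.2 k hk
  · rw [eq_top_iff]
    have hof : ∀ (k : ℕ) (a : DForm I M k),
        DirectSum.of (fun k => DForm I M k) k a ∈ shiftedForms I M ((k : ℤ) - 1) := by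
      intro k a k' hk'
      refine DirectSum.of_eq_of_ne _ _ _ ?_
      intro h
      apply hk'
      rw [h]
      ring
    have h1 : ∀ a : Forms I M, (a, (0 : Forms I M)) ∈
        ⨆ j : ℤ, (shiftedForms I M j).prod (shiftedForms I M j) := by
      intro a
      induction a using DirectSum.induction_on with
      | zero => exact Submodule.zero_mem _
      | of k a =>
        exact Submodule.mem_iSup_of_mem ((k : ℤ) - 1) ⟨hof k a, Submodule.zero_mem _⟩
      | add a b ha hb =>
        have := Submodule.add_mem _ ha hb
        rwa [Prod.mk_add_mk, add_zero] at this
    have h2 : ∀ a : Forms I M, ((0 : Forms I M), a) ∈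
        ⨆ j : ℤ, (shiftedForms I M j).prod (shiftedForms I M j) := by
      intro a
      induction a using DirectSum.induction_on with
      | zero => exact Submodule.zero_mem _
      | of k a =>
        exact Submodule.mem_iSup_of_mem ((k : ℤ) - 1) ⟨Submodule.zero_mem _, hof k a⟩
      | add a b ha hb =>
        have := Submodule.add_mem _ ha hb
        rwa [Prod.mk_add_mk, add_zero] at this
    rintro ⟨a, b⟩ -
    have := Submodule.add_mem _ (h1 a) (h2 b)
    rwa [Prod.mk_add_mk, add_zero, zero_add] at this

/-- The graded manifold of BF fields `Ω^•(M)[1] ⊕ Ω^•(M)[1] ∋ (A, B)`. -/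
def bfFields : GVect.{u} where
  carrier := Forms I M × Forms I M
  gr := fun j => (shiftedForms I M j).prod (shiftedForms I M j)
  internal := isInternal_shiftedForms_prod I M

variable {I M}

/-- The exterior derivative on `Ω^•(M)`. -/
def totalD [IsManifold I ∞ M] : Forms I M →ₗ[ℝ] Forms I M :=
  DirectSum.toModule ℝ ℕ _ fun k => DirectSum.lof ℝ ℕ (fun k => DForm I M k) (k + 1) ∘ₗ DForm.d

/-- The superfield `A`, an inhomogeneous form with coefficients in `Λ`. -/
def superA {Λ : GCAlg} (x : bfFields I M ⊗[ℝ] Λ) : Forms I M ⊗[ℝ] Λ :=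
  (LinearMap.fst ℝ (Forms I M) (Forms I M)).rTensor Λ x

/-- The superfield `B`, an inhomogeneous form with coefficients in `Λ`. -/
def superB {Λ : GCAlg} (x : bfFields I M ⊗[ℝ] Λ) : Forms I M ⊗[ℝ] Λ :=
  (LinearMap.snd ℝ (Forms I M) (Forms I M)).rTensor Λ x

/-- The exterior derivative on forms with coefficients in `Λ`. -/
def superD [IsManifold I ∞ M] {Λ : GCAlg} : Forms I M ⊗[ℝ] Λ →ₗ[ℝ] Forms I M ⊗[ℝ] Λ :=
  totalD.rTensor Λ

/-- The component of form degree `k`. -/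
def superComp {Λ : GCAlg} (k : ℕ) : Forms I M ⊗[ℝ] Λ →ₗ[ℝ] DForm I M k ⊗[ℝ] Λ :=
  (DirectSum.component ℝ ℕ (fun k => DForm I M k) k).rTensor Λ

/-- The wedge product of forms with coefficients in `Λ`, with the sign rule for the total degree:
`(α ⊗ a) ∧ (β ⊗ b) = (-1)^(|a| |β|) (α ∧ β) ⊗ a b`. -/
def superWedge {Λ : GCAlg} {k l m : ℕ} (h : k + l = m) :
    DForm I M k ⊗[ℝ] Λ →ₗ[ℝ] DForm I M l ⊗[ℝ] Λ →ₗ[ℝ] DForm I M m ⊗[ℝ] Λ :=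
  TensorProduct.map₂ (DForm.wedge h) (LinearMap.mul ℝ Λ ∘ₗ Λ.sign l)

variable [IsManifold I ∞ M] [T2Space M] [CompactSpace M]

/-- The integral of forms with coefficients in `Λ`. -/
def superIntegral {Λ : GCAlg} : DForm I M n ⊗[ℝ] Λ →ₗ[ℝ] Λ :=
  (TensorProduct.lid ℝ Λ).toLinearMap ∘ₗ integral.rTensor Λ

/-- `∫_M X ∧ Y`, the integral of the top degree part of the product of two superfields. -/
def pairing {Λ : GCAlg} (X Y : Forms I M ⊗[ℝ] Λ) : Λ :=
  ∑ k : Fin (n + 1), superIntegral (superWedge (k := (k : ℕ)) (l := n - k) (by omega)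
    (superComp k X) (superComp (n - k) Y))

variable (I M)

/-- The 2-form `∫_M δA ∧ δB`. -/
def bfOmega : FormData (bfFields I M) := fun _ _ ξ => pairing (superA ξ) (superB ξ)

/-- The 1-form `∫_M B ∧ δA`. -/
def bfAlpha : FormData (bfFields I M) := fun _ x ξ => pairing (superB x) (superA ξ)

/-- The action `∫_M B ∧ dA`. -/
def bfAction : FormData (bfFields I M) := fun _ x _ => pairing (superB x) (superD (superA x))

/-- The vector field `∫_M dA δ/δA + dB δ/δB`, i.e. `A ↦ dA`, `B ↦ dB`. -/
def bfQ : MapData (bfFields I M) (bfFields I M) := fun Λ =>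
  (totalD.prodMap totalD : Forms I M × Forms I M →ₗ[ℝ] Forms I M × Forms I M).rTensor Λ

end BFTheory

section Restriction

variable {m n : ℕ} {H H' : Type*} [TopologicalSpace H] [TopologicalSpace H']
  {I : ModelWithCorners ℝ (EuclideanSpace ℝ (Fin n)) H}
  {J : ModelWithCorners ℝ (EuclideanSpace ℝ (Fin m)) H'}
  {M : Type u} [TopologicalSpace M] [ChartedSpace H M] [IsManifold I ∞ M]
  {N : Type v} [TopologicalSpace N] [ChartedSpace H' N] [IsManifold J ∞ N]

/-- The pullback `f^*` of inhomogeneous forms. -/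
def totalPullback (f : N → M) (hf : ContMDiff J I ∞ f) : Forms I M →ₗ[ℝ] Forms J N :=
  DirectSum.lmap fun _ => DForm.pullback f hf

/-- The pullback of fields `(A, B) ↦ (f^* A, f^* B)`. -/
def bfPullback (f : N → M) (hf : ContMDiff J I ∞ f) : MapData (bfFields I M) (bfFields J N) :=
  fun Λ => ((totalPullback f hf).prodMap (totalPullback f hf)).rTensor Λ

end Restriction

section Boundary

variable {M : Type*} [TopologicalSpace M] [ChartedSpace (EuclideanHalfSpace 3) M]
  {N : Type*} [TopologicalSpace N] [ChartedSpace (EuclideanSpace ℝ (Fin 2)) N]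

/-- The orientation of `N`, included as boundary in `M`, is the induced one: an outward pointing
vector followed by an oriented basis of `T_p N` is an oriented basis of `T_{i p} M`. In the charts
of `M`, with values in `{x | 0 ≤ x 0}`, the vectors pointing outward are those with `v 0 < 0`. -/
def IsBoundaryOriented (i : N → M) : Prop :=
  ∀ (p : N) (v : EuclideanSpace ℝ (Fin 3)), v 0 < 0 →
    0 < (Matrix.of ![v.ofLp,
      (tangentMapAt (𝓡∂ 3) (𝓡 2) i p (EuclideanSpace.single 0 1)).ofLp,
      (tangentMapAt (𝓡∂ 3) (𝓡 2) i p (EuclideanSpace.single 1 1)).ofLp]).det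

end Boundary

end

end BF

open BF

/-! All the structures are built from the pairing `∫ X ∧ Y` of superfields, so the theorem reduces
to three properties of it: its sign rules (`pairing_comm`, `pairing_superRmul_left`,
`pairing_superRmul_right`), Stokes' theorem (`pairing_superD_boundary`, `pairing_superD_closed`) and
nondegeneracy (`eq_zero_of_pairing_eq_zero`).

The superfields A and B have total degree 1, whereas dA, dB, δA and δB have total degree 2 and
therefore commute under the integral. One finds ι_Q ω = ∫ dA ∧ δB + δA ∧ dB and δS = ∫ δB ∧ dA + B ∧
d(δA). The difference is ∫ dB ∧ δA - B ∧ d(δA) = ∫ d(B ∧ δA), which Stokes' theorem turns into the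
integral of B ∧ δA over the boundary, that is, into π^* α. The minus sign is the Leibniz sign of the
odd superfield B. On the closed surface the same argument gives δ ι_Q ω = ∫ d(δA ∧ δB) = 0; as also
δω = 0, it follows that L_Q ω = 0. Finally Q² = 0 is d² = 0, and π intertwines the vector fields
because pullback commutes with d.

Stokes' theorem is reduced by a partition of unity to forms supported in one chart, where it is the
divergence theorem on a large box (`integral_box_extDerivWithin`). To recognize the boundary term,
the charts of M are restricted to boundary coordinates (`boundaryChart`). By
`det_boundaryChartDeriv_neg` they reverse the induced orientation, and this accounts for the minus
sign in the half space formula.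

Nondegeneracy has a geometric and an algebraic half. A form β with β(c) ≠ 0 is detected by a bump
form at c whose wedge with β has an integrand of one sign (`DForm.eq_zero_of_integral_wedge`). To
test a superfield by a form of arbitrary degree one needs a coefficient of the complementary degree,
which Λ may lack; it is adjoined as a free square-zero generator (`GCAlg.sqZero`).

The projection π is surjective, and so is its differential, because forms on the boundary extend:
the boundary is locally a smooth retract of M, by dropping the first coordinate of a chart, and the
pullbacks along local retractions are glued by a partition of unity
(`DForm.pullback_boundary_surjective`). -/

namespace BF

noncomputable section

universe u v

set_option linter.unusedSectionVars false

/-! ### Antisymmetrization and its expansion along the first slot -/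

section AltSum

variable {E : Type*} {m : ℕ}

/-- The antisymmetrization of a function of `m` variables. -/
def altSum (T : (Fin m → E) → ℝ) (v : Fin m → E) : ℝ :=
  ∑ σ : Equiv.Perm (Fin m), ((Equiv.Perm.sign σ : ℤ) : ℝ) * T (v ∘ σ)

/-- Reindex the sum by `σ ↦ σ * π`; the sign is multiplicative and `sign π` squares to one. Every
later manipulation of slots rests on this. -/
theorem altSum_perm (T : (Fin m → E) → ℝ) (π : Equiv.Perm (Fin m)) (v : Fin m → E) :
    altSum (fun w => T (w ∘ π)) v = ((Equiv.Perm.sign π : ℤ) : ℝ) * altSum T v := by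
  unfold altSum
  rw [Finset.mul_sum, ← Equiv.sum_comp (Equiv.mulRight π) (fun σ : Equiv.Perm (Fin m) =>
    ((Equiv.Perm.sign π : ℤ) : ℝ) * (((Equiv.Perm.sign σ : ℤ) : ℝ) * T (v ∘ σ)))]
  refine Finset.sum_congr rfl fun σ _ => ?_
  have h : ((Equiv.Perm.sign π : ℤ) : ℝ) * ((Equiv.Perm.sign π : ℤ) : ℝ) = 1 := by
    rcases Int.units_eq_one_or (Equiv.Perm.sign π) with h | h <;> rw [h] <;> norm_num
  have e : (v ∘ σ) ∘ π = v ∘ (Equiv.mulRight π σ) := by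
    funext i; simp
  change _ * T ((v ∘ σ) ∘ π) = _
  rw [e]
  have hs : Equiv.Perm.sign (Equiv.mulRight π σ) = Equiv.Perm.sign σ * Equiv.Perm.sign π :=
    Equiv.Perm.sign_mul σ π
  rw [hs, Units.val_mul, Int.cast_mul]
  linear_combination (- ((Equiv.Perm.sign σ : ℤ) : ℝ) * T (v ∘ ⇑(Equiv.mulRight π σ))) * h

theorem altSum_sum {ι : Type*} (s : Finset ι) (T : ι → (Fin m → E) → ℝ) (v : Fin m → E) :
    altSum (fun w => ∑ i ∈ s, T i w) v = ∑ i ∈ s, altSum (T i) v := by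
  unfold altSum
  simp only [Finset.mul_sum]
  exact Finset.sum_comm

theorem altSum_const_mul (c : ℝ) (T : (Fin m → E) → ℝ) (v : Fin m → E) :
    altSum (fun w => c * T w) v = c * altSum T v := by
  unfold altSum
  rw [Finset.mul_sum]
  exact Finset.sum_congr rfl fun _ _ => by ring

/-- Permutations of `Fin (m + 1)` correspond to pairs of the image of `0` and of the permutation
induced on the complement. -/
def permOfSuccAbove (p : Fin (m + 1) × Equiv.Perm (Fin m)) : Equiv.Perm (Fin (m + 1)) :=
  p.1.cycleRange.symm * Equiv.Perm.decomposeFin.symm (0, p.2)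

theorem permOfSuccAbove_zero (p : Fin (m + 1) × Equiv.Perm (Fin m)) :
    permOfSuccAbove p 0 = p.1 := by
  simp [permOfSuccAbove, Fin.cycleRange_symm_zero]

theorem permOfSuccAbove_succ (p : Fin (m + 1) × Equiv.Perm (Fin m)) (j : Fin m) :
    permOfSuccAbove p j.succ = p.1.succAbove (p.2 j) := by
  simp [permOfSuccAbove, Fin.cycleRange_symm_succ]

theorem sign_cycleRange_symm (i : Fin m) :
    ((Equiv.Perm.sign i.cycleRange.symm : ℤ) : ℝ) = (-1) ^ (i : ℕ) := by
  rw [Equiv.Perm.sign_symm, Fin.sign_cycleRange]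
  push_cast
  rfl

theorem sign_permOfSuccAbove (p : Fin (m + 1) × Equiv.Perm (Fin m)) :
    ((Equiv.Perm.sign (permOfSuccAbove p) : ℤ) : ℝ) =
      (-1) ^ (p.1 : ℕ) * ((Equiv.Perm.sign p.2 : ℤ) : ℝ) := by
  rw [permOfSuccAbove, Equiv.Perm.sign_mul, Units.val_mul, Int.cast_mul, sign_cycleRange_symm,
    Equiv.Perm.decomposeFin.symm_sign, if_pos rfl, one_mul]

/-- The image of `0` recovers the first component and the images of the successors recover the
second; surjectivity follows by counting, since both sides have `(m + 1)!` elements. -/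
theorem permOfSuccAbove_bijective : Bijective (permOfSuccAbove (m := m)) := by
  rw [Fintype.bijective_iff_injective_and_card]
  constructor
  · intro p q h
    have h0 : p.1 = q.1 := by rw [← permOfSuccAbove_zero p, h, permOfSuccAbove_zero]
    refine Prod.ext h0 (Equiv.ext fun j => ?_)
    have h1 := permOfSuccAbove_succ p j
    rw [h, permOfSuccAbove_succ, h0] at h1
    exact (Fin.succAbove_right_injective h1).symm
  · simp [Fintype.card_perm, Nat.factorial_succ]

/-- Grouping permutations by the image of `0` gives a Laplace expansion. It has the shape of
`alternatizeUncurryFin`, so that exterior derivatives can be compared with full antisymmetrizations.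
-/
theorem altSum_succ (T : (Fin (m + 1) → E) → ℝ) (v : Fin (m + 1) → E) :
    altSum T v = ∑ j : Fin (m + 1), (-1) ^ (j : ℕ) *
      altSum (fun w => T (Fin.cons (v j) w)) (j.removeNth v) := by
  unfold altSum
  rw [← (Equiv.ofBijective _ (permOfSuccAbove_bijective (m := m))).sum_comp,
    Fintype.sum_prod_type]
  refine Finset.sum_congr rfl fun j _ => ?_
  rw [Finset.mul_sum]
  refine Finset.sum_congr rfl fun σ _ => ?_
  rw [Equiv.ofBijective_apply, sign_permOfSuccAbove, mul_assoc]
  congr 3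
  funext i
  refine Fin.cases ?_ (fun i => ?_) i
  · simp [permOfSuccAbove_zero]
  · simp [permOfSuccAbove_succ, Fin.removeNth]

end AltSum

/-! ### Graded commutativity and the Leibniz rule for alternating forms on a vector space -/

section WedgeAlgebra

variable {E : Type*} [NormedAddCommGroup E] [NormedSpace ℝ E] {k l m : ℕ}

theorem wedgeAlt_eq_altSum (h : k + l = m) (a : E [⋀^Fin k]→L[ℝ] ℝ) (b : E [⋀^Fin l]→L[ℝ] ℝ)
    (v : Fin m → E) : wedgeAlt h a b v = (k.factorial * l.factorial : ℝ)⁻¹ *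
      altSum (fun w => a (fun i => w (Fin.cast h (Fin.castAdd l i))) *
        b (fun j => w (Fin.cast h (Fin.natAdd k j)))) v :=
  wedgeAlt_apply h a b v

/-- The rotation power exchanges a block of length `k` with one of length `l`. Its sign is `(-1)^((k
+ l - 1) * l)`, and the part `(l - 1) * l` of the exponent is even. -/
theorem sign_finRotate_pow (h : k + l = m) :
    ((Equiv.Perm.sign (finRotate m ^ l) : ℤ) : ℝ) = (-1) ^ (k * l) := by
  subst h
  rw [map_pow, sign_finRotate]
  push_cast
  rw [← pow_mul]
  rcases Nat.eq_zero_or_pos l with rfl | hl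
  · simp
  · obtain ⟨l, rfl⟩ : ∃ l', l = l' + 1 := ⟨l - 1, by omega⟩
    have e : (k + (l + 1) - 1) * (l + 1) = k * (l + 1) + l * (l + 1) := by
      rw [show k + (l + 1) - 1 = k + l by omega]; ring
    rw [e, pow_add, (Nat.even_mul_succ_self l).neg_one_pow, mul_one]

theorem finRotate_pow_apply [NeZero m] (j : ℕ) (i : Fin m) :
    (finRotate m ^ j) i = i + Fin.ofNat m j := by
  induction j with
  | zero => simp
  | succ j ih =>
    rw [pow_succ', Equiv.Perm.mul_apply, ih, finRotate_apply, add_assoc]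
    congr 1
    apply Fin.ext
    simp [Fin.val_add, Fin.ofNat]

/-- Graded commutativity of the wedge product. -/
theorem wedgeAlt_comm (h : k + l = m) (h' : l + k = m) (a : E [⋀^Fin k]→L[ℝ] ℝ)
    (b : E [⋀^Fin l]→L[ℝ] ℝ) : wedgeAlt h' b a = (-1 : ℝ) ^ (k * l) • wedgeAlt h a b := by
  ext v
  rw [ContinuousAlternatingMap.smul_apply, smul_eq_mul, wedgeAlt_eq_altSum, wedgeAlt_eq_altSum,
    ← sign_finRotate_pow h, mul_left_comm, ← altSum_perm, mul_comm (l.factorial : ℝ)]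
  congr 2
  funext w
  rw [mul_comm]
  have hrot : ∀ i : Fin m, ((finRotate m ^ l) i : ℕ) = (i + l) % m := by
    intro i
    have := i.neZero
    rw [finRotate_pow_apply]
    simp [Fin.val_add, Fin.ofNat]
  congr 2
  · funext i
    rw [comp_apply]
    congr 1
    apply Fin.ext
    rw [hrot]
    simp only [Fin.val_cast, Fin.val_natAdd, Fin.val_castAdd]
    rw [Nat.mod_eq_of_lt (by omega), add_comm]
  · funext i
    rw [comp_apply]
    congr 1
    apply Fin.ext
    rw [hrot]
    simp only [Fin.val_cast, Fin.val_natAdd, Fin.val_castAdd]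
    rw [show k + (i : ℕ) + l = i + m by omega, Nat.add_mod_right, Nat.mod_eq_of_lt (by omega)]

theorem wedgeAlt_comp {E' : Type*} [NormedAddCommGroup E'] [NormedSpace ℝ E'] (h : k + l = m)
    (a : E [⋀^Fin k]→L[ℝ] ℝ) (b : E [⋀^Fin l]→L[ℝ] ℝ) (f : E' →L[ℝ] E) :
    (wedgeAlt h a b).compContinuousLinearMap f =
      wedgeAlt h (a.compContinuousLinearMap f) (b.compContinuousLinearMap f) := by
  ext v
  simp only [ContinuousAlternatingMap.compContinuousLinearMap_apply, wedgeAlt_apply,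
    Function.comp_def]

/-- Under the outer antisymmetrization all `k + 1` terms of the inner one coincide: the cycle that
brings slot `i` to the front has sign `(-1)^i`, which cancels the sign of the term. -/
theorem altSum_alternatizeUncurryFin_mul (h : k + 1 + l = m + 1)
    (A : E →L[ℝ] E [⋀^Fin k]→L[ℝ] ℝ) (b : E [⋀^Fin l]→L[ℝ] ℝ) (v : Fin (m + 1) → E) :
    altSum (fun w => ContinuousAlternatingMap.alternatizeUncurryFin A
        (fun i => w (Fin.cast h (Fin.castAdd l i))) *
        b (fun j => w (Fin.cast h (Fin.natAdd (k + 1) j)))) v =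
      (k + 1 : ℝ) * altSum (fun w => A (w 0) (fun i => w (Fin.cast h (Fin.castAdd l i.succ))) *
        b (fun j => w (Fin.cast h (Fin.natAdd (k + 1) j)))) v := by
  simp only [ContinuousAlternatingMap.alternatizeUncurryFin_apply, Finset.sum_mul]
  rw [altSum_sum]
  have key : ∀ i : Fin (k + 1), altSum (fun w =>
      (-1) ^ (i : ℕ) • A (w (Fin.cast h (Fin.castAdd l i)))
        (i.removeNth fun i => w (Fin.cast h (Fin.castAdd l i))) *
        b (fun j => w (Fin.cast h (Fin.natAdd (k + 1) j)))) v =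
      altSum (fun w => A (w 0) (fun i => w (Fin.cast h (Fin.castAdd l i.succ))) *
        b (fun j => w (Fin.cast h (Fin.natAdd (k + 1) j)))) v := by
    intro i
    have hp := altSum_perm (fun w : Fin (m + 1) → E =>
      A (w 0) (fun i => w (Fin.cast h (Fin.castAdd l i.succ))) *
        b (fun j => w (Fin.cast h (Fin.natAdd (k + 1) j))))
      (Fin.cast h (Fin.castAdd l i)).cycleRange.symm v
    rw [sign_cycleRange_symm] at hp
    have h1 : ((-1 : ℝ) ^ (i : ℕ)) * (-1) ^ (i : ℕ) = 1 := by
      rw [← mul_pow]; norm_num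
    have h2 := congrArg (fun t => (-1 : ℝ) ^ (i : ℕ) * t) hp
    simp only [Fin.val_cast, Fin.val_castAdd] at h2
    rw [← mul_assoc, h1, one_mul, ← altSum_const_mul] at h2
    rw [← h2]
    congr 1
    funext w
    have e1 : ∀ j : Fin k, (Fin.cast h (Fin.castAdd l i)).cycleRange.symm
        (Fin.cast h (Fin.castAdd l j.succ)) = Fin.cast h (Fin.castAdd l (i.succAbove j)) := by
      intro j
      have e : Fin.cast h (Fin.castAdd l j.succ) = Fin.succ (⟨j, by omega⟩ : Fin m) :=
        Fin.ext (by simp)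
      rw [e, Fin.cycleRange_symm_succ]
      apply Fin.ext
      simp only [Fin.succAbove, Fin.lt_def, Fin.val_cast, Fin.val_castAdd, Fin.val_castSucc]
      split_ifs <;> simp
    have e2 : ∀ j : Fin l, (Fin.cast h (Fin.castAdd l i)).cycleRange.symm
        (Fin.cast h (Fin.natAdd (k + 1) j)) = Fin.cast h (Fin.natAdd (k + 1) j) := by
      intro j
      have e : Fin.cast h (Fin.natAdd (k + 1) j) = Fin.succ (⟨k + j, by omega⟩ : Fin m) :=
        Fin.ext (by simp; omega)
      rw [e, Fin.cycleRange_symm_succ, Fin.succAbove_of_le_castSucc]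
      simp [Fin.le_def]; omega
    simp only [comp_apply, Fin.cycleRange_symm_zero, e1, e2]
    rw [zsmul_eq_mul]
    push_cast
    rw [mul_assoc]
    rfl
  rw [Finset.sum_congr rfl fun i _ => key i]
  simp

/-- The derivative slot now starts behind the `k` slots of `a`, so the cycle to the front has sign
`(-1)^(k + i)`. The uncancelled `(-1)^k` is the sign of the Leibniz rule. -/
theorem altSum_mul_alternatizeUncurryFin (h : k + (l + 1) = m + 1) (h₁ : k + 1 + l = m + 1)
    (a : E [⋀^Fin k]→L[ℝ] ℝ) (B : E →L[ℝ] E [⋀^Fin l]→L[ℝ] ℝ) (v : Fin (m + 1) → E) :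
    altSum (fun w => a (fun i => w (Fin.cast h (Fin.castAdd (l + 1) i))) *
        ContinuousAlternatingMap.alternatizeUncurryFin B
          (fun j => w (Fin.cast h (Fin.natAdd k j)))) v =
      (-1) ^ k * ((l + 1 : ℝ) *
        altSum (fun w => a (fun i => w (Fin.cast h₁ (Fin.castAdd l i.succ))) *
        B (w 0) (fun j => w (Fin.cast h₁ (Fin.natAdd (k + 1) j)))) v) := by
  simp only [ContinuousAlternatingMap.alternatizeUncurryFin_apply, Finset.mul_sum]
  rw [altSum_sum]
  have key : ∀ i : Fin (l + 1), altSum (fun w =>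
      a (fun i => w (Fin.cast h (Fin.castAdd (l + 1) i))) *
      (-1) ^ (i : ℕ) • B (w (Fin.cast h (Fin.natAdd k i)))
        (i.removeNth fun j => w (Fin.cast h (Fin.natAdd k j)))) v =
      (-1) ^ k * altSum (fun w => a (fun i => w (Fin.cast h₁ (Fin.castAdd l i.succ))) *
        B (w 0) (fun j => w (Fin.cast h₁ (Fin.natAdd (k + 1) j)))) v := by
    intro i
    have hp := altSum_perm (fun w : Fin (m + 1) → E =>
      a (fun i => w (Fin.cast h₁ (Fin.castAdd l i.succ))) *
        B (w 0) (fun j => w (Fin.cast h₁ (Fin.natAdd (k + 1) j))))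
      (Fin.cast h (Fin.natAdd k i)).cycleRange.symm v
    rw [sign_cycleRange_symm] at hp
    have h1 : ((-1 : ℝ) ^ (i : ℕ)) * (-1) ^ (i : ℕ) = 1 := by
      rw [← mul_pow]; norm_num
    have h2 := congrArg (fun t => (-1 : ℝ) ^ (i : ℕ) * t) hp
    simp only [Fin.val_cast, Fin.val_natAdd] at h2
    rw [pow_add, mul_comm ((-1 : ℝ) ^ k), mul_assoc, ← mul_assoc, h1, one_mul,
      ← altSum_const_mul] at h2
    rw [← h2]
    congr 1
    funext w
    have e1 : ∀ j : Fin k, (Fin.cast h (Fin.natAdd k i)).cycleRange.symm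
        (Fin.cast h₁ (Fin.castAdd l j.succ)) = Fin.cast h (Fin.castAdd (l + 1) j) := by
      intro j
      have e : Fin.cast h₁ (Fin.castAdd l j.succ) = Fin.succ (⟨j, by omega⟩ : Fin m) :=
        Fin.ext (by simp)
      rw [e, Fin.cycleRange_symm_succ, Fin.succAbove_of_castSucc_lt]
      · apply Fin.ext; simp
      · simp [Fin.lt_def]; omega
    have e2 : ∀ j : Fin l, (Fin.cast h (Fin.natAdd k i)).cycleRange.symm
        (Fin.cast h₁ (Fin.natAdd (k + 1) j)) = Fin.cast h (Fin.natAdd k (i.succAbove j)) := by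
      intro j
      have e : Fin.cast h₁ (Fin.natAdd (k + 1) j) = Fin.succ (⟨k + j, by omega⟩ : Fin m) :=
        Fin.ext (by simp; omega)
      rw [e, Fin.cycleRange_symm_succ]
      apply Fin.ext
      simp only [Fin.succAbove, Fin.lt_def, Fin.val_cast, Fin.val_natAdd, Fin.val_castSucc,
        add_lt_add_iff_left]
      split_ifs <;> simp [add_assoc]
    simp only [comp_apply, Fin.cycleRange_symm_zero, e1, e2]
    rw [zsmul_eq_mul]
    push_cast
    rw [mul_left_comm]
    rfl
  rw [Finset.sum_congr rfl fun i _ => key i]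
  simp
  ring

/-- The Leibniz rule for the antisymmetrized derivative of a wedge product. -/
theorem alternatizeUncurryFin_wedgeAlt (h : k + l = m) (h₁ : k + 1 + l = m + 1)
    (h₂ : k + (l + 1) = m + 1) (a : E [⋀^Fin k]→L[ℝ] ℝ) (b : E [⋀^Fin l]→L[ℝ] ℝ)
    (A : E →L[ℝ] E [⋀^Fin k]→L[ℝ] ℝ) (B : E →L[ℝ] E [⋀^Fin l]→L[ℝ] ℝ)
    (D : E →L[ℝ] E [⋀^Fin m]→L[ℝ] ℝ)
    (hD : ∀ x, D x = wedgeAlt h (A x) b + wedgeAlt h a (B x)) :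
    ContinuousAlternatingMap.alternatizeUncurryFin D =
      wedgeAlt h₁ (ContinuousAlternatingMap.alternatizeUncurryFin A) b +
      (-1 : ℝ) ^ k • wedgeAlt h₂ a (ContinuousAlternatingMap.alternatizeUncurryFin B) := by
  ext v
  rw [ContinuousAlternatingMap.add_apply, ContinuousAlternatingMap.smul_apply, smul_eq_mul,
    wedgeAlt_eq_altSum, wedgeAlt_eq_altSum, altSum_alternatizeUncurryFin_mul,
    altSum_mul_alternatizeUncurryFin h₂ h₁, altSum_succ, altSum_succ,
    ContinuousAlternatingMap.alternatizeUncurryFin_apply]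
  simp only [hD, ContinuousAlternatingMap.add_apply, wedgeAlt_eq_altSum]
  have hs : ((-1 : ℝ) ^ k) * (-1) ^ k = 1 := by rw [← mul_pow]; norm_num
  have hk : ((k + 1).factorial : ℝ) = (k + 1) * k.factorial := by
    rw [Nat.factorial_succ]; push_cast; ring
  have hl : ((l + 1).factorial : ℝ) = (l + 1) * l.factorial := by
    rw [Nat.factorial_succ]; push_cast; ring
  -- The multiplicities `k + 1` and `l + 1` are exactly what turns the normalizations of the two
  -- derived wedge products into that of the original one.
  have hc1 : ((k + 1).factorial * l.factorial : ℝ)⁻¹ * (k + 1) =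
      (k.factorial * l.factorial : ℝ)⁻¹ := by
    rw [hk]
    have : (k + 1 : ℝ) ≠ 0 := by positivity
    have : (k.factorial : ℝ) ≠ 0 := by positivity
    have : (l.factorial : ℝ) ≠ 0 := by positivity
    field_simp
  have hc2 : (k.factorial * (l + 1).factorial : ℝ)⁻¹ * (l + 1) =
      (k.factorial * l.factorial : ℝ)⁻¹ := by
    rw [hl]
    have : (l + 1 : ℝ) ≠ 0 := by positivity
    have : (k.factorial : ℝ) ≠ 0 := by positivity
    have : (l.factorial : ℝ) ≠ 0 := by positivity
    field_simp
  rw [← mul_assoc, hc1, mul_left_comm _ ((-1 : ℝ) ^ k), ← mul_assoc ((-1 : ℝ) ^ k), hs, one_mul,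
    ← mul_assoc _ (l + 1 : ℝ), hc2, ← mul_add, ← Finset.sum_add_distrib, Finset.mul_sum]
  refine Finset.sum_congr rfl fun j _ => ?_
  rw [zsmul_eq_mul]
  push_cast
  rw [← mul_add]
  have e1 : ∀ i : Fin k, Fin.cast h₁ (Fin.castAdd l i.succ) =
      (Fin.cast h (Fin.castAdd l i)).succ := fun i => Fin.ext (by simp)
  have e2 : ∀ i : Fin l, Fin.cast h₁ (Fin.natAdd (k + 1) i) =
      (Fin.cast h (Fin.natAdd k i)).succ := fun i => Fin.ext (by simp; omega)
  simp only [e1, e2, Fin.cons_zero, Fin.cons_succ]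
  ring

end WedgeAlgebra

/-! ### Differential forms on a manifold: locality, `d² = 0`, Leibniz rule -/

section FormCalculus

variable {E : Type*} [NormedAddCommGroup E] [NormedSpace ℝ E]
  {H : Type*} [TopologicalSpace H] {I : ModelWithCorners ℝ E H}
  {M : Type*} [TopologicalSpace M] [ChartedSpace H M] {k l m : ℕ}

/-- The value of a form at a point. -/
def DForm.evalAt (x : M) : DForm I M k →ₗ[ℝ] E [⋀^Fin k]→L[ℝ] ℝ where
  toFun α := α.toFun x
  map_add' _ _ := rfl
  map_smul' _ _ := rfl

theorem DForm.sum_toFun {ι : Type*} (s : Finset ι) (α : ι → DForm I M k) (x : M) :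
    (∑ i ∈ s, α i).toFun x = ∑ i ∈ s, (α i).toFun x :=
  map_sum (DForm.evalAt x) α s

theorem localRep_eq_zero {α : M → E [⋀^Fin k]→L[ℝ] ℝ} {x₀ : M} {y : E}
    (h : α ((extChartAt I x₀).symm y) = 0) : localRep I α x₀ y = 0 := by
  rw [localRep, h]
  rfl

/-- Forms of degree greater than the dimension vanish. -/
theorem DForm.eq_zero_of_finrank_lt [FiniteDimensional ℝ E] (hk : Module.finrank ℝ E < k)
    (α : DForm I M k) : α = 0 := by
  refine DForm.ext' fun x => ContinuousAlternatingMap.ext fun v => ?_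
  refine (α.toFun x).toAlternatingMap.map_linearDependent v fun hv => ?_
  have := hv.fintype_card_le_finrank
  rw [Fintype.card_fin] at this
  omega

section Scalar

variable [IsManifold I ∞ M]

theorem contDiffOn_comp_extChartAt_symm {f : M → ℝ} (hf : ContMDiff I 𝓘(ℝ, ℝ) ∞ f) (x₀ : M) :
    ContDiffOn ℝ ∞ (fun y => f ((extChartAt I x₀).symm y)) (extChartAt I x₀).target := by
  rw [← contMDiffOn_iff_contDiffOn]
  exact hf.comp_contMDiffOn (contMDiffOn_extChartAt_symm x₀)

/-- The product of a form and a smooth function. -/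
def DForm.fsmul (f : M → ℝ) (hf : ContMDiff I 𝓘(ℝ, ℝ) ∞ f) (α : DForm I M k) : DForm I M k where
  toFun x := f x • α.toFun x
  smooth x₀ := (contDiffOn_comp_extChartAt_symm hf x₀).smul (α.smooth x₀)

/-- On a compact space a locally finite family has only finitely many nonzero members, so `finsum`
can be traded for a sum over one fixed finite set. -/
theorem exists_finset_partition [T2Space M] [CompactSpace M] {ι : Type*}
    (ρ : SmoothPartitionOfUnity ι I M univ) :
    ∃ s : Finset ι, (∀ i, i ∉ s → ∀ x, ρ i x = 0) ∧ ∀ x, ∑ i ∈ s, ρ i x = 1 := by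
  have hfin := ρ.locallyFinite.finite_nonempty_of_compact
  refine ⟨hfin.toFinset, fun i hi x => ?_, fun x => ?_⟩
  · by_contra hx
    exact hi (hfin.mem_toFinset.2 ⟨x, hx⟩)
  · rw [← ρ.sum_eq_one (mem_univ x), finsum_eq_sum_of_support_subset]
    intro i hi
    exact hfin.mem_toFinset.2 ⟨x, hi⟩

theorem DForm.sum_fsmul {ι : Type*} (ρ : SmoothPartitionOfUnity ι I M univ) (s : Finset ι)
    (hs : ∀ x, ∑ i ∈ s, ρ i x = 1) (α : DForm I M k) :
    ∑ i ∈ s, DForm.fsmul (ρ i) (ρ i).contMDiff α = α := by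
  refine DForm.ext' fun x => ?_
  rw [DForm.sum_toFun]
  change ∑ i ∈ s, ρ i x • α.toFun x = α.toFun x
  rw [← Finset.sum_smul, hs, one_smul]

end Scalar

section Derivative

variable [IsManifold I ∞ M]

/-- The exterior derivative is a local operator: agreement near `x` pulls back through the inverse
chart to agreement of local expressions near the image of `x`, within the range of the model. -/
theorem DForm.d_toFun_congr {α β : DForm I M k} {x : M}
    (h : ∀ᶠ z in 𝓝 x, α.toFun z = β.toFun z) : (DForm.d α).toFun x = (DForm.d β).toFun x := by
  have hr : extChartAt I x x ∈ range I := mem_range_self _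
  refine Filter.EventuallyEq.extDerivWithin_eq_of_mem ?_ hr
  have h2 : Filter.Tendsto (extChartAt I x).symm (𝓝[range I] (extChartAt I x x)) (𝓝 x) := by
    have h3 := (continuousOn_extChartAt_symm (I := I) x).continuousWithinAt (mem_extChartAt_target x)
    have h4 := h3.mono_of_mem_nhdsWithin (extChartAt_target_mem_nhdsWithin (I := I) x)
    have h5 := h4.tendsto
    rwa [extChartAt_to_inv] at h5
  filter_upwards [h2.eventually h] with y hy
  simp only [localRep, hy]

theorem DForm.d_toFun_eq_zero {α : DForm I M k} {x : M}
    (h : ∀ᶠ z in 𝓝 x, α.toFun z = 0) : (DForm.d α).toFun x = 0 := by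
  rw [DForm.d_toFun_congr (β := 0) h, map_zero]
  rfl

/-- By `localRep_dFun` the local expression of `dα` is, on a whole neighbourhood and not just at the
point, the exterior derivative of that of `α`; the vector space identity then applies. -/
theorem DForm.d_d (α : DForm I M k) : DForm.d (DForm.d α) = 0 := by
  refine DForm.ext' fun x => ?_
  have hr : extChartAt I x x ∈ range I := mem_range_self _
  change extDerivWithin (localRep I α.dFun x) (range I) (extChartAt I x x) = 0
  have h1 : localRep I α.dFun x =ᶠ[𝓝[range I] (extChartAt I x x)]
      extDerivWithin (localRep I α.toFun x) (range I) := by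
    filter_upwards [extChartAt_target_mem_nhdsWithin (I := I) x] with y hy
    exact α.localRep_dFun hy
  rw [h1.extDerivWithin_eq_of_mem hr]
  exact extDerivWithin_extDerivWithin_apply (r := ∞)
    (α.contDiffWithinAt_localRep (mem_extChartAt_target x)) (by simp; exact ENat.LEInfty.out)
    I.uniqueDiffOn (I.range_subset_closure_interior hr) hr

/-- Evaluated on fixed vectors, the wedge product is a finite sum of products of scalar functions,
to which the ordinary product rule applies. -/
theorem fderivWithin_wedgeAlt {w : E → E [⋀^Fin k]→L[ℝ] ℝ} {u : E → E [⋀^Fin l]→L[ℝ] ℝ}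
    {s : Set E} {y : E} (hs : UniqueDiffWithinAt ℝ s y) (h : k + l = m)
    (hw : DifferentiableWithinAt ℝ w s y) (hu : DifferentiableWithinAt ℝ u s y)
    (hwu : DifferentiableWithinAt ℝ (fun z => wedgeAlt h (w z) (u z)) s y) (x : E) :
    fderivWithin ℝ (fun z => wedgeAlt h (w z) (u z)) s y x =
      wedgeAlt h (fderivWithin ℝ w s y x) (u y) + wedgeAlt h (w y) (fderivWithin ℝ u s y x) := by
  have happ : ∀ {r : ℕ} {f : E → E [⋀^Fin r]→L[ℝ] ℝ} (v : Fin r → E),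
      DifferentiableWithinAt ℝ f s y →
      HasFDerivWithinAt (fun z => f z v)
        ((ContinuousAlternatingMap.apply ℝ E ℝ v).comp (fderivWithin ℝ f s y)) s y := fun v hf =>
    (ContinuousAlternatingMap.apply ℝ E ℝ v).hasFDerivAt.comp_hasFDerivWithinAt y
      hf.hasFDerivWithinAt
  ext v
  have h1 := (happ v hwu).fderivWithin hs
  have h2 := (HasFDerivWithinAt.fun_sum (u := Finset.univ) fun (σ : Equiv.Perm (Fin m)) _ =>
      ((happ (fun i => v (σ (Fin.cast h (Fin.castAdd l i)))) hw).mul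
        (happ (fun j => v (σ (Fin.cast h (Fin.natAdd k j)))) hu)).const_mul
          ((Equiv.Perm.sign σ : ℤ) : ℝ)).const_mul ((k.factorial * l.factorial : ℝ)⁻¹)
  simp only [wedgeAlt_apply] at h1
  have h3 := DFunLike.congr_fun (h1.symm.trans (h2.fderivWithin hs)) x
  refine h3.trans ?_
  simp only [_root_.smul_apply, _root_.add_apply, smul_eq_mul,
    _root_.sum_apply, ContinuousLinearMap.comp_apply,
    ContinuousAlternatingMap.add_apply, wedgeAlt_apply, ← mul_add, ← Finset.sum_add_distrib]
  congr 1
  refine Finset.sum_congr rfl fun σ _ => ?_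
  congr 1
  rw [add_comm]
  congr 1
  exact mul_comm _ _

variable [FiniteDimensional ℝ E]

theorem DForm.wedge_toFun (h : k + l = m) (α : DForm I M k) (β : DForm I M l) (x : M) :
    (DForm.wedge h α β).toFun x = wedgeAlt h (α.toFun x) (β.toFun x) := rfl

theorem DForm.localRep_wedge (h : k + l = m) (α : DForm I M k) (β : DForm I M l) (x₀ : M) (y : E) :
    localRep I (DForm.wedge h α β).toFun x₀ y =
      wedgeAlt h (localRep I α.toFun x₀ y) (localRep I β.toFun x₀ y) :=
  wedgeAlt_comp h _ _ _

theorem DForm.wedge_comm (h : k + l = m) (h' : l + k = m) (α : DForm I M k) (β : DForm I M l) :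
    DForm.wedge h' β α = (-1 : ℝ) ^ (k * l) • DForm.wedge h α β :=
  DForm.ext' fun _ => wedgeAlt_comm h h' _ _

/-- The Leibniz rule. -/
theorem DForm.d_wedge (h : k + l = m) (h₁ : k + 1 + l = m + 1) (h₂ : k + (l + 1) = m + 1)
    (α : DForm I M k) (β : DForm I M l) :
    DForm.d (DForm.wedge h α β) = DForm.wedge h₁ (DForm.d α) β +
      (-1 : ℝ) ^ k • DForm.wedge h₂ α (DForm.d β) := by
  refine DForm.ext' fun x => ?_
  have hr : extChartAt I x x ∈ range I := mem_range_self _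
  have ht : extChartAt I x x ∈ (extChartAt I x).target := mem_extChartAt_target x
  have hD := fderivWithin_wedgeAlt (I.uniqueDiffOn _ hr) h
    ((α.contDiffWithinAt_localRep ht).differentiableWithinAt (by simp))
    ((β.contDiffWithinAt_localRep ht).differentiableWithinAt (by simp))
    (((DForm.wedge h α β).contDiffWithinAt_localRep ht).congr_of_eventuallyEq_of_mem
      (Filter.Eventually.of_forall fun y => (DForm.localRep_wedge h α β x y).symm) hr
      |>.differentiableWithinAt (by simp))
  rw [localRep_self, localRep_self] at hD
  have e : localRep I (DForm.wedge h α β).toFun x =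
      fun y => wedgeAlt h (localRep I α.toFun x y) (localRep I β.toFun x y) :=
    funext fun y => DForm.localRep_wedge h α β x y
  change ContinuousAlternatingMap.alternatizeUncurryFin (fderivWithin ℝ
    (localRep I (DForm.wedge h α β).toFun x) (range I) (extChartAt I x x)) = _
  rw [e]
  exact alternatizeUncurryFin_wedgeAlt h h₁ h₂ _ _ _ _ _ hD

end Derivative

end FormCalculus

/-! ### Naturality of `∧` and `d`, and pullback along locally defined maps -/

section PullbackCalculus

variable {E : Type*} [NormedAddCommGroup E] [NormedSpace ℝ E] [FiniteDimensional ℝ E]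
  {H : Type*} [TopologicalSpace H] {I : ModelWithCorners ℝ E H}
  {M : Type*} [TopologicalSpace M] [ChartedSpace H M] [IsManifold I ∞ M]
  {E' : Type*} [NormedAddCommGroup E'] [NormedSpace ℝ E'] [FiniteDimensional ℝ E']
  {H' : Type*} [TopologicalSpace H'] {J : ModelWithCorners ℝ E' H'}
  {N : Type*} [TopologicalSpace N] [ChartedSpace H' N] [IsManifold J ∞ N] {k l m : ℕ}

theorem DForm.pullback_wedge (f : N → M) (hf : ContMDiff J I ∞ f) (h : k + l = m)
    (α : DForm I M k) (β : DForm I M l) :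
    DForm.pullback f hf (DForm.wedge h α β) =
      DForm.wedge h (DForm.pullback f hf α) (DForm.pullback f hf β) :=
  DForm.ext' fun _ => wedgeAlt_comp h _ _ _

/-- In the charts at `p` and `f p` the pullback of a form is the pullback of its local expression
along the chart expression of `f`, so the vector space statement suffices. -/
theorem DForm.pullback_d (f : N → M) (hf : ContMDiff J I ∞ f) (α : DForm I M k) :
    DForm.pullback f hf (DForm.d α) = DForm.d (DForm.pullback f hf α) := by
  refine DForm.ext' fun p => ?_
  set y := extChartAt J p p
  have hyr : y ∈ range J := mem_range_self _
  have hy : y ∈ (extChartAt J p).target := mem_extChartAt_target p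
  have hp : (extChartAt J p).symm y = p := extChartAt_to_inv p
  have hx : f ((extChartAt J p).symm y) ∈ (extChartAt I (f p)).source := by
    rw [hp]; exact mem_extChartAt_source _
  have ht : (extChartAt I (f p) ∘ f ∘ (extChartAt J p).symm) y ∈ (extChartAt I (f p)).target :=
    (extChartAt I (f p)).map_source hx
  have hsF : MapsTo (extChartAt I (f p) ∘ f ∘ (extChartAt J p).symm) (range J) (range I) :=
    fun y' _ => ⟨chartAt H (f p) (f ((extChartAt J p).symm y')), rfl⟩
  have h1 : localRep J (DForm.pullback f hf α).toFun p =ᶠ[𝓝[range J] y] fun y' =>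
      (localRep I α.toFun (f p)
        ((extChartAt I (f p) ∘ f ∘ (extChartAt J p).symm) y')).compContinuousLinearMap
        (fderivWithin ℝ (extChartAt I (f p) ∘ f ∘ (extChartAt J p).symm) (range J) y') := by
    filter_upwards [eventually_chartMap hf hy hx] with y' h
    exact localRep_pullback hf α.toFun h.1 h.2
  rw [← localRep_self (I := J) (DForm.pullback f hf (DForm.d α)).toFun p]
  have h2 := localRep_pullback hf (DForm.d α).toFun hy hx
  refine Eq.trans h2 ?_
  change _ = extDerivWithin (localRep J (DForm.pullback f hf α).toFun p) (range J) y
  rw [h1.extDerivWithin_eq_of_mem hyr, extDerivWithin_pullback (t := range I) (r := 2)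
    ((α.contDiffWithinAt_localRep ht).differentiableWithinAt (by simp))
    ((contDiffWithinAt_chartMap hf hy hx).of_le ENat.LEInfty.out) (by simp) J.uniqueDiffOn
    (J.range_subset_closure_interior hyr) hyr hsF]
  congr 1
  exact α.localRep_dFun ht

section Local

variable {f : N → M} {U : Set N}

/-- Charts and local retractions onto the boundary are smooth only on open sets; this and the
following lemmas are the counterparts, for such maps, of the facts about globally smooth ones. -/
theorem contDiffWithinAt_chartMap_of_contMDiffOn (hU : IsOpen U) (hf : ContMDiffOn J I ∞ f U)
    {p₀ : N} {x₀ : M} {y : E'} (hy : y ∈ (extChartAt J p₀).target)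
    (hyU : (extChartAt J p₀).symm y ∈ U)
    (hx : f ((extChartAt J p₀).symm y) ∈ (extChartAt I x₀).source) :
    ContDiffWithinAt ℝ ∞ (extChartAt I x₀ ∘ f ∘ (extChartAt J p₀).symm) (range J) y := by
  have h1 : (extChartAt J p₀).symm y ∈ (chartAt H' p₀).source := by
    rw [← extChartAt_source J]; exact (extChartAt J p₀).map_target hy
  rw [extChartAt_source] at hx
  have h := ((contMDiffAt_iff_of_mem_source h1 hx).1 (hf.contMDiffAt (hU.mem_nhds hyU))).2
  rwa [(extChartAt J p₀).right_inv hy] at h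

theorem eventually_chartMap_of_contMDiffOn (hU : IsOpen U) (hf : ContMDiffOn J I ∞ f U)
    {p₀ : N} {x₀ : M} {y : E'} (hy : y ∈ (extChartAt J p₀).target)
    (hyU : (extChartAt J p₀).symm y ∈ U)
    (hx : f ((extChartAt J p₀).symm y) ∈ (extChartAt I x₀).source) :
    ∀ᶠ y' in 𝓝[range J] y, y' ∈ (extChartAt J p₀).target ∧ (extChartAt J p₀).symm y' ∈ U ∧
      f ((extChartAt J p₀).symm y') ∈ (extChartAt I x₀).source := by
  have h1 : (extChartAt J p₀).target ∈ 𝓝[range J] y := extChartAt_target_mem_nhdsWithin_of_mem hy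
  have h0 : ContinuousWithinAt (extChartAt J p₀).symm (range J) y :=
    ((continuousOn_extChartAt_symm p₀) y hy).mono_of_mem_nhdsWithin h1
  have h2 : ContinuousWithinAt (f ∘ (extChartAt J p₀).symm) (range J) y :=
    (hf.continuousOn.continuousAt (hU.mem_nhds hyU)).comp_continuousWithinAt h0
  exact Filter.Eventually.and h1 (Filter.Eventually.and (h0 (hU.mem_nhds hyU))
    (h2 ((isOpen_extChartAt_source (I := I) x₀).mem_nhds hx)))

/-- The chain rule for the expression of the differential of a map in charts. -/
theorem tangentMapAt_comp_fderivWithin_trans (hU : IsOpen U) (hf : ContMDiffOn J I ∞ f U)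
    {p₀ : N} {x₀ : M} {y : E'} (hy : y ∈ (extChartAt J p₀).target)
    (hyU : (extChartAt J p₀).symm y ∈ U)
    (hx : f ((extChartAt J p₀).symm y) ∈ (extChartAt I x₀).source) {q : N} {z : M}
    (hq : q = (extChartAt J p₀).symm y) (hz : z = f q) :
    (tangentMapAt I J f q).comp (fderivWithin ℝ (trans J p₀ q) (range J) y) =
      (fderivWithin ℝ (trans I x₀ z) (range I)
        ((extChartAt I x₀ ∘ f ∘ (extChartAt J p₀).symm) y)).comp
        (fderivWithin ℝ (extChartAt I x₀ ∘ f ∘ (extChartAt J p₀).symm) (range J) y) := by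
  have hyr : y ∈ range J := extChartAt_target_subset_range p₀ hy
  have hu : UniqueDiffWithinAt ℝ (range J) y := J.uniqueDiffOn y hyr
  have hsF : MapsTo (extChartAt I x₀ ∘ f ∘ (extChartAt J p₀).symm) (range J) (range I) :=
    fun y' _ => ⟨chartAt H x₀ (f ((extChartAt J p₀).symm y')), rfl⟩
  have hp : (extChartAt I x₀).symm ((extChartAt I x₀ ∘ f ∘ (extChartAt J p₀).symm) y) =
      f ((extChartAt J p₀).symm y) := (extChartAt I x₀).left_inv hx
  have ht : (extChartAt I x₀ ∘ f ∘ (extChartAt J p₀).symm) y ∈ (extChartAt I x₀).target :=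
    (extChartAt I x₀).map_source hx
  have hF := (contDiffWithinAt_chartMap_of_contMDiffOn hU hf hy hyU hx).differentiableWithinAt
    (by simp)
  have hqs : (extChartAt J p₀).symm y ∈ (extChartAt J q).source := by
    rw [← hq]; exact mem_extChartAt_source q
  have hty : trans J p₀ q y = extChartAt J q q := by
    simp only [trans, Function.comp_apply]; rw [← hq]
  have hzs : (extChartAt I x₀).symm ((extChartAt I x₀ ∘ f ∘ (extChartAt J p₀).symm) y) ∈
      (extChartAt I z).source := by
    rw [hp, ← hq, ← hz]; exact mem_extChartAt_source z
  have hmd : MDifferentiableAt J I f q :=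
    (hf.contMDiffAt (hU.mem_nhds (by rwa [hq]))).mdifferentiableAt (by simp)
  have hG : DifferentiableWithinAt ℝ (writtenInExtChartAt J I q f) (range J)
      (trans J p₀ q y) := by
    rw [hty]; exact hmd.differentiableWithinAt_writtenInExtChartAt
  have e1 : tangentMapAt I J f q =
      fderivWithin ℝ (writtenInExtChartAt J I q f) (range J) (trans J p₀ q y) := by
    rw [hty]; exact hmd.mfderiv
  rw [e1, ← fderivWithin_comp y hG
    ((contDiffWithinAt_trans J hy hqs).differentiableWithinAt (by simp)) (mapsTo_trans J p₀ q) hu,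
    ← fderivWithin_comp y ((contDiffWithinAt_trans I ht hzs).differentiableWithinAt (by simp))
    hF hsF hu]
  refine Filter.EventuallyEq.fderivWithin_eq_of_mem ?_ hyr
  filter_upwards [eventually_mem_source J hy hqs,
    eventually_chartMap_of_contMDiffOn hU hf hy hyU hx] with y' h1 h2
  simp only [writtenInExtChartAt, trans, Function.comp_apply]
  rw [(extChartAt J q).left_inv h1.2, (extChartAt I x₀).left_inv h2.2.2, hz]

theorem localRep_pullback_of_contMDiffOn (hU : IsOpen U) (hf : ContMDiffOn J I ∞ f U)
    (α : M → E [⋀^Fin k]→L[ℝ] ℝ) {p₀ : N} {x₀ : M} {y : E'} (hy : y ∈ (extChartAt J p₀).target)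
    (hyU : (extChartAt J p₀).symm y ∈ U)
    (hx : f ((extChartAt J p₀).symm y) ∈ (extChartAt I x₀).source) :
    localRep J (fun p => (α (f p)).compContinuousLinearMap (tangentMapAt I J f p)) p₀ y =
      (localRep I α x₀ ((extChartAt I x₀ ∘ f ∘ (extChartAt J p₀).symm) y)).compContinuousLinearMap
        (fderivWithin ℝ (extChartAt I x₀ ∘ f ∘ (extChartAt J p₀).symm) (range J) y) := by
  have hp : (extChartAt I x₀).symm ((extChartAt I x₀ ∘ f ∘ (extChartAt J p₀).symm) y) =
      f ((extChartAt J p₀).symm y) := (extChartAt I x₀).left_inv hx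
  unfold localRep
  rw [hp]
  have h := tangentMapAt_comp_fderivWithin_trans hU hf hy hyU hx rfl rfl
  ext v
  simp only [ContinuousAlternatingMap.compContinuousLinearMap_apply]
  congr 1
  funext i
  exact DFunLike.congr_fun h (v i)

/-- The pullback of a form along a smooth map defined on an open set, multiplied by a smooth
function with support in this set. -/
def DForm.cutoffPullback (hU : IsOpen U) (hf : ContMDiffOn J I ∞ f U) (ρ : N → ℝ)
    (hρ : ContMDiff J 𝓘(ℝ, ℝ) ∞ ρ) (hsupp : tsupport ρ ⊆ U) (α : DForm I M k) : DForm J N k where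
  toFun p := ρ p • (α.toFun (f p)).compContinuousLinearMap (tangentMapAt I J f p)
  smooth p₀ := by
    intro y hy
    have hyr : y ∈ range J := extChartAt_target_subset_range p₀ hy
    refine ContDiffWithinAt.mono ?_ (extChartAt_target_subset_range p₀)
    by_cases hyU : (extChartAt J p₀).symm y ∈ U
    · set x₀ := f ((extChartAt J p₀).symm y) with hx₀
      have hx : f ((extChartAt J p₀).symm y) ∈ (extChartAt I x₀).source := mem_extChartAt_source x₀
      have hsF : MapsTo (extChartAt I x₀ ∘ f ∘ (extChartAt J p₀).symm) (range J) (range I) :=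
        fun y' _ => ⟨chartAt H x₀ (f ((extChartAt J p₀).symm y')), rfl⟩
      have ht : (extChartAt I x₀ ∘ f ∘ (extChartAt J p₀).symm) y ∈ (extChartAt I x₀).target :=
        (extChartAt I x₀).map_source hx
      have hF := contDiffWithinAt_chartMap_of_contMDiffOn hU hf hy hyU hx
      have h1 := (α.contDiffWithinAt_localRep ht).comp y hF hsF
      have h2 := hF.fderivWithin_right (m := ∞) J.uniqueDiffOn (by simp) hyr
      have h3 := (contDiffOn_comp_extChartAt_symm hρ p₀ y hy).mono_of_mem_nhdsWithin
        (extChartAt_target_mem_nhdsWithin_of_mem hy)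
      refine (h3.smul (contDiffWithinAt_formComp h1 h2)).congr_of_eventuallyEq_of_mem ?_ hyr
      filter_upwards [eventually_chartMap_of_contMDiffOn hU hf hy hyU hx] with y' h
      have h4 := localRep_pullback_of_contMDiffOn hU hf α.toFun h.1 h.2.1 h.2.2
      exact congrArg (fun t => ρ ((extChartAt J p₀).symm y') • t) h4
    -- Outside `U` nothing is known about `f`, but the closed support of `ρ` lies in `U`, so the
    -- form vanishes on a neighbourhood.
    · have h0 : (extChartAt J p₀).symm y ∈ (tsupport ρ)ᶜ := fun h => hyU (hsupp h)
      have h1 : ContinuousWithinAt (extChartAt J p₀).symm (range J) y :=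
        ((continuousOn_extChartAt_symm p₀) y hy).mono_of_mem_nhdsWithin
          (extChartAt_target_mem_nhdsWithin_of_mem hy)
      refine ContDiffWithinAt.congr_of_eventuallyEq_of_mem (contDiffWithinAt_const (c := 0)) ?_ hyr
      filter_upwards [h1 ((isClosed_tsupport ρ).isOpen_compl.mem_nhds h0)] with y' hy'
      refine localRep_eq_zero ?_
      rw [image_eq_zero_of_notMem_tsupport hy', zero_smul]

end Local

end PullbackCalculus

/-! ### Computing integrals in arbitrary coordinates -/

section IntegralCoordinates

variable {n : ℕ} {H : Type*} [TopologicalSpace H]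
  {I : ModelWithCorners ℝ (EuclideanSpace ℝ (Fin n)) H}
  {M : Type*} [TopologicalSpace M] [ChartedSpace H M]

variable (I) in
theorem measurableSet_extChartAt_target (c : M) : MeasurableSet (extChartAt I c).target := by
  rw [extChartAt_target]
  exact (((chartAt H c).open_target.preimage I.continuous_symm).measurableSet).inter
    I.isClosed_range.measurableSet

theorem measurableSet_target_inter_preimage (c : M) {s : Set M} (hs : IsOpen s) :
    MeasurableSet ((extChartAt I c).target ∩ (extChartAt I c).symm ⁻¹' s) := by
  obtain ⟨t, ht, h⟩ := continuousOn_iff'.1 (continuousOn_extChartAt_symm (I := I) c) s hs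
  rw [inter_comm, h]
  exact ht.measurableSet.inter (measurableSet_extChartAt_target I c)

variable [IsManifold I ∞ M] [T2Space M] [CompactSpace M]

theorem chartPartition_eq_zero {p x : M} (hx : x ∉ (extChartAt I p).source) :
    chartPartition I M p x = 0 := by
  by_contra h
  refine hx ?_
  rw [extChartAt_source]
  exact chartPartition_isSubordinate I M p (subset_tsupport _ h)

/-- The integral of a form supported in the domain of a system of coordinates `e` is the integral
of its expression in these coordinates. -/
theorem integral_eq_setIntegral (γ : DForm I M n) (e : PartialEquiv M (EuclideanSpace ℝ (Fin n)))
    (hsrc : IsOpen e.source) (htgt : MeasurableSet e.target)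
    (hsymm : ContinuousOn e.symm e.target) (u : EuclideanSpace ℝ (Fin n) → ℝ)
    (hu : MeasureTheory.IntegrableOn u e.target) (hsupp : ∀ x ∉ e.source, γ.toFun x = 0)
    (D : M → EuclideanSpace ℝ (Fin n) →
      EuclideanSpace ℝ (Fin n) →L[ℝ] EuclideanSpace ℝ (Fin n))
    (hD : ∀ p, ∀ y ∈ (extChartAt I p).target, (extChartAt I p).symm y ∈ e.source →
      HasFDerivWithinAt (e ∘ (extChartAt I p).symm) (D p y)
        ((extChartAt I p).target ∩ (extChartAt I p).symm ⁻¹' e.source) y)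
    (hγ : ∀ p, ∀ y ∈ (extChartAt I p).target, (extChartAt I p).symm y ∈ e.source →
      localRep I γ.toFun p y (fun i => EuclideanSpace.single i 1) =
        |(D p y).det| * u (e ((extChartAt I p).symm y))) :
    integral γ = ∫ z in e.target, u z := by
  obtain ⟨s, hs0, hs1⟩ := exists_finset_partition (chartPartition I M)
  have hint : ∀ p : M, MeasureTheory.IntegrableOn
      (fun z => chartPartition I M p (e.symm z) * u z) e.target := by
    intro p
    refine MeasureTheory.Integrable.bdd_mul (c := 1) hu ?_ ?_
    · exact ((chartPartition I M p).contMDiff.continuous.comp_continuousOn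
        hsymm).aestronglyMeasurable htgt
    · refine Filter.Eventually.of_forall fun z => ?_
      rw [Real.norm_of_nonneg ((chartPartition I M).nonneg p _)]
      exact (chartPartition I M).le_one p _
  -- For each member of the partition both integrals reduce to the overlap of the two coordinate
  -- domains and are related there by the change of variables formula. The absolute value in `hγ`
  -- allows orientation-reversing coordinates, as needed for boundary charts.
  have key : ∀ p : M, ∫ y in (extChartAt I p).target, chartIntegrand γ p y =
      ∫ z in e.target, chartPartition I M p (e.symm z) * u z := by
    intro p
    set S := (extChartAt I p).target ∩ (extChartAt I p).symm ⁻¹' e.source with hS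
    have hSm : MeasurableSet S := measurableSet_target_inter_preimage p hsrc
    have hinj : InjOn (e ∘ (extChartAt I p).symm) S := by
      intro y hy y' hy' h
      exact (extChartAt I p).symm.injOn hy.1 hy'.1 (e.injOn hy.2 hy'.2 h)
    have himg : (e ∘ (extChartAt I p).symm) '' S ⊆ e.target := by
      rintro _ ⟨y, hy, rfl⟩
      exact e.map_source hy.2
    rw [MeasureTheory.setIntegral_eq_of_subset_of_forall_sdiff_eq_zero htgt himg,
      MeasureTheory.integral_image_eq_integral_abs_det_fderiv_smul _ hSm
        (fun y hy => hD p y hy.1 hy.2) hinj,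
      MeasureTheory.setIntegral_eq_of_subset_of_forall_sdiff_eq_zero
        (measurableSet_extChartAt_target I p) (inter_subset_left : S ⊆ _)]
    · refine MeasureTheory.setIntegral_congr_fun hSm fun y hy => ?_
      simp only [chartIntegrand, comp_apply, smul_eq_mul]
      rw [hγ p y hy.1 hy.2, e.left_inv hy.2]
      ring
    · intro y hy
      have h0 : (extChartAt I p).symm y ∉ e.source := fun h => hy.2 ⟨hy.1, h⟩
      rw [chartIntegrand, localRep_eq_zero (hsupp _ h0)]
      simp
    · intro z hz
      rw [chartPartition_eq_zero, zero_mul]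
      intro hzs
      refine hz.2 ⟨extChartAt I p (e.symm z), ⟨(extChartAt I p).map_source hzs, ?_⟩, ?_⟩
      · rw [mem_preimage, (extChartAt I p).left_inv hzs]
        exact e.map_target hz.1
      · rw [comp_apply, (extChartAt I p).left_inv hzs, e.right_inv hz.1]
  change ∑ᶠ p : M, ∫ y in (extChartAt I p).target, chartIntegrand γ p y = _
  simp only [key]
  rw [finsum_eq_sum_of_support_subset (s := s), ← MeasureTheory.integral_finsetSum _
    fun p _ => hint p]
  · refine MeasureTheory.setIntegral_congr_fun htgt fun z _ => ?_
    rw [← Finset.sum_mul, hs1, one_mul]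
  · intro p hp
    by_contra hps
    exact hp (by simp [hs0 p hps])

/-- Alternating maps of top degree are multiples of the determinant, which is multiplicative under
composition with `L`. -/
theorem alternatingMap_apply_comp (a : EuclideanSpace ℝ (Fin n) [⋀^Fin n]→ₗ[ℝ] ℝ)
    (L : EuclideanSpace ℝ (Fin n) →L[ℝ] EuclideanSpace ℝ (Fin n))
    (w : Fin n → EuclideanSpace ℝ (Fin n)) : a (fun i => L (w i)) = L.det * a w := by
  set b := (EuclideanSpace.basisFun (Fin n) ℝ).toBasis with hb
  have h : ∀ v, a v = a b * b.det v := fun v =>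
    AlternatingMap.congr_fun (AlternatingMap.eq_smul_basis_det b a) v
  rw [h, h w, mul_left_comm]
  exact congrArg (a b * ·) (b.det_comp L.toLinearMap w)

theorem compContinuousLinearMap_apply_single {a : EuclideanSpace ℝ (Fin n) [⋀^Fin n]→L[ℝ] ℝ}
    (L : EuclideanSpace ℝ (Fin n) →L[ℝ] EuclideanSpace ℝ (Fin n)) :
    a.compContinuousLinearMap L (fun i => EuclideanSpace.single i 1) =
      L.det * a (fun i => EuclideanSpace.single i 1) :=
  alternatingMap_apply_comp a.toAlternatingMap L _

/-- The integral of a form supported in a chart domain is computed in this chart. -/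
theorem integral_eq_of_support_subset (hM : IsOrientedAtlas I M) (γ : DForm I M n) (c : M)
    (hint : MeasureTheory.IntegrableOn
      (fun y => localRep I γ.toFun c y (fun i => EuclideanSpace.single i 1)) (extChartAt I c).target)
    (hsupp : ∀ x ∉ (extChartAt I c).source, γ.toFun x = 0) :
    integral γ = ∫ y in (extChartAt I c).target,
      localRep I γ.toFun c y (fun i => EuclideanSpace.single i 1) := by
  refine integral_eq_setIntegral γ (extChartAt I c) (isOpen_extChartAt_source c)
    (measurableSet_extChartAt_target I c) (continuousOn_extChartAt_symm c) _ hint hsupp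
    (fun p y => fderivWithin ℝ (trans I p c) (range I) y) ?_ ?_
  · intro p y hy hyc
    exact ((contDiffWithinAt_trans I hy hyc).differentiableWithinAt
      (by simp)).hasFDerivWithinAt.mono
      (inter_subset_left.trans (extChartAt_target_subset_range p))
  · intro p y hy hyc
    rw [localRep_trans I γ.toFun hy hyc, compContinuousLinearMap_apply_single, abs_of_pos (hM p c y hy hyc)]
    rfl

end IntegralCoordinates

/-! ### Stokes' theorem on Euclidean space and on the half space -/

section LocalStokes

open MeasureTheory

variable {n : ℕ}

/-- The inclusion `z ↦ (0, z)` of the boundary hyperplane of the half space. -/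
def consZero (n : ℕ) : EuclideanSpace ℝ (Fin n) →L[ℝ] EuclideanSpace ℝ (Fin (n + 1)) :=
  LinearMap.toContinuousLinearMap
    { toFun := fun z => WithLp.toLp 2 (Fin.cons 0 z.ofLp)
      map_add' := fun z z' => by
        ext i; refine Fin.cases ?_ (fun j => ?_) i <;> simp
      map_smul' := fun c z => by
        ext i; refine Fin.cases ?_ (fun j => ?_) i <;> simp }

@[simp] theorem consZero_zero (z : EuclideanSpace ℝ (Fin n)) : consZero n z 0 = 0 := rfl

@[simp] theorem consZero_succ (z : EuclideanSpace ℝ (Fin n)) (i : Fin n) :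
    consZero n z i.succ = z i := rfl

/-- The projection `(t, z) ↦ z`. -/
def tailL (n : ℕ) : EuclideanSpace ℝ (Fin (n + 1)) →L[ℝ] EuclideanSpace ℝ (Fin n) :=
  LinearMap.toContinuousLinearMap
    { toFun := fun y => WithLp.toLp 2 (fun i => y i.succ)
      map_add' := fun _ _ => rfl
      map_smul' := fun _ _ => rfl }

@[simp] theorem tailL_apply (y : EuclideanSpace ℝ (Fin (n + 1))) (i : Fin n) :
    tailL n y i = y i.succ := rfl

@[simp] theorem tailL_consZero (z : EuclideanSpace ℝ (Fin n)) : tailL n (consZero n z) = z := rfl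

theorem consZero_tailL {y : EuclideanSpace ℝ (Fin (n + 1))} (h : y 0 = 0) :
    consZero n (tailL n y) = y := by
  ext i
  refine Fin.cases ?_ (fun j => ?_) i
  · rw [consZero_zero, h]
  · rfl

theorem consZero_single (j : Fin n) :
    consZero n (EuclideanSpace.single j 1) = EuclideanSpace.single j.succ 1 := by
  ext i
  refine Fin.cases ?_ (fun k => ?_) i
  · simp
  · simp

variable {w : EuclideanSpace ℝ (Fin (n + 1)) → EuclideanSpace ℝ (Fin (n + 1)) [⋀^Fin n]→L[ℝ] ℝ}
  {s : Set (EuclideanSpace ℝ (Fin (n + 1)))}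

theorem continuousOn_extDerivWithin (hw : ContDiffOn ℝ ∞ w s) (hs : UniqueDiffOn ℝ s) :
    ContinuousOn (extDerivWithin w s) s :=
  (ContinuousAlternatingMap.alternatizeUncurryFinCLM ℝ _ ℝ).continuous.comp_continuousOn
    (hw.continuousOn_fderivWithin hs (by simp))

/-- An `n`-form in dimension `n + 1` is a vector field: its `i`-th component is `(-1)^i` times the
value of `w` on the basis vectors other than `e_i`. The divergence of this field is the coefficient
of `dw`, so the divergence theorem applies. -/
theorem integral_box_extDerivWithin (hw : ContDiffOn ℝ ∞ w s) (hs : UniqueDiffOn ℝ s)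
    {a b : Fin (n + 1) → ℝ} (hab : a ≤ b) (hsub : ∀ x ∈ Icc a b, WithLp.toLp 2 x ∈ s) :
    ∫ x in Icc a b, extDerivWithin w s (WithLp.toLp 2 x) (fun i => EuclideanSpace.single i 1) =
      ∑ i : Fin (n + 1),
        ((∫ x in Icc (a ∘ i.succAbove) (b ∘ i.succAbove), (-1) ^ (i : ℕ) *
          w (WithLp.toLp 2 (i.insertNth (b i) x))
            (fun j => EuclideanSpace.single (i.succAbove j) 1)) -
        ∫ x in Icc (a ∘ i.succAbove) (b ∘ i.succAbove), (-1) ^ (i : ℕ) *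
          w (WithLp.toLp 2 (i.insertNth (a i) x))
            (fun j => EuclideanSpace.single (i.succAbove j) 1)) := by
  set L : (Fin (n + 1) → ℝ) →L[ℝ] EuclideanSpace ℝ (Fin (n + 1)) :=
    (EuclideanSpace.equiv (Fin (n + 1)) ℝ).symm.toContinuousLinearMap with hL
  have hLa : ∀ x, L x = WithLp.toLp 2 x := fun x => rfl
  have hmap : MapsTo L (Icc a b) s := hsub
  set f : Fin (n + 1) → (Fin (n + 1) → ℝ) → ℝ := fun i x => (-1) ^ (i : ℕ) *
    w (L x) (fun j => EuclideanSpace.single (i.succAbove j) 1) with hf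
  set f' : Fin (n + 1) → (Fin (n + 1) → ℝ) → (Fin (n + 1) → ℝ) →L[ℝ] ℝ := fun i x =>
    ((-1 : ℝ) ^ (i : ℕ)) • ((ContinuousAlternatingMap.apply ℝ _ ℝ
      (fun j => EuclideanSpace.single (i.succAbove j) 1)).comp
      ((fderivWithin ℝ w s (L x)).comp L)) with hf'
  have hsum : ∀ x, extDerivWithin w s (WithLp.toLp 2 x) (fun i => EuclideanSpace.single i 1) =
      ∑ i, f' i x (Pi.single i 1) := by
    intro x
    rw [extDerivWithin, ContinuousAlternatingMap.alternatizeUncurryFin_apply]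
    refine Finset.sum_congr rfl fun i _ => ?_
    rw [zsmul_eq_mul]
    push_cast
    rfl
  have hd := integral_divergence_of_hasFDerivAt_off_countable' a b hab f f' ∅ countable_empty
    ?_ ?_ ?_
  · simp only [hsum]
    exact hd
  · intro i
    refine continuousOn_const.mul ?_
    exact (ContinuousAlternatingMap.apply ℝ _ ℝ _).continuous.comp_continuousOn
      (hw.continuousOn.comp L.continuous.continuousOn hmap)
  -- Differentiability is required only in the open box. There `s` is a neighbourhood of the point,
  -- so the derivative within `s` is a genuine derivative, even if the box touches the boundary of
  -- `s`.
  · rintro x ⟨hx, -⟩ i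
    have hmem : s ∈ 𝓝 (L x) := by
      have ho : IsOpen ((EuclideanSpace.equiv (Fin (n + 1)) ℝ) ⁻¹'
          (Set.pi univ fun i => Ioo (a i) (b i))) :=
        (isOpen_set_pi finite_univ fun _ _ => isOpen_Ioo).preimage
          (EuclideanSpace.equiv (Fin (n + 1)) ℝ).continuous
      refine Filter.mem_of_superset (ho.mem_nhds hx) fun y hy => ?_
      have := hmap (show y.ofLp ∈ Icc a b from
        ⟨fun j => (hy j (mem_univ _)).1.le, fun j => (hy j (mem_univ _)).2.le⟩)
      exact this
    have h1 : HasFDerivAt w (fderivWithin ℝ w s (L x)) (L x) := by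
      rw [fderivWithin_of_mem_nhds hmem]
      exact ((hw.contDiffAt hmem).differentiableAt (by simp)).hasFDerivAt
    have h2 := (ContinuousAlternatingMap.apply ℝ _ ℝ
      (fun j => EuclideanSpace.single (i.succAbove j) (1 : ℝ))).hasFDerivAt.comp x
      (h1.comp x L.hasFDerivAt)
    exact h2.const_mul _
  · have h1 : ContinuousOn (fun x => extDerivWithin w s (L x)
        (fun i => EuclideanSpace.single i 1)) (Icc a b) :=
      (ContinuousAlternatingMap.apply ℝ _ ℝ _).continuous.comp_continuousOn
        ((continuousOn_extDerivWithin hw hs).comp L.continuous.continuousOn hmap)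
    refine (h1.congr fun x _ => (hsum x).symm).integrableOn_compact isCompact_Icc

theorem extDerivWithin_eq_zero_of_notMem {K : Set (EuclideanSpace ℝ (Fin (n + 1)))}
    (hK : IsClosed K) (h0 : ∀ y ∈ s, y ∉ K → w y = 0) {y : EuclideanSpace ℝ (Fin (n + 1))}
    (hy : y ∈ s) (hyK : y ∉ K) : extDerivWithin w s y = 0 := by
  have h : w =ᶠ[𝓝[s] y] fun _ => 0 := by
    filter_upwards [self_mem_nhdsWithin, mem_nhdsWithin_of_mem_nhds (hK.isOpen_compl.mem_nhds hyK)]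
      with z hz hzK using h0 z hz hzK
  rw [h.extDerivWithin_eq_of_mem hy, extDerivWithin, fderivWithin_const_apply]
  exact map_zero (ContinuousAlternatingMap.alternatizeUncurryFinCLM ℝ _ ℝ)

theorem exists_abs_lt_of_isCompact {m : ℕ} {K : Set (EuclideanSpace ℝ (Fin m))}
    (hK : IsCompact K) : ∃ R : ℝ, 0 < R ∧ ∀ y ∈ K, ∀ i, |y i| < R := by
  obtain ⟨R, hR0, hR⟩ := hK.isBounded.exists_pos_norm_lt
  exact ⟨R, hR0, fun y hy i => (PiLp.norm_apply_le y i).trans_lt (hR y hy)⟩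

/-- The divergence theorem concerns boxes in `Fin m → ℝ`, while charts take values in
`EuclideanSpace`; the identification of the two preserves volume. -/
theorem setIntegral_toLp {m : ℕ} (f : EuclideanSpace ℝ (Fin m) → ℝ)
    (t : Set (EuclideanSpace ℝ (Fin m))) :
    ∫ y in t, f y = ∫ x in (WithLp.toLp 2 : (Fin m → ℝ) → _) ⁻¹' t, f (WithLp.toLp 2 x) :=
  ((PiLp.volume_preserving_toLp (Fin m)).setIntegral_preimage_emb
    (MeasurableEquiv.toLp 2 (Fin m → ℝ)).measurableEmbedding f t).symm

/-- Stokes' theorem for compactly supported forms on Euclidean space. -/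
theorem integral_extDerivWithin_univ (hw : ContDiffOn ℝ ∞ w univ)
    {K : Set (EuclideanSpace ℝ (Fin (n + 1)))} (hK : IsCompact K) (h0 : ∀ y ∉ K, w y = 0) :
    ∫ y, extDerivWithin w univ y (fun i => EuclideanSpace.single i 1) = 0 := by
  obtain ⟨R, hR0, hR⟩ := exists_abs_lt_of_isCompact hK
  have hwR : ∀ x : Fin (n + 1) → ℝ, (∃ i, R ≤ |x i|) → WithLp.toLp 2 x ∉ K := by
    rintro x ⟨i, hi⟩ hx
    exact (hR _ hx i).not_ge hi
  rw [← setIntegral_univ, setIntegral_toLp, preimage_univ,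
    setIntegral_eq_of_subset_of_forall_sdiff_eq_zero MeasurableSet.univ
      (subset_univ (Icc (fun _ => -R) (fun _ => R))),
    integral_box_extDerivWithin hw uniqueDiffOn_univ (fun _ => by linarith) (fun _ _ => mem_univ _)]
  -- A coordinate equal to `±R` excludes membership in `K`, so every face term vanishes.
  · refine Finset.sum_eq_zero fun i _ => ?_
    have h1 : ∀ x : Fin n → ℝ, w (WithLp.toLp 2 (i.insertNth R x)) = 0 := fun x =>
      h0 _ (hwR _ ⟨i, by simp [le_abs_self]⟩)
    have h2 : ∀ x : Fin n → ℝ, w (WithLp.toLp 2 (i.insertNth (-R) x)) = 0 := fun x =>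
      h0 _ (hwR _ ⟨i, by simp [le_abs_self]⟩)
    simp [h1, h2]
  · rintro x ⟨-, hx⟩
    rw [extDerivWithin_eq_zero_of_notMem hK.isClosed (fun y _ => h0 y) (mem_univ _)]
    · rfl
    · refine hwR _ ?_
      by_contra! hc
      exact hx ⟨fun i => (abs_lt.1 (hc i)).1.le, fun i => (abs_lt.1 (hc i)).2.le⟩

/-- Stokes' theorem for compactly supported forms on the half space. -/
theorem integral_extDerivWithin_halfSpace (hw : ContDiffOn ℝ ∞ w {y | 0 ≤ y 0})
    (hu : UniqueDiffOn ℝ {y : EuclideanSpace ℝ (Fin (n + 1)) | 0 ≤ y 0})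
    {K : Set (EuclideanSpace ℝ (Fin (n + 1)))} (hK : IsCompact K)
    (h0 : ∀ y, 0 ≤ y 0 → y ∉ K → w y = 0) :
    ∫ y in {y | 0 ≤ y 0}, extDerivWithin w {y | 0 ≤ y 0} y (fun i => EuclideanSpace.single i 1) =
      - ∫ z, w (consZero n z) (fun j => EuclideanSpace.single j.succ 1) := by
  obtain ⟨R, hR0, hR⟩ := exists_abs_lt_of_isCompact hK
  have hwR : ∀ x : Fin (n + 1) → ℝ, (∃ i, R ≤ |x i|) → WithLp.toLp 2 x ∉ K := by
    rintro x ⟨i, hi⟩ hx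
    exact (hR _ hx i).not_ge hi
  -- The box has one face on the boundary hyperplane, and its other faces are pushed out beyond `K`.
  -- Thus only the lower face in direction `0` contributes, and lower faces enter with a minus sign.
  set a : Fin (n + 1) → ℝ := Fin.cons 0 (fun _ => -R) with ha
  have hab : a ≤ fun _ => R := by
    intro i
    refine Fin.cases ?_ (fun j => ?_) i
    · simpa [ha] using hR0.le
    · simp only [ha, Fin.cons_succ]; linarith
  have hsub : Icc a (fun _ => R) ⊆ (WithLp.toLp 2 : (Fin (n + 1) → ℝ) → _) ⁻¹'
      {y : EuclideanSpace ℝ (Fin (n + 1)) | 0 ≤ y 0} := fun x hx => hx.1 0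
  have hm : MeasurableSet ((WithLp.toLp 2 : (Fin (n + 1) → ℝ) → _) ⁻¹'
      {y : EuclideanSpace ℝ (Fin (n + 1)) | 0 ≤ y 0}) :=
    measurableSet_le measurable_const (measurable_pi_apply 0)
  rw [setIntegral_toLp, setIntegral_eq_of_subset_of_forall_sdiff_eq_zero
      (s := Icc a (fun _ => R)) hm hsub, integral_box_extDerivWithin hw hu hab hsub,
    Fin.sum_univ_succ, Finset.sum_eq_zero, add_zero]
  · have h1 : ∀ x : Fin n → ℝ, w (WithLp.toLp 2 ((0 : Fin (n + 1)).insertNth R x)) = 0 := fun x =>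
      h0 _ (by simpa using hR0.le) (hwR _ ⟨0, by simp [le_abs_self]⟩)
    have h2 : ∀ (x : Fin n → ℝ) v, w (WithLp.toLp 2 ((0 : Fin (n + 1)).insertNth R x)) v = 0 := by
      intro x v; rw [h1]; rfl
    simp only [h2, mul_zero, integral_zero, zero_sub]
    congr 1
    rw [← setIntegral_univ (μ := volume) (f := fun z : EuclideanSpace ℝ (Fin n) => _),
      setIntegral_toLp, preimage_univ, eq_comm,
      setIntegral_eq_of_subset_of_forall_sdiff_eq_zero MeasurableSet.univ
      (subset_univ (Icc (a ∘ (0 : Fin (n + 1)).succAbove) ((fun _ => R) ∘ (0 : Fin (n + 1)).succAbove)))]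
    · refine setIntegral_congr_fun measurableSet_Icc fun x _ => ?_
      simp only [Fin.val_zero, pow_zero, one_mul, Fin.succAbove_zero, Fin.insertNth_zero']
      rfl
    · rintro x ⟨-, hx⟩
      have h2 : w (consZero n (WithLp.toLp 2 x)) = 0 := by
        refine h0 _ le_rfl fun hk => hx ⟨fun i => ?_, fun i => ?_⟩
        · have := (abs_lt.1 (hR _ hk i.succ)).1.le
          simpa [ha] using this
        · exact (abs_lt.1 (hR _ hk i.succ)).2.le
      rw [h2]
      rfl
  · intro i _
    -- Since `h0` speaks only about the half space, the first coordinate of a point on a side face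
    -- must also be seen to be nonnegative; it is the coordinate `x 0`, bounded below by `a 0 = 0`.
    have hz : ∀ (t : ℝ) (x : Fin n → ℝ), R ≤ |t| → x ∈ Icc (a ∘ i.succ.succAbove)
        ((fun _ => R) ∘ i.succ.succAbove) → w (WithLp.toLp 2 (i.succ.insertNth t x)) = 0 := by
      intro t x ht hx
      refine h0 _ ?_ (hwR _ ⟨i.succ, by simpa using ht⟩)
      have : NeZero n := i.neZero
      have h3 := hx.1 0
      have h4 : i.succ.succAbove 0 = 0 := Fin.succAbove_ne_zero_zero (Fin.succ_ne_zero i)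
      have h5 : i.succ.insertNth (α := fun _ => ℝ) t x (i.succ.succAbove 0) = x 0 :=
        Fin.insertNth_apply_succAbove _ _ _ _
      rw [h4] at h5
      change 0 ≤ i.succ.insertNth (α := fun _ => ℝ) t x 0
      rw [h5]
      simpa [h4, ha] using h3
    rw [setIntegral_eq_zero_of_forall_eq_zero, setIntegral_eq_zero_of_forall_eq_zero, sub_zero]
    · intro x hx
      rw [hz _ _ _ hx]
      · simp
      · simp [ha, le_abs_self]
    · intro x hx
      rw [hz _ _ (le_abs_self R) hx]
      simp
  · rintro x ⟨hx0, hx⟩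
    rw [extDerivWithin_eq_zero_of_notMem (s := {y | 0 ≤ y 0}) hK.isClosed
      (fun y hy => h0 y hy) hx0]
    · rfl
    · refine hwR _ ?_
      by_contra! hc
      refine hx ⟨fun i => ?_, fun i => (abs_lt.1 (hc i)).2.le⟩
      refine Fin.cases ?_ (fun j => ?_) i
      · exact hx0
      · exact (abs_lt.1 (hc j.succ)).1.le

end LocalStokes

/-! ### Reduction of Stokes' theorem to a single chart -/

section StokesLocalization

open MeasureTheory

section Extend

variable {E : Type*} [NormedAddCommGroup E] [NormedSpace ℝ E]
  {H : Type*} [TopologicalSpace H] {I : ModelWithCorners ℝ E H}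
  {M : Type*} [TopologicalSpace M] [ChartedSpace H M] {k : ℕ}

variable (I) in
/-- The local expression of a form in a chart, extended by zero. -/
def localExt (α : M → E [⋀^Fin k]→L[ℝ] ℝ) (c : M) : E → E [⋀^Fin k]→L[ℝ] ℝ :=
  (extChartAt I c).target.indicator (localRep I α c)

theorem localExt_of_mem {α : M → E [⋀^Fin k]→L[ℝ] ℝ} {c : M} {y : E}
    (hy : y ∈ (extChartAt I c).target) : localExt I α c y = localRep I α c y :=
  indicator_of_mem hy _

theorem localExt_eq_zero {α : M → E [⋀^Fin k]→L[ℝ] ℝ} {c : M} {T : Set M}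
    (h0 : ∀ x ∉ T, α x = 0) {y : E} (hy : y ∉ extChartAt I c '' T) :
    localExt I α c y = 0 := by
  by_cases hyt : y ∈ (extChartAt I c).target
  · rw [localExt_of_mem hyt]
    refine localRep_eq_zero (h0 _ fun h => hy ⟨_, h, (extChartAt I c).right_inv hyt⟩)
  · exact indicator_of_notMem hyt _

theorem isCompact_image_extChartAt [CompactSpace M] {c : M} {T : Set M} (hT : IsClosed T)
    (hTc : T ⊆ (extChartAt I c).source) : IsCompact (extChartAt I c '' T) :=
  hT.isCompact.image_of_continuousOn ((continuousOn_extChartAt c).mono hTc)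

variable [IsManifold I ∞ M]

/-- The image of `T` in the chart is compact, hence closed in the whole model space, so a point
outside the chart target has a neighbourhood on which the extension is zero. -/
theorem contDiffOn_localExt [CompactSpace M] (α : DForm I M k) {c : M} {T : Set M}
    (hT : IsClosed T) (hTc : T ⊆ (extChartAt I c).source) (h0 : ∀ x ∉ T, α.toFun x = 0) :
    ContDiffOn ℝ ∞ (localExt I α.toFun c) (range I) := by
  intro y hy
  by_cases hyt : y ∈ (extChartAt I c).target
  · refine (α.contDiffWithinAt_localRep hyt).congr_of_eventuallyEq_of_mem ?_ hy
    filter_upwards [extChartAt_target_mem_nhdsWithin_of_mem hyt] with z hz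
    exact localExt_of_mem hz
  · have hyK : y ∉ extChartAt I c '' T := by
      rintro ⟨x, hx, rfl⟩
      exact hyt ((extChartAt I c).map_source (hTc hx))
    refine (contDiffWithinAt_const (c := 0)).congr_of_eventuallyEq_of_mem ?_ hy
    filter_upwards [mem_nhdsWithin_of_mem_nhds
      ((isCompact_image_extChartAt hT hTc).isClosed.isOpen_compl.mem_nhds hyK)] with z hz
    exact localExt_eq_zero h0 hz

end Extend

variable {n : ℕ} {H : Type*} [TopologicalSpace H]

section

variable {I : ModelWithCorners ℝ (EuclideanSpace ℝ (Fin n)) H}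
  {M : Type*} [TopologicalSpace M] [ChartedSpace H M] [IsManifold I ∞ M] [T2Space M]
  [CompactSpace M]

theorem integrableOn_localRep (γ : DForm I M n) {c : M} {T : Set M}
    (hT : IsClosed T) (hTc : T ⊆ (extChartAt I c).source) (h0 : ∀ x ∉ T, γ.toFun x = 0) :
    IntegrableOn (fun y => localRep I γ.toFun c y (fun i => EuclideanSpace.single i 1))
      (extChartAt I c).target := by
  have hKt : extChartAt I c '' T ⊆ (extChartAt I c).target := by
    rintro _ ⟨x, hx, rfl⟩
    exact (extChartAt I c).map_source (hTc hx)
  have hcont := (contDiffOn_form_iff.1 (γ.smooth c)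
    (fun i => EuclideanSpace.single i 1)).continuousOn
  refine ((hcont.mono hKt).integrableOn_compact
    (isCompact_image_extChartAt hT hTc)).of_forall_sdiff_eq_zero
      (measurableSet_extChartAt_target I c) ?_
  rintro y ⟨hy, hyK⟩
  rw [localRep_eq_zero (h0 _ fun h => hyK ⟨_, h, (extChartAt I c).right_inv hy⟩)]
  rfl

end

variable {I : ModelWithCorners ℝ (EuclideanSpace ℝ (Fin (n + 1))) H}
  {M : Type*} [TopologicalSpace M] [ChartedSpace H M] [IsManifold I ∞ M] [T2Space M]
  [CompactSpace M]

/-- As `d` is local, `dγ` also vanishes off `T`. Its integral is therefore computed in the chart at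
`c`, and extension by zero replaces the chart target by the range of the model, where Stokes'
theorem is known. -/
theorem integral_d_eq_integral_range (hM : IsOrientedAtlas I M) (γ : DForm I M n) {c : M}
    {T : Set M} (hT : IsClosed T) (hTc : T ⊆ (extChartAt I c).source)
    (h0 : ∀ x ∉ T, γ.toFun x = 0) :
    integral (DForm.d γ) = ∫ y in range I,
      extDerivWithin (localExt I γ.toFun c) (range I) y (fun i => EuclideanSpace.single i 1) := by
  have hd0 : ∀ x ∉ T, (DForm.d γ).toFun x = 0 := fun x hx =>
    DForm.d_toFun_eq_zero (Filter.mem_of_superset (hT.isOpen_compl.mem_nhds hx) fun z hz => h0 z hz)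
  rw [integral_eq_of_support_subset hM _ c (integrableOn_localRep _ hT hTc hd0)
    (fun x hx => hd0 x fun h => hx (hTc h)),
    setIntegral_eq_of_subset_of_forall_sdiff_eq_zero I.isClosed_range.measurableSet
      (extChartAt_target_subset_range c)]
  · refine setIntegral_congr_fun (measurableSet_extChartAt_target I c) fun y hy => ?_
    have h1 : localExt I γ.toFun c =ᶠ[𝓝[range I] y] localRep I γ.toFun c := by
      filter_upwards [extChartAt_target_mem_nhdsWithin_of_mem hy] with z hz
      exact localExt_of_mem hz
    rw [h1.extDerivWithin_eq_of_mem (extChartAt_target_subset_range c hy)]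
    exact DFunLike.congr_fun (γ.localRep_dFun hy) _
  · rintro y ⟨hy, hyt⟩
    rw [extDerivWithin_eq_zero_of_notMem (isCompact_image_extChartAt hT hTc).isClosed
      (fun z _ hz => localExt_eq_zero h0 hz) hy]
    · rfl
    · rintro ⟨x, hx, rfl⟩
      exact hyt ((extChartAt I c).map_source (hTc hx))

/-- A linear identity between forms holds if it holds for forms supported in chart domains. -/
theorem DForm.linearMap_eq_of_chart {k : ℕ} {F : Type*} [AddCommGroup F] [Module ℝ F]
    (f g : DForm I M k →ₗ[ℝ] F)
    (h : ∀ (c : M) (T : Set M), IsClosed T → T ⊆ (extChartAt I c).source →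
      ∀ γ : DForm I M k, (∀ x ∉ T, γ.toFun x = 0) → f γ = g γ) : f = g := by
  ext γ
  obtain ⟨s, -, hs⟩ := exists_finset_partition (chartPartition I M)
  rw [← DForm.sum_fsmul (chartPartition I M) s hs γ, map_sum, map_sum]
  refine Finset.sum_congr rfl fun c _ => h c (tsupport (chartPartition I M c))
    (isClosed_tsupport _) ?_ _ fun x hx => ?_
  · rw [extChartAt_source]
    exact chartPartition_isSubordinate I M c
  · change chartPartition I M c x • γ.toFun x = 0
    rw [image_eq_zero_of_notMem_tsupport hx, zero_smul]

/-- Stokes' theorem on closed manifolds. -/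
theorem integral_d_eq_zero {N : Type*} [TopologicalSpace N]
    [ChartedSpace (EuclideanSpace ℝ (Fin (n + 1))) N] [IsManifold (𝓡 (n + 1)) ∞ N] [T2Space N]
    [CompactSpace N] (hN : IsOrientedAtlas (𝓡 (n + 1)) N) (γ : DForm (𝓡 (n + 1)) N n) :
    integral (DForm.d γ) = 0 := by
  have h := DForm.linearMap_eq_of_chart (I := 𝓡 (n + 1)) (M := N) (integral ∘ₗ DForm.d) 0
    fun c T hT hTc γ h0 => ?_
  · exact LinearMap.congr_fun h γ
  · have hr : range (𝓡 (n + 1)) = univ := ModelWithCorners.range_eq_univ _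
    have h1 := contDiffOn_localExt γ hT hTc h0
    rw [hr] at h1
    rw [LinearMap.comp_apply, integral_d_eq_integral_range hN γ hT hTc h0, hr, setIntegral_univ]
    exact integral_extDerivWithin_univ h1 (isCompact_image_extChartAt hT hTc)
      fun y hy => localExt_eq_zero h0 hy

end StokesLocalization

/-! ### Coordinates on the boundary and their orientation -/

section BoundaryChart

variable {M : Type*} [TopologicalSpace M] [ChartedSpace (EuclideanHalfSpace 3) M]
  [IsManifold (𝓡∂ 3) ∞ M]
  {N : Type*} [TopologicalSpace N] [ChartedSpace (EuclideanSpace ℝ (Fin 2)) N]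
  [IsManifold (𝓡 2) ∞ N] {i : N → M}

theorem range_halfSpace_eq :
    range (𝓡∂ 3) = {y : EuclideanSpace ℝ (Fin (2 + 1)) | 0 ≤ y 0} :=
  range_modelWithCornersEuclideanHalfSpace 3

theorem extChartAt_zero_nonneg (c x : M) : 0 ≤ (extChartAt (𝓡∂ 3) c x) 0 := by
  have h : extChartAt (𝓡∂ 3) c x ∈ range (𝓡∂ 3) := ⟨chartAt _ c x, rfl⟩
  rw [range_halfSpace_eq] at h
  exact h

/-- Boundary points are those whose first coordinate vanishes in some chart. -/
theorem mem_boundary_iff {c x : M} (hx : x ∈ (extChartAt (𝓡∂ 3) c).source) :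
    x ∈ (𝓡∂ 3).boundary M ↔ (extChartAt (𝓡∂ 3) c x) 0 = 0 := by
  rw [← ModelWithCorners.compl_interior, mem_compl_iff]
  have h1 : x ∈ (𝓡∂ 3).interior M ↔ extChartAt (𝓡∂ 3) c x ∈ interior (range (𝓡∂ 3)) := by
    rw [extChartAt_source] at hx
    refine ((𝓡∂ 3).isInteriorPoint_iff_of_mem_atlas (n := ∞) (by simp)
      (chart_mem_atlas _ c) hx).trans ⟨fun h => ?_, fun h => ?_⟩
    · exact interior_mono (extChartAt_target_subset_range c) h
    · exact OpenPartialHomeomorph.mem_interior_extend_target _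
        ((chartAt _ c).map_source hx) h
  rw [h1, interior_range_modelWithCornersEuclideanHalfSpace]
  have h2 := extChartAt_zero_nonneg c x
  change ¬ (0 : ℝ) < extChartAt (𝓡∂ 3) c x 0 ↔ _
  exact ⟨fun h => le_antisymm (not_lt.1 h) h2, fun h => not_lt.2 (le_of_eq h)⟩

theorem consZero_mem_range (z : EuclideanSpace ℝ (Fin 2)) : consZero 2 z ∈ range (𝓡∂ 3) := by
  rw [range_halfSpace_eq]
  exact le_refl (0 : ℝ)

/-- Dropping the first coordinate loses nothing at a boundary point, where that coordinate is zero.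
-/
theorem consZero_tailL_extChartAt (hrange : range i = (𝓡∂ 3).boundary M) {c : M} {p : N}
    (hp : i p ∈ (extChartAt (𝓡∂ 3) c).source) :
    consZero 2 (tailL 2 (extChartAt (𝓡∂ 3) c (i p))) = extChartAt (𝓡∂ 3) c (i p) :=
  consZero_tailL ((mem_boundary_iff hp).1 (hrange ▸ mem_range_self p))

theorem extChartAt_symm_consZero_mem_range (hrange : range i = (𝓡∂ 3).boundary M) {c : M}
    {z : EuclideanSpace ℝ (Fin 2)} (hz : consZero 2 z ∈ (extChartAt (𝓡∂ 3) c).target) :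
    (extChartAt (𝓡∂ 3) c).symm (consZero 2 z) ∈ range i := by
  rw [hrange, mem_boundary_iff ((extChartAt (𝓡∂ 3) c).map_target hz),
    (extChartAt (𝓡∂ 3) c).right_inv hz]
  rfl

/-- The system of coordinates on the boundary induced by a chart. -/
def boundaryChart [Nonempty N] (hi : Topology.IsEmbedding i) (hrange : range i = (𝓡∂ 3).boundary M)
    (c : M) : OpenPartialHomeomorph N (EuclideanSpace ℝ (Fin 2)) where
  toFun p := tailL 2 (extChartAt (𝓡∂ 3) c (i p))
  invFun z := invFun i ((extChartAt (𝓡∂ 3) c).symm (consZero 2 z))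
  source := i ⁻¹' (extChartAt (𝓡∂ 3) c).source
  target := consZero 2 ⁻¹' (extChartAt (𝓡∂ 3) c).target
  map_source' p hp := by
    rw [mem_preimage, consZero_tailL_extChartAt hrange hp]
    exact (extChartAt (𝓡∂ 3) c).map_source hp
  map_target' z hz := by
    rw [mem_preimage, invFun_eq (extChartAt_symm_consZero_mem_range hrange hz)]
    exact (extChartAt (𝓡∂ 3) c).map_target hz
  left_inv' p hp := by
    rw [consZero_tailL_extChartAt hrange hp, (extChartAt (𝓡∂ 3) c).left_inv hp]
    exact leftInverse_invFun hi.injective p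
  right_inv' z hz := by
    rw [invFun_eq (extChartAt_symm_consZero_mem_range hrange hz),
      (extChartAt (𝓡∂ 3) c).right_inv hz]
    rfl
  open_source := (isOpen_extChartAt_source c).preimage hi.continuous
  open_target := by
    have h : consZero 2 ⁻¹' (extChartAt (𝓡∂ 3) c).target =
        (fun z => (𝓡∂ 3).symm (consZero 2 z)) ⁻¹' (chartAt (EuclideanHalfSpace 3) c).target := by
      rw [extChartAt_target]
      ext z
      exact ⟨fun h => h.1, fun h => ⟨h, consZero_mem_range z⟩⟩
    rw [h]
    exact (chartAt _ c).open_target.preimage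
      ((𝓡∂ 3).continuous_symm.comp (consZero 2).continuous)
  continuousOn_toFun := (tailL 2).continuous.comp_continuousOn
    ((continuousOn_extChartAt c).comp hi.continuous.continuousOn (mapsTo_preimage _ _))
  continuousOn_invFun := by
    -- As `i` is an embedding, continuity of the inverse may be checked after composing with `i`,
    -- and there it is the inverse chart on the hyperplane.
    rw [hi.isInducing.continuousOn_iff]
    refine ((continuousOn_extChartAt_symm c).comp (consZero 2).continuous.continuousOn
      (mapsTo_preimage _ _)).congr fun z hz => ?_
    exact invFun_eq (extChartAt_symm_consZero_mem_range hrange hz)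

variable (i) in
/-- The derivative of the boundary coordinates induced by the chart at `c`, in the chart at `p`. -/
def boundaryChartDeriv (c : M) (p : N) (y : EuclideanSpace ℝ (Fin 2)) :
    EuclideanSpace ℝ (Fin 2) →L[ℝ] EuclideanSpace ℝ (Fin 2) :=
  (tailL 2).comp (fderivWithin ℝ (extChartAt (𝓡∂ 3) c ∘ i ∘ (extChartAt (𝓡 2) p).symm)
    (range (𝓡 2)) y)

theorem hasFDerivAt_boundaryChart [Nonempty N] (hi : Topology.IsEmbedding i)
    (hrange : range i = (𝓡∂ 3).boundary M) (his : ContMDiff (𝓡 2) (𝓡∂ 3) ∞ i) {c : M} {p : N}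
    {y : EuclideanSpace ℝ (Fin 2)} (hy : y ∈ (extChartAt (𝓡 2) p).target)
    (hyc : i ((extChartAt (𝓡 2) p).symm y) ∈ (extChartAt (𝓡∂ 3) c).source) :
    HasFDerivAt (boundaryChart hi hrange c ∘ (extChartAt (𝓡 2) p).symm)
      (boundaryChartDeriv i c p y) y := by
  have h1 := ((contDiffWithinAt_chartMap his hy hyc).differentiableWithinAt
    (by simp)).hasFDerivWithinAt
  have h2 := (tailL 2).hasFDerivAt.comp_hasFDerivWithinAt y h1
  have hr : range (𝓡 2) = univ := ModelWithCorners.range_eq_univ _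
  rw [← hasFDerivWithinAt_univ, ← hr]
  exact h2

/-- Near `y` the chart expression of `i` takes values in the boundary hyperplane, so it is unchanged
by projecting to the hyperplane; differentiating this identity gives the claim. -/
theorem consZero_boundaryChartDeriv (hrange : range i = (𝓡∂ 3).boundary M)
    (his : ContMDiff (𝓡 2) (𝓡∂ 3) ∞ i) {c : M} {p : N}
    {y : EuclideanSpace ℝ (Fin 2)} (hy : y ∈ (extChartAt (𝓡 2) p).target)
    (hyc : i ((extChartAt (𝓡 2) p).symm y) ∈ (extChartAt (𝓡∂ 3) c).source) :
    (consZero 2).comp (boundaryChartDeriv i c p y) =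
      fderivWithin ℝ (extChartAt (𝓡∂ 3) c ∘ i ∘ (extChartAt (𝓡 2) p).symm) (range (𝓡 2)) y := by
  have hyr : y ∈ range (𝓡 2) := extChartAt_target_subset_range p hy
  have h1 := ((contDiffWithinAt_chartMap his hy hyc).differentiableWithinAt
    (by simp)).hasFDerivWithinAt
  have h2 := (((consZero 2).comp (tailL 2)).hasFDerivAt.comp_hasFDerivWithinAt y h1).fderivWithin
    ((𝓡 2).uniqueDiffOn y hyr)
  refine h2.symm.trans (Filter.EventuallyEq.fderivWithin_eq_of_mem ?_ hyr)
  filter_upwards [eventually_chartMap his hy hyc] with y' hy'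
  exact consZero_tailL_extChartAt hrange hy'.2

theorem mem_posTangentConeAt_halfSpace {y u : EuclideanSpace ℝ (Fin (2 + 1))} (hy : 0 ≤ y 0)
    (hu : 0 ≤ u 0) : u ∈ posTangentConeAt (range (𝓡∂ 3)) y := by
  refine mem_posTangentConeAt_of_segment_subset ((𝓡∂ 3).convex_range.segment_subset ?_ ?_)
  · rw [range_halfSpace_eq]
    exact hy
  · rw [range_halfSpace_eq]
    exact add_nonneg hy hu

/-- Outward pointing vectors at the boundary are preserved by coordinate changes. -/
theorem fderivWithin_trans_zero {x₀ z : M} {y : EuclideanSpace ℝ (Fin (2 + 1))}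
    (hy : y ∈ (extChartAt (𝓡∂ 3) x₀).target)
    (hz : (extChartAt (𝓡∂ 3) x₀).symm y ∈ (extChartAt (𝓡∂ 3) z).source) (hy0 : y 0 = 0)
    (hdet : (fderivWithin ℝ (trans (𝓡∂ 3) x₀ z) (range (𝓡∂ 3)) y).det ≠ 0) :
    0 < fderivWithin ℝ (trans (𝓡∂ 3) x₀ z) (range (𝓡∂ 3)) y (EuclideanSpace.single 0 1) 0 := by
  set R := fderivWithin ℝ (trans (𝓡∂ 3) x₀ z) (range (𝓡∂ 3)) y with hR
  have hd : HasFDerivWithinAt (trans (𝓡∂ 3) x₀ z) R (range (𝓡∂ 3)) y :=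
    ((contDiffWithinAt_trans (𝓡∂ 3) hy hz).differentiableWithinAt (by simp)).hasFDerivWithinAt
  have hb : (trans (𝓡∂ 3) x₀ z y) 0 = 0 := by
    rw [trans, comp_apply, ← mem_boundary_iff hz,
      mem_boundary_iff ((extChartAt (𝓡∂ 3) x₀).map_target hy), (extChartAt (𝓡∂ 3) x₀).right_inv hy]
    exact hy0
  have hd0 : HasFDerivWithinAt (fun y' => trans (𝓡∂ 3) x₀ z y' 0)
      ((EuclideanSpace.proj (0 : Fin 3)).comp R) (range (𝓡∂ 3)) y :=
    (EuclideanSpace.proj (𝕜 := ℝ) (0 : Fin 3)).hasFDerivAt.comp_hasFDerivWithinAt y hd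
  -- The first coordinate of the coordinate change is nonnegative and vanishes at `y`, so `y` is a
  -- minimum. The first-order condition makes the derivative nonnegative on inward directions, hence
  -- zero on tangential ones, which are inward together with their opposites.
  have hmin : IsLocalMinOn (fun y' => trans (𝓡∂ 3) x₀ z y' 0) (range (𝓡∂ 3)) y := by
    refine Filter.Eventually.of_forall fun y' => ?_
    change trans (𝓡∂ 3) x₀ z y 0 ≤ trans (𝓡∂ 3) x₀ z y' 0
    rw [hb]
    exact extChartAt_zero_nonneg z _
  have hpos : ∀ u : EuclideanSpace ℝ (Fin (2 + 1)), 0 ≤ u 0 → 0 ≤ R u 0 := fun u hu =>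
    hmin.hasFDerivWithinAt_nonneg hd0 (mem_posTangentConeAt_halfSpace hy0.ge hu)
  have hzero : ∀ u : EuclideanSpace ℝ (Fin (2 + 1)), u 0 = 0 → R u 0 = 0 := by
    intro u hu
    refine le_antisymm ?_ (hpos u hu.ge)
    have := hpos (-u) (by simp [hu])
    rw [map_neg] at this
    simpa using this
  -- Were the value zero, the whole image of `R` would lie in the hyperplane of vanishing first
  -- coordinate, contradicting invertibility.
  refine lt_of_le_of_ne (hpos _ (by simp)) fun h => ?_
  obtain ⟨u, hu⟩ : ∃ u, R u = EuclideanSpace.single 0 1 :=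
    (LinearMap.equivOfDetNeZero R.toLinearMap hdet).surjective _
  have h1 : R u 0 = 0 := by
    have e : u = u 0 • EuclideanSpace.single 0 1 + (u - u 0 • EuclideanSpace.single 0 1) := by
      abel
    rw [e, map_add, map_smul]
    have h2 := hzero (u - u 0 • EuclideanSpace.single 0 1) (by simp)
    simp only [PiLp.add_apply, PiLp.smul_apply, h2, ← h, smul_zero, add_zero]
  rw [hu] at h1
  simp at h1

/-- The determinant of three vectors, as an alternating form. -/
def detForm (n : ℕ) : EuclideanSpace ℝ (Fin n) [⋀^Fin n]→ₗ[ℝ] ℝ :=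
  (Matrix.detRowAlternating (n := Fin n) (R := ℝ)).compLinearMap
    (WithLp.linearEquiv 2 ℝ (Fin n → ℝ)).toLinearMap

theorem detForm_three (a b c : EuclideanSpace ℝ (Fin 3)) :
    detForm 3 ![a, b, c] = (Matrix.of ![a.ofLp, b.ofLp, c.ofLp]).det := by
  change Matrix.det (n := Fin 3) (R := ℝ) _ = _
  congr 1
  funext j
  fin_cases j <;> rfl

/-- Coordinate changes from the boundary orientation to the coordinates induced by a chart have
negative determinant: the vectors pointing outward have negative first coordinate. -/
theorem det_boundaryChartDeriv_neg (hM : IsOrientedAtlas (𝓡∂ 3) M) (hN : IsOrientedAtlas (𝓡 2) N)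
    (hor : IsBoundaryOriented i) (hrange : range i = (𝓡∂ 3).boundary M)
    (his : ContMDiff (𝓡 2) (𝓡∂ 3) ∞ i) {c : M} {p : N}
    {y : EuclideanSpace ℝ (Fin 2)} (hy : y ∈ (extChartAt (𝓡 2) p).target)
    (hyc : i ((extChartAt (𝓡 2) p).symm y) ∈ (extChartAt (𝓡∂ 3) c).source) :
    (boundaryChartDeriv i c p y).det < 0 := by
  set q := (extChartAt (𝓡 2) p).symm y with hq
  set D := boundaryChartDeriv i c p y
  set F := (extChartAt (𝓡∂ 3) c ∘ i ∘ (extChartAt (𝓡 2) p).symm) y with hF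
  set S := fderivWithin ℝ (trans (𝓡 2) p q) (range (𝓡 2)) y
  set R := fderivWithin ℝ (trans (𝓡∂ 3) c (i q)) (range (𝓡∂ 3)) F
  set T := tangentMapAt (𝓡∂ 3) (𝓡 2) i q
  have hFt : F ∈ (extChartAt (𝓡∂ 3) c).target := (extChartAt (𝓡∂ 3) c).map_source hyc
  have hFs : (extChartAt (𝓡∂ 3) c).symm F = i q := (extChartAt (𝓡∂ 3) c).left_inv hyc
  have hFm : (extChartAt (𝓡∂ 3) c).symm F ∈ (extChartAt (𝓡∂ 3) (i q)).source := by
    rw [hFs]; exact mem_extChartAt_source _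
  have hF0 : F 0 = 0 := (mem_boundary_iff hyc).1 (hrange ▸ mem_range_self q)
  have hS : 0 < S.det := hN p q y hy (mem_extChartAt_source q)
  have hR : 0 < R.det := hM c (i q) F hFt hFm
  -- The differential of `i` expressed in two ways: through the preferred charts at `q` and `i q`,
  -- which define the orientation, and through the chart at `c`.
  have hTS : ∀ u, T (S u) = R (consZero 2 (D u)) := by
    intro u
    have h := tangentMapAt_comp_fderivWithin_trans isOpen_univ his.contMDiffOn hy (mem_univ _) hyc
      hq rfl
    rw [← consZero_boundaryChartDeriv hrange his hy hyc] at h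
    exact DFunLike.congr_fun h u
  have hR0 := fderivWithin_trans_zero hFt hFm hF0 hR.ne'
  -- The orientation hypothesis holds for any outward vector. This choice makes all three vectors
  -- images under `R`, so that a factor `det R` can be extracted.
  set v : EuclideanSpace ℝ (Fin 3) := R (-EuclideanSpace.single 0 1) with hv
  have hv0 : v 0 < 0 := by
    have : v 0 = -(R (EuclideanSpace.single 0 1) 0) := by rw [hv, map_neg]; rfl
    linarith
  have h1 := hor q v hv0
  rw [← detForm_three] at h1
  let θ : EuclideanSpace ℝ (Fin 2) [⋀^Fin 2]→ₗ[ℝ] ℝ :=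
    ((detForm 3).curryLeft v).compLinearMap T.toLinearMap
  let θ' : EuclideanSpace ℝ (Fin 2) [⋀^Fin 2]→ₗ[ℝ] ℝ :=
    ((detForm 3).curryLeft (-EuclideanSpace.single 0 1)).compLinearMap (consZero 2).toLinearMap
  have e1 : θ (fun j => EuclideanSpace.single j 1) =
      detForm 3 ![v, T (EuclideanSpace.single 0 1), T (EuclideanSpace.single 1 1)] := by
    change detForm 3 _ = _
    congr 1
    funext j
    fin_cases j <;> rfl
  have e2 : θ' (fun j => EuclideanSpace.single j 1) = -1 := by
    have : θ' (fun j => EuclideanSpace.single j 1) = detForm 3 ![-EuclideanSpace.single 0 1,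
        consZero 2 (EuclideanSpace.single 0 1), consZero 2 (EuclideanSpace.single 1 1)] := by
      change detForm 3 _ = _
      congr 1
      funext j
      fin_cases j <;> rfl
    rw [this, detForm_three, consZero_single, consZero_single, Matrix.det_fin_three]
    simp
  have e3 : θ (fun j => S (EuclideanSpace.single j 1)) =
      R.det * θ' (fun j => D (EuclideanSpace.single j 1)) := by
    have h4 := alternatingMap_apply_comp (detForm 3) R ![-EuclideanSpace.single 0 1,
      consZero 2 (D (EuclideanSpace.single 0 1)), consZero 2 (D (EuclideanSpace.single 1 1))]
    refine Eq.trans ?_ (h4.trans ?_)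
    · change detForm 3 _ = _
      congr 1
      funext j
      fin_cases j
      · rfl
      · exact hTS _
      · exact hTS _
    · congr 1
  -- The identity becomes `det S * (positive) = det R * (det D * (-1))` with `det S` and `det R`
  -- positive.
  rw [alternatingMap_apply_comp, alternatingMap_apply_comp, e1, e2] at e3
  have h5 := mul_pos hS h1
  rw [e3] at h5
  nlinarith

end BoundaryChart

/-! ### Stokes' theorem on a compact 3-manifold with boundary -/

section StokesBoundary

open MeasureTheory

variable {M : Type*} [TopologicalSpace M] [T2Space M] [CompactSpace M]
  [ChartedSpace (EuclideanHalfSpace 3) M] [IsManifold (𝓡∂ 3) ∞ M]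
  {N : Type*} [TopologicalSpace N] [T2Space N] [CompactSpace N]
  [ChartedSpace (EuclideanSpace ℝ (Fin 2)) N] [IsManifold (𝓡 2) ∞ N] {i : N → M}

theorem localExt_consZero_eq_zero [IsEmpty N] (hrange : range i = (𝓡∂ 3).boundary M)
    (γ : DForm (𝓡∂ 3) M 2) (c : M) (z : EuclideanSpace ℝ (Fin 2)) :
    localExt (𝓡∂ 3) γ.toFun c (consZero 2 z) = 0 := by
  refine indicator_of_notMem (fun hz => ?_) _
  obtain ⟨p, -⟩ := extChartAt_symm_consZero_mem_range hrange hz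
  exact isEmptyElim p

/-- The boundary integral is computed in the coordinates induced by the chart at `c`. They reverse
orientation, so `|det| = -det` produces the minus sign that matches the half space formula. -/
theorem integral_pullback_boundary [Nonempty N] (hM : IsOrientedAtlas (𝓡∂ 3) M)
    (hN : IsOrientedAtlas (𝓡 2) N) (hi : Topology.IsEmbedding i)
    (his : ContMDiff (𝓡 2) (𝓡∂ 3) ∞ i) (hrange : range i = (𝓡∂ 3).boundary M)
    (hor : IsBoundaryOriented i) (γ : DForm (𝓡∂ 3) M 2) {c : M} {T : Set M} (hT : IsClosed T)
    (hTc : T ⊆ (extChartAt (𝓡∂ 3) c).source) (h0 : ∀ x ∉ T, γ.toFun x = 0) :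
    integral (DForm.pullback i his γ) =
      - ∫ z, localExt (𝓡∂ 3) γ.toFun c (consZero 2 z) (fun j => EuclideanSpace.single j.succ 1) := by
  set e := boundaryChart hi hrange c with he
  set u : EuclideanSpace ℝ (Fin 2) → ℝ := fun z =>
    -localExt (𝓡∂ 3) γ.toFun c (consZero 2 z) (fun j => EuclideanSpace.single j.succ 1) with hu
  have hw := contDiffOn_localExt γ hT hTc h0
  have huc : Continuous u := by
    have h1 := (contDiffOn_form_iff.1 hw (fun j => EuclideanSpace.single j.succ 1)).continuousOn
    exact (h1.comp_continuous (consZero 2).continuous consZero_mem_range).neg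
  have hK : IsCompact (tailL 2 '' (extChartAt (𝓡∂ 3) c '' T)) :=
    (isCompact_image_extChartAt hT hTc).image (tailL 2).continuous
  have hu0 : ∀ z, z ∉ tailL 2 '' (extChartAt (𝓡∂ 3) c '' T) → u z = 0 := by
    intro z hz
    have : localExt (𝓡∂ 3) γ.toFun c (consZero 2 z) = 0 :=
      localExt_eq_zero h0 fun h => hz ⟨_, h, tailL_consZero z⟩
    simp only [hu, this]
    exact neg_zero
  have hui : Integrable u :=
    huc.integrable_of_hasCompactSupport (HasCompactSupport.intro hK hu0)
  have ht0 : ∀ z, z ∉ e.target → u z = 0 := by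
    intro z hz
    have : localExt (𝓡∂ 3) γ.toFun c (consZero 2 z) = 0 :=
      indicator_of_notMem (s := (extChartAt (𝓡∂ 3) c).target) hz _
    simp only [hu, this]
    exact neg_zero
  have key : integral (DForm.pullback i his γ) = ∫ z in e.target, u z := by
    refine integral_eq_setIntegral _ e.toPartialEquiv e.open_source e.open_target.measurableSet
      e.continuousOn_invFun u hui.integrableOn ?_ (boundaryChartDeriv i c) ?_ ?_
    · intro p hp
      have h1 : γ.toFun (i p) = 0 := h0 _ fun h => hp (hTc h)
      change (γ.toFun (i p)).compContinuousLinearMap _ = 0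
      rw [h1]
      rfl
    · intro p y hy hyc
      exact (hasFDerivAt_boundaryChart hi hrange his hy hyc).hasFDerivWithinAt
    · intro p y hy hyc
      have hyc' : i ((extChartAt (𝓡 2) p).symm y) ∈ (extChartAt (𝓡∂ 3) c).source := hyc
      have hdet := det_boundaryChartDeriv_neg hM hN hor hrange his hy hyc'
      have h1 := localRep_pullback his γ.toFun hy hyc'
      rw [← consZero_boundaryChartDeriv hrange his hy hyc'] at h1
      have h2 : consZero 2 (boundaryChart hi hrange c ((extChartAt (𝓡 2) p).symm y)) =
          extChartAt (𝓡∂ 3) c (i ((extChartAt (𝓡 2) p).symm y)) :=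
        consZero_tailL_extChartAt hrange hyc'
      have h3 : localExt (𝓡∂ 3) γ.toFun c
          (consZero 2 (boundaryChart hi hrange c ((extChartAt (𝓡 2) p).symm y))) =
          localRep (𝓡∂ 3) γ.toFun c (extChartAt (𝓡∂ 3) c (i ((extChartAt (𝓡 2) p).symm y))) := by
        rw [h2]
        exact localExt_of_mem ((extChartAt (𝓡∂ 3) c).map_source hyc')
      have h4 := compContinuousLinearMap_apply_single
        (a := (localRep (𝓡∂ 3) γ.toFun c (extChartAt (𝓡∂ 3) c
          (i ((extChartAt (𝓡 2) p).symm y)))).compContinuousLinearMap (consZero 2))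
        (boundaryChartDeriv i c p y)
      refine ((DFunLike.congr_fun h1 _).trans h4).trans ?_
      rw [abs_of_neg hdet]
      change _ = -_ * -(localExt (𝓡∂ 3) γ.toFun c
          (consZero 2 (boundaryChart hi hrange c ((extChartAt (𝓡 2) p).symm y))) _)
      rw [h3, neg_mul_neg]
      congr 1
      change localRep (𝓡∂ 3) γ.toFun c _ (fun j => consZero 2 (EuclideanSpace.single j 1)) = _
      congr 1
      funext j
      exact consZero_single j
  rw [key, setIntegral_eq_integral_of_forall_compl_eq_zero ht0, ← integral_neg]

/-- Stokes' theorem on manifolds with boundary. -/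
theorem integral_d_eq_integral_pullback (hM : IsOrientedAtlas (𝓡∂ 3) M)
    (hN : IsOrientedAtlas (𝓡 2) N) (hi : Topology.IsEmbedding i)
    (his : ContMDiff (𝓡 2) (𝓡∂ 3) ∞ i) (hrange : range i = (𝓡∂ 3).boundary M)
    (hor : IsBoundaryOriented i) (γ : DForm (𝓡∂ 3) M 2) :
    integral (DForm.d γ) = integral (DForm.pullback i his γ) := by
  refine LinearMap.congr_fun (f := integral ∘ₗ DForm.d)
    (g := integral ∘ₗ DForm.pullback (k := 2) i his)
    (DForm.linearMap_eq_of_chart _ _ fun c T hT hTc γ h0 => ?_) γ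
  have hu : UniqueDiffOn ℝ {y : EuclideanSpace ℝ (Fin (2 + 1)) | 0 ≤ y 0} :=
    range_halfSpace_eq ▸ (𝓡∂ 3).uniqueDiffOn
  have hw := contDiffOn_localExt γ hT hTc h0
  rw [range_halfSpace_eq] at hw
  have h1 := integral_d_eq_integral_range hM γ hT hTc h0
  rw [range_halfSpace_eq, integral_extDerivWithin_halfSpace hw hu
    (isCompact_image_extChartAt hT hTc) fun y _ hy => localExt_eq_zero h0 hy] at h1
  refine h1.trans ?_
  -- The inverse of a boundary chart is built with `invFun`, which needs a point of `N`. For empty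
  -- `N` no chart meets the hyperplane and both sides vanish.
  rcases isEmpty_or_nonempty N with hE | hE
  · have h2 : ∀ z, localExt (𝓡∂ 3) γ.toFun c (consZero 2 z) = 0 :=
      localExt_consZero_eq_zero hrange γ c
    have h3 : integral (DForm.pullback i his γ) = 0 := finsum_of_isEmpty _
    rw [LinearMap.comp_apply, h3, neg_eq_zero]
    refine integral_eq_zero_of_ae (Filter.Eventually.of_forall fun z => ?_)
    simp only [h2]
    rfl
  · exact (integral_pullback_boundary hM hN hi his hrange hor γ hT hTc h0).symm

end StokesBoundary

/-! ### Extending forms from the boundary -/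

section Extension

section Retraction

variable {E : Type*} [NormedAddCommGroup E] [NormedSpace ℝ E] [FiniteDimensional ℝ E]
  {H : Type*} [TopologicalSpace H] {I : ModelWithCorners ℝ E H}
  {M : Type*} [TopologicalSpace M] [ChartedSpace H M] [IsManifold I ∞ M] [T2Space M]
  [CompactSpace M]
  {E' : Type*} [NormedAddCommGroup E'] [NormedSpace ℝ E'] [FiniteDimensional ℝ E']
  {H' : Type*} [TopologicalSpace H'] {J : ModelWithCorners ℝ E' H'}
  {N : Type*} [TopologicalSpace N] [ChartedSpace H' N] [IsManifold J ∞ N] {k : ℕ}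

/-- If a map has smooth local retractions, then the pullback of forms along it is surjective. -/
theorem DForm.pullback_surjective_of_retraction {i : N → M} (hi : ContMDiff J I ∞ i)
    (h : ∀ x : M, ∃ U : Set M, IsOpen U ∧ x ∈ U ∧ ∃ r : M → N, ContMDiffOn I J ∞ r U ∧
      ∀ p, i p ∈ U → r (i p) = p) :
    Function.Surjective (DForm.pullback (k := k) i hi) := by
  intro β
  choose U hU hxU r hr hri using h
  obtain ⟨ρ, hρ⟩ := SmoothPartitionOfUnity.exists_isSubordinate I (isClosed_univ (X := M)) U hU
    fun x _ => mem_iUnion.2 ⟨x, hxU x⟩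
  obtain ⟨s, -, hs⟩ := exists_finset_partition ρ
  have key : ∀ x, ∀ p, (DForm.pullback i hi (DForm.cutoffPullback (hU x) (hr x) (ρ x)
      (ρ x).contMDiff (hρ x) β)).toFun p = ρ x (i p) • β.toFun p := by
    intro x p
    change (ρ x (i p) • (β.toFun (r x (i p))).compContinuousLinearMap
      (tangentMapAt J I (r x) (i p))).compContinuousLinearMap (tangentMapAt I J i p) = _
    -- Where the retraction is defined, `r ∘ i` is the identity near `p`, so the two differentials
    -- compose to the identity; elsewhere the cutoff function is zero.
    by_cases hp : i p ∈ U x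
    · have h1 : HasMFDerivAt J J (r x ∘ i) p
          ((mfderiv I J (r x) (i p)).comp (mfderiv J I i p)) :=
        HasMFDerivAt.comp p (((hr x).contMDiffAt ((hU x).mem_nhds hp)).mdifferentiableAt
          (by simp)).hasMFDerivAt ((hi p).mdifferentiableAt (by simp)).hasMFDerivAt
      have h2 : r x ∘ i =ᶠ[𝓝 p] id := by
        filter_upwards [((hU x).preimage hi.continuous).mem_nhds hp] with q hq
        exact hri x q hq
      have h3 : (tangentMapAt J I (r x) (i p)).comp (tangentMapAt I J i p) =
          ContinuousLinearMap.id ℝ E' := by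
        have h4 := h1.mfderiv
        rw [h2.mfderiv_eq] at h4
        exact h4.symm.trans mfderiv_id
      ext v
      change ρ x (i p) * β.toFun (r x (i p)) (fun j =>
        ((tangentMapAt J I (r x) (i p)).comp (tangentMapAt I J i p)) (v j)) = _
      rw [h3, hri x p hp]
      rfl
    · have h0 : ρ x (i p) = 0 := image_eq_zero_of_notMem_tsupport fun h => hp (hρ x h)
      rw [h0, zero_smul, zero_smul]
      rfl
  refine ⟨∑ x ∈ s, DForm.cutoffPullback (hU x) (hr x) (ρ x) (ρ x).contMDiff (hρ x) β,
    DForm.ext' fun p => ?_⟩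
  rw [map_sum, DForm.sum_toFun, Finset.sum_congr rfl fun x _ => key x p, ← Finset.sum_smul, hs,
    one_smul]

end Retraction

variable {M : Type*} [TopologicalSpace M] [T2Space M] [CompactSpace M]
  [ChartedSpace (EuclideanHalfSpace 3) M] [IsManifold (𝓡∂ 3) ∞ M]
  {N : Type*} [TopologicalSpace N] [T2Space N] [CompactSpace N]
  [ChartedSpace (EuclideanSpace ℝ (Fin 2)) N] [IsManifold (𝓡 2) ∞ N] {i : N → M} {k : ℕ}

/-- The boundary coordinates are already a homeomorphism, smooth and with nonzero Jacobian
determinant in the charts of `N`, so the inverse is smooth by the inverse function theorem. The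
orientation hypotheses enter only through the nonvanishing of the determinant. -/
theorem contMDiffAt_boundaryChart_symm [Nonempty N] (hM : IsOrientedAtlas (𝓡∂ 3) M)
    (hN : IsOrientedAtlas (𝓡 2) N) (hi : Topology.IsEmbedding i)
    (his : ContMDiff (𝓡 2) (𝓡∂ 3) ∞ i) (hrange : range i = (𝓡∂ 3).boundary M)
    (hor : IsBoundaryOriented i) (c : M) {z : EuclideanSpace ℝ (Fin 2)}
    (hz : z ∈ (boundaryChart hi hrange c).target) :
    ContMDiffAt 𝓘(ℝ, EuclideanSpace ℝ (Fin 2)) (𝓡 2) ∞ (boundaryChart hi hrange c).symm z := by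
  set e := boundaryChart hi hrange c with he
  set p := e.symm z with hp
  have hps : p ∈ e.source := e.map_target hz
  have hyt : extChartAt (𝓡 2) p p ∈ (extChartAt (𝓡 2) p).target := mem_extChartAt_target p
  have hyc : i ((extChartAt (𝓡 2) p).symm (extChartAt (𝓡 2) p p)) ∈
      (extChartAt (𝓡∂ 3) c).source := by
    rw [extChartAt_to_inv]
    exact hps
  have hdet := (det_boundaryChartDeriv_neg hM hN hor hrange his hyt hyc).ne
  have hd := hasFDerivAt_boundaryChart hi hrange his hyt hyc
  have hc : ContDiffAt ℝ ∞ (e ∘ (extChartAt (𝓡 2) p).symm) (extChartAt (𝓡 2) p p) := by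
    have h1 := (tailL 2).contDiff.comp_contDiffWithinAt (contDiffWithinAt_chartMap his hyt hyc)
    have hr : range (𝓡 2) = univ := ModelWithCorners.range_eq_univ _
    rw [hr] at h1
    exact contDiffWithinAt_univ.1 h1
  let g : OpenPartialHomeomorph (EuclideanSpace ℝ (Fin 2)) (EuclideanSpace ℝ (Fin 2)) :=
    (chartAt (EuclideanSpace ℝ (Fin 2)) p).symm.trans e
  have hgz : z ∈ g.target := by
    refine ⟨hz, ?_⟩
    exact mem_chart_source _ p
  have hsymm : ContDiffAt ℝ ∞ g.symm z := by
    refine g.contDiffAt_symm (f₀' := ContinuousLinearMap.toContinuousLinearEquivOfDetNeZero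
      (boundaryChartDeriv i c p (extChartAt (𝓡 2) p p)) hdet) hgz ?_ ?_
    · exact hd
    · exact hc
  rw [contMDiffAt_iff_target]
  refine ⟨e.continuousAt_symm hz, ?_⟩
  exact hsymm.contMDiffAt

/-- Near a boundary point, forget the first coordinate of a chart and return to `N` by the inverse
boundary chart. Away from the boundary, which is closed because `N` is compact, any constant map
qualifies vacuously. -/
theorem exists_local_retraction [Nonempty N] (hM : IsOrientedAtlas (𝓡∂ 3) M)
    (hN : IsOrientedAtlas (𝓡 2) N) (hi : Topology.IsEmbedding i)
    (his : ContMDiff (𝓡 2) (𝓡∂ 3) ∞ i) (hrange : range i = (𝓡∂ 3).boundary M)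
    (hor : IsBoundaryOriented i) (x : M) :
    ∃ U : Set M, IsOpen U ∧ x ∈ U ∧ ∃ r : M → N, ContMDiffOn (𝓡∂ 3) (𝓡 2) ∞ r U ∧
      ∀ p, i p ∈ U → r (i p) = p := by
  by_cases hx : x ∈ range i
  · obtain ⟨p, rfl⟩ := hx
    set e := boundaryChart hi hrange (i p) with he
    have hps : p ∈ e.source := mem_extChartAt_source (i p)
    have hcont : ContinuousOn (fun x => tailL 2 (extChartAt (𝓡∂ 3) (i p) x))
        (extChartAt (𝓡∂ 3) (i p)).source :=
      (tailL 2).continuous.comp_continuousOn (continuousOn_extChartAt _)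
    refine ⟨(extChartAt (𝓡∂ 3) (i p)).source ∩
      (fun x => tailL 2 (extChartAt (𝓡∂ 3) (i p) x)) ⁻¹' e.target,
      hcont.isOpen_inter_preimage (isOpen_extChartAt_source _) e.open_target,
      ⟨mem_extChartAt_source _, e.map_source hps⟩,
      fun x => e.symm (tailL 2 (extChartAt (𝓡∂ 3) (i p) x)), ?_, ?_⟩
    · rintro x ⟨hx, hxt⟩
      refine ContMDiffAt.contMDiffWithinAt ?_
      rw [extChartAt_source] at hx
      exact (contMDiffAt_boundaryChart_symm hM hN hi his hrange hor (i p) hxt).comp x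
        ((tailL 2).contMDiff.contMDiffAt.comp x (contMDiffAt_extChartAt' hx))
    · rintro q ⟨hq, -⟩
      exact e.left_inv hq
  · refine ⟨(range i)ᶜ, (isCompact_range his.continuous).isClosed.isOpen_compl, hx,
      fun _ => Classical.arbitrary N, contMDiffOn_const, fun p hp => (hp (mem_range_self p)).elim⟩

/-- Every form on the boundary extends to a form. -/
theorem DForm.pullback_boundary_surjective (hM : IsOrientedAtlas (𝓡∂ 3) M)
    (hN : IsOrientedAtlas (𝓡 2) N) (hi : Topology.IsEmbedding i)
    (his : ContMDiff (𝓡 2) (𝓡∂ 3) ∞ i) (hrange : range i = (𝓡∂ 3).boundary M)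
    (hor : IsBoundaryOriented i) :
    Function.Surjective (DForm.pullback (k := k) i his) := by
  rcases isEmpty_or_nonempty N with hE | hE
  · exact fun β => ⟨0, DForm.ext' fun p => isEmptyElim p⟩
  · exact DForm.pullback_surjective_of_retraction his
      (exists_local_retraction hM hN hi his hrange hor)

end Extension

/-! ### Nondegeneracy of the wedge product in complementary degrees -/

section WedgeNondegenerate

variable {k l n : ℕ}

/-- The form `dx₁ ∧ ⋯ ∧ dx_k` on `ℝ^(k + l)`. -/
def headForm (k l : ℕ) : EuclideanSpace ℝ (Fin (k + l)) [⋀^Fin k]→L[ℝ] ℝ :=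
  { (Matrix.detRowAlternating (n := Fin k) (R := ℝ)).compLinearMap
      ({ toFun := fun y j => y (Fin.castAdd l j)
         map_add' := fun _ _ => rfl
         map_smul' := fun _ _ => rfl } : EuclideanSpace ℝ (Fin (k + l)) →ₗ[ℝ] (Fin k → ℝ)) with
    cont := by
      change Continuous fun v : Fin k → EuclideanSpace ℝ (Fin (k + l)) =>
        Matrix.det (Matrix.of fun i j => v i (Fin.castAdd l j))
      refine Continuous.matrix_det (continuous_matrix fun i j => ?_)
      exact (EuclideanSpace.proj (𝕜 := ℝ) (Fin.castAdd l j)).continuous.comp (continuous_apply i) }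

theorem headForm_apply (v : Fin k → EuclideanSpace ℝ (Fin (k + l))) :
    headForm k l v = Matrix.det (Matrix.of fun i j => v i (Fin.castAdd l j)) := rfl

theorem headForm_single :
    headForm k l (fun i => EuclideanSpace.single (Fin.castAdd l i) 1) = 1 := by
  rw [headForm_apply, ← Matrix.det_one (n := Fin k)]
  congr 1
  ext i j
  simp [Matrix.one_apply, eq_comm]

/-- No cancellation occurs in the alternating sum: every term is `0` or the same number `β`, and the
identity permutation contributes `β`. -/
theorem wedgeAlt_headForm_ne_zero (b : EuclideanSpace ℝ (Fin (k + l)) [⋀^Fin l]→L[ℝ] ℝ)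
    (hb : b (fun j => EuclideanSpace.single (Fin.natAdd k j) 1) ≠ 0) :
    wedgeAlt rfl (headForm k l) b (fun i => EuclideanSpace.single i 1) ≠ 0 := by
  set β := b (fun j => EuclideanSpace.single (Fin.natAdd k j) 1) with hβ
  set F : Equiv.Perm (Fin (k + l)) → ℝ := fun σ => ((Equiv.Perm.sign σ : ℤ) : ℝ) *
    (headForm k l (fun i => EuclideanSpace.single (σ (Fin.castAdd l i)) 1) *
      b (fun j => EuclideanSpace.single (σ (Fin.natAdd k j)) 1)) with hF
  have key : ∀ σ, F σ = 0 ∨ F σ = β := by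
    intro σ
    -- If a head index goes to the tail, the determinant has a zero row. Otherwise `σ` preserves
    -- both blocks, and the signs of its two parts appear once in `sign σ` and once in the two
    -- factors.
    by_cases h : ∃ i j, σ (Fin.castAdd l i) = Fin.natAdd k j
    · obtain ⟨i, j, hij⟩ := h
      left
      have : headForm k l (fun i => EuclideanSpace.single (σ (Fin.castAdd l i)) 1) = 0 := by
        rw [headForm_apply]
        refine Matrix.det_eq_zero_of_row_eq_zero i fun j' => ?_
        simp [hij, Fin.ext_iff]
        omega
      simp [hF, this]
    · right
      push Not at h
      set τ : Equiv.Perm (Fin k ⊕ Fin l) := finSumFinEquiv.symm.permCongr σ with hτ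
      have hσ : ∀ s, σ (finSumFinEquiv s) = finSumFinEquiv (τ s) := by
        intro s
        simp [hτ, Equiv.permCongr_apply]
      have hmaps : MapsTo τ (range Sum.inl) (range Sum.inl) := by
        rintro _ ⟨i, rfl⟩
        rcases hs : τ (Sum.inl i) with i' | j'
        · exact mem_range_self _
        · have := hσ (Sum.inl i)
          rw [hs] at this
          exact (h i j' this).elim
      obtain ⟨⟨τ₁, τ₂⟩, hτ'⟩ := Equiv.Perm.mem_sumCongrHom_range_of_perm_mapsTo_inl hmaps
      have h1 : ∀ i, σ (Fin.castAdd l i) = Fin.castAdd l (τ₁ i) := by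
        intro i
        have := hσ (Sum.inl i)
        rw [← hτ'] at this
        exact this
      have h2 : ∀ j, σ (Fin.natAdd k j) = Fin.natAdd k (τ₂ j) := by
        intro j
        have := hσ (Sum.inr j)
        rw [← hτ'] at this
        exact this
      have h3 : Equiv.Perm.sign σ = Equiv.Perm.sign τ₁ * Equiv.Perm.sign τ₂ := by
        rw [← Equiv.Perm.sign_sumCongr, ← Equiv.Perm.sign_permCongr finSumFinEquiv.symm σ]
        exact congrArg _ hτ'.symm
      have h4 : headForm k l (fun i => EuclideanSpace.single (σ (Fin.castAdd l i)) 1) =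
          ((Equiv.Perm.sign τ₁ : ℤ) : ℝ) := by
        simp only [h1]
        refine ((headForm k l).toAlternatingMap.map_perm
          (fun i => EuclideanSpace.single (Fin.castAdd l i) 1) τ₁).trans ?_
        change Equiv.Perm.sign τ₁ • headForm k l _ = _
        rw [headForm_single, Units.smul_def, zsmul_eq_mul, mul_one]
      have h5 : b (fun j => EuclideanSpace.single (σ (Fin.natAdd k j)) 1) =
          ((Equiv.Perm.sign τ₂ : ℤ) : ℝ) * β := by
        simp only [h2]
        refine (b.toAlternatingMap.map_perm
          (fun j => EuclideanSpace.single (Fin.natAdd k j) 1) τ₂).trans ?_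
        rw [Units.smul_def, zsmul_eq_mul]
        rfl
      simp only [hF]
      rw [h4, h5, h3]
      rcases Int.units_eq_one_or (Equiv.Perm.sign τ₁) with h | h <;>
        rcases Int.units_eq_one_or (Equiv.Perm.sign τ₂) with h' | h' <;> rw [h, h'] <;> simp
  have hone : F 1 = β := by
    simp only [hF, Equiv.Perm.one_apply, Equiv.Perm.sign_one, headForm_single]
    simp [hβ]
  rw [wedgeAlt_apply]
  refine mul_ne_zero (by positivity) ?_
  change ∑ σ, F σ ≠ 0
  have hsum : ∑ σ, F σ = ∑ σ, (if F σ = 0 then 0 else 1) * β := by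
    refine Finset.sum_congr rfl fun σ _ => ?_
    rcases key σ with h | h
    · simp [h]
    · rw [h, if_neg hb, one_mul]
  rw [hsum, ← Finset.sum_mul]
  refine mul_ne_zero (ne_of_gt (Finset.sum_pos' (fun σ _ => ?_) ⟨1, Finset.mem_univ _, ?_⟩)) hb
  · split_ifs <;> norm_num
  · rw [hone, if_neg hb]
    exact one_pos

/-- The wedge product of forms of complementary degrees is nondegenerate. -/
theorem exists_wedgeAlt_ne_zero (h : k + l = n) (b : EuclideanSpace ℝ (Fin n) [⋀^Fin l]→L[ℝ] ℝ)
    (hb : b ≠ 0) : ∃ a, wedgeAlt h a b (fun i => EuclideanSpace.single i 1) ≠ 0 := by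
  subst h
  obtain ⟨v, hv, hbv⟩ : ∃ v : Fin l → Fin (k + l), Injective v ∧
      b (fun j => EuclideanSpace.single (v j) 1) ≠ 0 := by
    by_contra hcon
    push Not at hcon
    refine hb (ContinuousAlternatingMap.toAlternatingMap_injective
      (Module.Basis.ext_alternating (EuclideanSpace.basisFun (Fin (k + l)) ℝ).toBasis
        fun v hv => ?_))
    have h0 := hcon v hv
    simpa using h0
  -- Permuting coordinates moves a nonvanishing coefficient of `b` to the last `l` indices, where
  -- the head form detects it. The permutation changes top forms only by its determinant.
  obtain ⟨π, hπ⟩ : ∃ π : Equiv.Perm (Fin (k + l)), ∀ j, π (Fin.natAdd k j) = v j := by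
    have hinj : Injective (Fin.natAdd k : Fin l → Fin (k + l)) := Fin.natAdd_injective l k
    classical
    refine ⟨Equiv.extendSubtype ((Equiv.ofInjective _ hinj).symm.trans (Equiv.ofInjective v hv)),
      fun j => ?_⟩
    rw [Equiv.extendSubtype_apply_of_mem _ _ (mem_range_self j)]
    simp only [Equiv.trans_apply]
    have : (Equiv.ofInjective _ hinj).symm ⟨Fin.natAdd k j, mem_range_self j⟩ = j :=
      (Equiv.ofInjective _ hinj).symm_apply_apply j
    rw [this]
    rfl
  let L := LinearIsometryEquiv.piLpCongrLeft 2 ℝ ℝ π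
  let L₁ : EuclideanSpace ℝ (Fin (k + l)) →L[ℝ] EuclideanSpace ℝ (Fin (k + l)) :=
    (L.toContinuousLinearEquiv : _ →L[ℝ] _)
  let L₂ : EuclideanSpace ℝ (Fin (k + l)) →L[ℝ] EuclideanSpace ℝ (Fin (k + l)) :=
    (L.symm.toContinuousLinearEquiv : _ →L[ℝ] _)
  have hL : ∀ i, L₁ (EuclideanSpace.single i 1) = EuclideanSpace.single (π i) 1 := fun i =>
    EuclideanSpace.piLpCongrLeft_single π i 1
  refine ⟨(headForm k l).compContinuousLinearMap L₂, fun h0 => ?_⟩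
  have h1 := compContinuousLinearMap_apply_single
    (a := wedgeAlt rfl ((headForm k l).compContinuousLinearMap L₂) b) L₁
  rw [h0, mul_zero, wedgeAlt_comp] at h1
  have h2 : ((headForm k l).compContinuousLinearMap L₂).compContinuousLinearMap L₁ =
      headForm k l := by
    ext w
    change headForm k l (fun i => L.symm (L (w i))) = headForm k l w
    simp only [LinearIsometryEquiv.symm_apply_apply]
  rw [h2] at h1
  refine wedgeAlt_headForm_ne_zero (b.compContinuousLinearMap L₁) ?_ h1
  change b (fun j => L₁ (EuclideanSpace.single (Fin.natAdd k j) 1)) ≠ 0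
  simp only [hL, hπ]
  exact hbv

end WedgeNondegenerate

/-! ### Nondegeneracy of the integral pairing of forms -/

section IntegralNondegenerate

open MeasureTheory

variable {n k l : ℕ} {H : Type*} [TopologicalSpace H]
  {I : ModelWithCorners ℝ (EuclideanSpace ℝ (Fin n)) H}
  {M : Type*} [TopologicalSpace M] [ChartedSpace H M] [IsManifold I ∞ M] [T2Space M]
  [CompactSpace M]

theorem localRep_modelSpace {E : Type*} [NormedAddCommGroup E] [NormedSpace ℝ E]
    (a : E → E [⋀^Fin k]→L[ℝ] ℝ) (x₀ y : E) : localRep 𝓘(ℝ, E) a x₀ y = a y := by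
  have h : trans 𝓘(ℝ, E) x₀ ((extChartAt 𝓘(ℝ, E) x₀).symm y) = id := by
    funext z
    simp only [trans, extChartAt_model_space_eq_id, PartialEquiv.refl_coe, PartialEquiv.refl_symm,
      comp_apply, id]
  have hr : range 𝓘(ℝ, E) = univ := ModelWithCorners.range_eq_univ _
  rw [localRep, h, hr, fderivWithin_univ, fderiv_id, extChartAt_model_space_eq_id]
  rfl

/-- Near a given point, there is a form with prescribed constant coefficients in a chart,
multiplied by a bump function. -/
theorem DForm.exists_bump (c : M) (a : EuclideanSpace ℝ (Fin n) [⋀^Fin k]→L[ℝ] ℝ) {V : Set M}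
    (hV : V ∈ 𝓝 c) : ∃ (ρ : M → ℝ) (α : DForm I M k), ContMDiff I 𝓘(ℝ, ℝ) ∞ ρ ∧ (∀ x, 0 ≤ ρ x) ∧
      ρ c = 1 ∧ IsClosed (tsupport ρ) ∧ tsupport ρ ⊆ V ∩ (extChartAt I c).source ∧
      (∀ x, ρ x = 0 → α.toFun x = 0) ∧
      ∀ y ∈ (extChartAt I c).target, localRep I α.toFun c y = ρ ((extChartAt I c).symm y) • a := by
  have hV' : V ∩ (extChartAt I c).source ∈ 𝓝 c :=
    Filter.inter_mem hV (extChartAt_source_mem_nhds c)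
  obtain ⟨f, -, hf⟩ := (SmoothBumpFunction.nhds_basis_tsupport (I := I) c).mem_iff.1 hV'
  have hsm : ContMDiffOn I 𝓘(ℝ, EuclideanSpace ℝ (Fin n)) ∞ (extChartAt I c)
      (extChartAt I c).source := by
    rw [extChartAt_source]
    exact contMDiffOn_extChartAt
  have hsupp : tsupport f ⊆ (extChartAt I c).source := hf.trans inter_subset_right
  -- The constant form `a` on the model space, to be pulled back along the chart and cut off by the
  -- bump function.
  let A : DForm 𝓘(ℝ, EuclideanSpace ℝ (Fin n)) (EuclideanSpace ℝ (Fin n)) k :=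
    ⟨fun _ => a, fun x₀ => by
      exact (contDiffOn_const (c := a)).congr fun y _ => localRep_modelSpace _ x₀ y⟩
  refine ⟨f, DForm.cutoffPullback (isOpen_extChartAt_source c) hsm f f.contMDiff hsupp A,
    f.contMDiff, fun _ => f.nonneg, f.eq_one, isClosed_tsupport _, hf, fun x hx => ?_,
    fun y hy => ?_⟩
  · change f x • _ = 0
    rw [hx, zero_smul]
  · have hyr : y ∈ range I := extChartAt_target_subset_range c hy
    have hys : (extChartAt I c).symm y ∈ (extChartAt I c).source := (extChartAt I c).map_target hy
    have h1 := localRep_pullback_of_contMDiffOn (I := 𝓘(ℝ, EuclideanSpace ℝ (Fin n))) (J := I)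
      (isOpen_extChartAt_source c) hsm (x₀ := extChartAt I c c) A.toFun hy hys (by
        rw [extChartAt_model_space_eq_id]
        exact mem_univ _)
    have h2 : fderivWithin ℝ (extChartAt 𝓘(ℝ, EuclideanSpace ℝ (Fin n)) (extChartAt I c c) ∘
        extChartAt I c ∘ (extChartAt I c).symm) (range I) y = ContinuousLinearMap.id ℝ _ := by
      have : (extChartAt 𝓘(ℝ, EuclideanSpace ℝ (Fin n)) (extChartAt I c c) ∘
          extChartAt I c ∘ (extChartAt I c).symm) =ᶠ[𝓝[range I] y] id := by
        filter_upwards [extChartAt_target_mem_nhdsWithin_of_mem hy] with z hz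
        rw [extChartAt_model_space_eq_id]
        exact (extChartAt I c).right_inv hz
      rw [this.fderivWithin_eq_of_mem hyr]
      exact fderivWithin_id (I.uniqueDiffOn _ hyr)
    rw [h2, localRep_modelSpace] at h1
    exact congrArg (f ((extChartAt I c).symm y) • ·) h1

/-- The pairing of forms by integration of the wedge product is nondegenerate. -/
theorem DForm.eq_zero_of_integral_wedge (hM : IsOrientedAtlas I M) (h : k + l = n)
    (β : DForm I M l) (hβ : ∀ α : DForm I M k, integral (DForm.wedge h α β) = 0) : β = 0 := by
  refine DForm.ext' fun c => ?_
  by_contra hne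
  change β.toFun c ≠ 0 at hne
  obtain ⟨a, ha⟩ := exists_wedgeAlt_ne_zero h (β.toFun c) hne
  set w : EuclideanSpace ℝ (Fin n) → ℝ := fun y =>
    wedgeAlt h a (localRep I β.toFun c y) (fun i => EuclideanSpace.single i 1) with hw
  have hyt : extChartAt I c c ∈ (extChartAt I c).target := mem_extChartAt_target c
  have hwc : w (extChartAt I c c) ≠ 0 := by
    simp only [hw, localRep_self]
    exact ha
  set t := w (extChartAt I c c) with ht
  have hcont : ContinuousOn w (extChartAt I c).target := by
    simp only [hw, wedgeAlt_apply]
    refine continuousOn_const.mul (continuousOn_finsetSum _ fun σ _ => continuousOn_const.mul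
      (continuousOn_const.mul ?_))
    exact (contDiffOn_form_iff.1 (β.smooth c) _).continuousOn
  -- Multiplying by `t`, the value of `w` at the centre, makes the integrand nonnegative whatever
  -- the sign of `t`, once the bump is supported in this neighbourhood.
  have hV : {x | x ∈ (extChartAt I c).source ∧ 0 < t * w (extChartAt I c x)} ∈ 𝓝 c := by
    have h1 : ContinuousAt (fun x => t * w (extChartAt I c x)) c := by
      refine continuousAt_const.mul ?_
      have h2 : ContinuousOn (w ∘ extChartAt I c) (extChartAt I c).source :=
        hcont.comp (continuousOn_extChartAt c) (extChartAt I c).mapsTo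
      exact h2.continuousAt (extChartAt_source_mem_nhds c)
    have h2 : 0 < t * w (extChartAt I c c) := mul_self_pos.2 hwc
    exact Filter.inter_mem (extChartAt_source_mem_nhds c) (h1.eventually (lt_mem_nhds h2))
  obtain ⟨ρ, α, hρ, hρ0, hρc, hcl, hsupp, hα0, hα⟩ := DForm.exists_bump (I := I) c a hV
  have hz : ∀ x ∉ tsupport ρ, (DForm.wedge h α β).toFun x = 0 := by
    intro x hx
    rw [DForm.wedge_toFun, hα0 x (image_eq_zero_of_notMem_tsupport hx)]
    ext v
    rw [wedgeAlt_apply]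
    simp
  have hrep : ∀ y ∈ (extChartAt I c).target, localRep I (DForm.wedge h α β).toFun c y
      (fun i => EuclideanSpace.single i 1) = ρ ((extChartAt I c).symm y) * w y := by
    intro y hy
    rw [DForm.localRep_wedge, hα y hy]
    simp only [hw, wedgeAlt_apply, ContinuousAlternatingMap.smul_apply, smul_eq_mul, mul_assoc]
    rw [mul_left_comm (ρ _)]
    congr 1
    rw [Finset.mul_sum]
    exact Finset.sum_congr rfl fun σ _ => by ring
  have hint := integrableOn_localRep (DForm.wedge h α β) hcl (hsupp.trans inter_subset_right) hz
  have h0 := hβ α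
  rw [integral_eq_of_support_subset hM _ c hint
    fun x hx => hz x fun h => hx (hsupp h).2] at h0
  have hmeas := measurableSet_extChartAt_target I c
  rw [setIntegral_congr_fun hmeas hrep] at h0
  have hint' := (hint.congr_fun hrep hmeas).const_mul t
  have hnn : ∀ y ∈ (extChartAt I c).target,
      0 ≤ t * (ρ ((extChartAt I c).symm y) * w y) := by
    intro y hy
    by_cases hy' : (extChartAt I c).symm y ∈ tsupport ρ
    · have h2 := (hsupp hy').1.2
      rw [(extChartAt I c).right_inv hy] at h2
      rw [mul_left_comm]
      exact mul_nonneg (hρ0 _) h2.le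
    · rw [image_eq_zero_of_notMem_tsupport hy', zero_mul, mul_zero]
  have hae := (setIntegral_eq_zero_iff_of_nonneg_ae
    ((ae_restrict_iff' hmeas).2 (Filter.Eventually.of_forall hnn)) hint').1 (by
      rw [integral_const_mul, h0, mul_zero])
  -- A continuous function that vanishes almost everywhere on the chart target vanishes at every
  -- point of it, even for `c` on the boundary, since the target lies in the closure of its
  -- interior.
  have heq := Measure.eqOn_of_ae_eq hae (continuousOn_const.mul
    ((hρ.continuous.comp_continuousOn (continuousOn_extChartAt_symm c)).mul hcont))
    continuousOn_const extChartAt_target_subset_closure_interior hyt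
  simp only [Pi.zero_apply, extChartAt_to_inv, hρc, one_mul] at heq
  exact mul_self_ne_zero.2 hwc heq

end IntegralNondegenerate

/-! ### Signs as real numbers -/

section Signs

/-- The sign `(-1) ^ i` as a real number. -/
def sgn (i : ℤ) : ℝ := ((i.negOnePow : ℤ) : ℝ)

theorem zsmul_negOnePow {V : Type*} [AddCommGroup V] [Module ℝ V] (i : ℤ) (v : V) :
    (i.negOnePow : ℤ) • v = sgn i • v :=
  (Int.cast_smul_eq_zsmul ℝ _ v).symm

theorem sgn_add (i j : ℤ) : sgn (i + j) = sgn i * sgn j := by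
  simp only [sgn, Int.negOnePow_add, Units.val_mul, Int.cast_mul]

theorem sgn_even {i : ℤ} (h : Even i) : sgn i = 1 := by
  simp [sgn, Int.negOnePow_even i h]

theorem sgn_odd {i : ℤ} (h : Odd i) : sgn i = -1 := by
  simp [sgn, Int.negOnePow_odd i h]

theorem sgn_natCast (k : ℕ) : sgn k = (-1 : ℝ) ^ k := by
  rcases Nat.even_or_odd k with h | h
  · rw [sgn_even (by exact_mod_cast h), h.neg_one_pow]
  · rw [sgn_odd (by exact_mod_cast h), h.neg_one_pow]

theorem sgn_mul_self (i : ℤ) : sgn i * sgn i = 1 := by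
  rw [← sgn_add]
  exact sgn_even ⟨i, rfl⟩

theorem sgn_congr {i j : ℤ} (h : Even (i - j)) : sgn i = sgn j := by
  have : i = (i - j) + j := by ring
  rw [this, sgn_add, sgn_even h, one_mul]

theorem sgn_ne_zero (i : ℤ) : sgn i ≠ 0 := fun h => by
  have := sgn_mul_self i
  rw [h, zero_mul] at this
  exact zero_ne_one this

end Signs

/-! ### Graded-commutative algebras and adjoining a square-zero generator -/

namespace GCAlg

variable (Λ : GCAlg)

theorem sign_of_mem (l : ℤ) {i : ℤ} {a : Λ} (ha : a ∈ Λ.gr i) : Λ.sign l a = sgn (i * l) • a := by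
  rw [GCAlg.sign, LinearMap.comp_apply]
  change DirectSum.toModule ℝ ℤ Λ _ (DirectSum.decompose Λ.gr a) = _
  rw [DirectSum.decompose_of_mem _ ha]
  refine (DirectSum.toModule_lof (M := fun i => Λ.gr i) ℝ i (⟨a, ha⟩ : Λ.gr i)).trans ?_
  exact zsmul_negOnePow _ _

theorem comm_of_mem {i j : ℤ} {a b : Λ} (ha : a ∈ Λ.gr i) (hb : b ∈ Λ.gr j) :
    a * b = sgn (i * j) • (b * a) :=
  (Λ.comm i j a b ha hb).trans (zsmul_negOnePow _ _)

/-- Graded commutativity says that `a * a` is its own negative, and `2` is invertible over the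
reals. -/
theorem mul_self_eq_zero {i : ℤ} (hi : Odd i) {a : Λ} (ha : a ∈ Λ.gr i) : a * a = 0 := by
  have h := Λ.comm_of_mem ha ha
  rw [sgn_odd (hi.mul hi), neg_smul, one_smul] at h
  have h2 : (2 : ℝ) • (a * a) = 0 := by
    rw [two_smul]
    nth_rewrite 1 [h]
    exact neg_add_cancel _
  exact (smul_eq_zero.1 h2).resolve_left two_ne_zero

/-- The degree is additive on products of homogeneous elements, so the sign is too,
multiplicatively. This makes the multiplication on `SqZero` associative. -/
theorem sign_mul (l : ℤ) (a b : Λ) : Λ.sign l (a * b) = Λ.sign l a * Λ.sign l b := by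
  induction a using DirectSum.Decomposition.inductionOn Λ.gr with
  | zero => simp
  | add a a' ha ha' => rw [add_mul, map_add, ha, ha', map_add, add_mul]
  | @homogeneous i a =>
    induction b using DirectSum.Decomposition.inductionOn Λ.gr with
    | zero => simp
    | add b b' hb hb' => rw [mul_add, map_add, hb, hb', map_add, mul_add]
    | @homogeneous j b =>
      rw [sign_of_mem Λ l a.2, sign_of_mem Λ l b.2,
        sign_of_mem Λ l (SetLike.mul_mem_graded a.2 b.2), smul_mul_smul_comm, ← sgn_add, add_mul]

theorem sign_one (l : ℤ) : Λ.sign l 1 = 1 := by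
  rw [sign_of_mem Λ l (SetLike.GradedOne.one_mem (A := Λ.gr)), zero_mul, sgn_even Even.zero, one_smul]

/-- The module `Λ ⊕ θ Λ` underlying the algebra `Λ[θ] / θ²`, with `θ` of degree `m`. -/
def SqZero (_ : ℤ) : Type := Λ × Λ

namespace SqZero

variable {Λ} {m : ℤ}

instance : AddCommGroup (SqZero Λ m) := inferInstanceAs (AddCommGroup (Λ × Λ))
instance : Module ℝ (SqZero Λ m) := inferInstanceAs (Module ℝ (Λ × Λ))

/-- The generator `θ` is kept on the left, so moving it past `x.1` costs the sign of degree `m`; the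
term with `θ²` is dropped. -/
instance : Mul (SqZero Λ m) := ⟨fun x y => (x.1 * y.1, Λ.sign m x.1 * y.2 + x.2 * y.1)⟩
instance : One (SqZero Λ m) := ⟨(1, 0)⟩

theorem fst_mul (x y : SqZero Λ m) : (x * y).1 = x.1 * y.1 := rfl
theorem snd_mul (x y : SqZero Λ m) : (x * y).2 = Λ.sign m x.1 * y.2 + x.2 * y.1 := rfl

theorem fst_add (x y : SqZero Λ m) : (x + y).1 = x.1 + y.1 := rfl
theorem snd_add (x y : SqZero Λ m) : (x + y).2 = x.2 + y.2 := rfl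

instance : Ring (SqZero Λ m) :=
  { (inferInstance : AddCommGroup (SqZero Λ m)) with
    mul := (· * ·)
    one := 1
    left_distrib := fun x y z => Prod.ext (mul_add _ _ _) (by
      simp only [snd_mul, fst_add, snd_add, mul_add]; abel)
    right_distrib := fun x y z => Prod.ext (add_mul _ _ _) (by
      simp only [snd_mul, fst_add, snd_add, map_add, add_mul]; abel)
    zero_mul := fun x => Prod.ext (zero_mul _) (by
      change Λ.sign m 0 * x.2 + 0 * x.1 = 0
      rw [map_zero, zero_mul, zero_mul, add_zero])
    mul_zero := fun x => Prod.ext (mul_zero _) (by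
      change Λ.sign m x.1 * 0 + x.2 * 0 = 0
      rw [mul_zero, mul_zero, add_zero])
    mul_assoc := fun x y z => Prod.ext (mul_assoc _ _ _) (by
      simp only [fst_mul, snd_mul, sign_mul, mul_add, add_mul, mul_assoc, add_assoc])
    one_mul := fun x => Prod.ext (one_mul _) (by
      change Λ.sign m 1 * x.2 + 0 * x.1 = x.2
      rw [sign_one, one_mul, zero_mul, add_zero])
    mul_one := fun x => Prod.ext (mul_one _) (by
      change Λ.sign m x.1 * 0 + x.2 * 1 = x.2
      rw [mul_zero, mul_one, zero_add]) }

instance : Algebra ℝ (SqZero Λ m) := Algebra.ofModule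
  (fun r x y => Prod.ext (smul_mul_assoc r x.1 y.1) (by
    change Λ.sign m (r • x.1) * y.2 + (r • x.2) * y.1 = r • (Λ.sign m x.1 * y.2 + x.2 * y.1)
    rw [map_smul, smul_mul_assoc, smul_mul_assoc, smul_add]))
  (fun r x y => Prod.ext (mul_smul_comm r x.1 y.1) (by
    change Λ.sign m x.1 * (r • y.2) + x.2 * (r • y.1) = r • (Λ.sign m x.1 * y.2 + x.2 * y.1)
    rw [mul_smul_comm, mul_smul_comm, smul_add]))

/-- The element `a + θ b`. -/
def mk (a b : Λ) : SqZero Λ m := (a, b)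

theorem mk_add (a b a' b' : Λ) : (mk (a + a') (b + b') : SqZero Λ m) = mk a b + mk a' b' := rfl

variable (Λ m) in
/-- The grading of `Λ[θ]`. -/
def gr (i : ℤ) : Submodule ℝ (SqZero Λ m) := (Λ.gr i).prod (Λ.gr (i - m))

theorem isInternal_gr : DirectSum.IsInternal (gr Λ m) := by
  rw [DirectSum.isInternal_submodule_iff_iSupIndep_and_iSup_eq_top]
  constructor
  · intro j
    rw [Submodule.disjoint_def]
    intro x hx hx'
    let P : Submodule ℝ (Λ × Λ) := (LinearMap.ker (GradedAlgebra.proj Λ.gr j)).prod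
      (LinearMap.ker (GradedAlgebra.proj Λ.gr (j - m)))
    have hP : (⨆ i, ⨆ (_ : i ≠ j), gr Λ m i) ≤ (P : Submodule ℝ (Λ × Λ)) := by
      refine iSup_le fun i => iSup_le fun hi y hy => ?_
      refine ⟨?_, ?_⟩
      · exact DirectSum.decompose_of_mem_ne Λ.gr hy.1 hi
      · exact DirectSum.decompose_of_mem_ne Λ.gr hy.2 (by omega)
    have hxP := hP hx'
    refine Prod.ext ?_ ?_
    · exact (DirectSum.decompose_of_mem_same Λ.gr hx.1).symm.trans hxP.1
    · exact (DirectSum.decompose_of_mem_same Λ.gr hx.2).symm.trans hxP.2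
  · rw [eq_top_iff]
    have h1 : ∀ a : Λ, (mk a 0 : SqZero Λ m) ∈ ⨆ i, gr Λ m i := by
      intro a
      induction a using DirectSum.Decomposition.inductionOn Λ.gr with
      | zero => exact Submodule.zero_mem (⨆ i, gr Λ m i)
      | @homogeneous i a =>
        exact Submodule.mem_iSup_of_mem i ⟨a.2, Submodule.zero_mem _⟩
      | add a b ha hb =>
        have := Submodule.add_mem _ ha hb
        rwa [← mk_add, add_zero] at this
    have h2 : ∀ a : Λ, (mk 0 a : SqZero Λ m) ∈ ⨆ i, gr Λ m i := by
      intro a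
      induction a using DirectSum.Decomposition.inductionOn Λ.gr with
      | zero => exact Submodule.zero_mem (⨆ i, gr Λ m i)
      | @homogeneous i a =>
        refine Submodule.mem_iSup_of_mem (i + m) ⟨Submodule.zero_mem _, ?_⟩
        rw [add_sub_cancel_right]
        exact a.2
      | add a b ha hb =>
        have := Submodule.add_mem _ ha hb
        rwa [← mk_add, add_zero] at this
    rintro ⟨a, b⟩ -
    have := Submodule.add_mem _ (h1 a) (h2 b)
    rwa [← mk_add, add_zero, zero_add] at this

instance : SetLike.GradedMonoid (gr Λ m) where
  one_mem := ⟨SetLike.GradedOne.one_mem, Submodule.zero_mem _⟩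
  mul_mem := by
    rintro i j x y ⟨hx1, hx2⟩ ⟨hy1, hy2⟩
    refine ⟨SetLike.mul_mem_graded hx1 hy1, Submodule.add_mem _ ?_ ?_⟩
    · rw [sign_of_mem Λ m hx1, smul_mul_assoc, add_sub_assoc]
      exact Submodule.smul_mem _ _ (SetLike.mul_mem_graded hx1 hy2)
    · rw [add_sub_right_comm]
      exact SetLike.mul_mem_graded hx2 hy1

instance : GradedAlgebra (gr Λ m) :=
  { (inferInstance : SetLike.GradedMonoid (gr Λ m)), isInternal_gr.chooseDecomposition with }

end SqZero

/-- The graded-commutative algebra `Λ[θ] / θ²`, with `θ` of degree `m`. -/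
def sqZero (m : ℤ) : GCAlg where
  carrier := SqZero Λ m
  gr := SqZero.gr Λ m
  comm := by
    rintro i j x y ⟨hx1, hx2⟩ ⟨hy1, hy2⟩
    rw [zsmul_negOnePow]
    refine Prod.ext (Λ.comm_of_mem hx1 hy1) ?_
    change Λ.sign m x.1 * y.2 + x.2 * y.1 = sgn (i * j) • (Λ.sign m y.1 * x.2 + y.2 * x.1)
    rw [sign_of_mem Λ m hx1, sign_of_mem Λ m hy1, smul_mul_assoc, smul_mul_assoc,
      Λ.comm_of_mem hx1 hy2, Λ.comm_of_mem hx2 hy1, smul_add, smul_smul, smul_smul, add_comm,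
      ← sgn_add, ← sgn_add]
    congr 2
    · exact sgn_congr ⟨-(m * j), by ring⟩
    · exact sgn_congr ⟨0, by ring⟩

/-- The inclusion `Λ → Λ[θ]`. -/
def sqZeroInl (m : ℤ) : GCAlg.Hom Λ (Λ.sqZero m) where
  toAlgHom := AlgHom.ofLinearMap (A := Λ) (B := SqZero Λ m) (LinearMap.inl ℝ Λ Λ) rfl
    (fun a b => Prod.ext rfl (by
      change 0 = Λ.sign m a * 0 + 0 * b
      rw [mul_zero, zero_mul, add_zero]))
  map_gr _ _ ha := ⟨ha, Submodule.zero_mem _⟩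

/-- The generator `θ`. -/
def sqZeroGen (m : ℤ) : Λ.sqZero m := ((0, 1) : Λ × Λ)

theorem sqZeroGen_mem (m : ℤ) : Λ.sqZeroGen m ∈ (Λ.sqZero m).gr m :=
  ⟨Submodule.zero_mem _, by rw [sub_self]; exact SetLike.GradedOne.one_mem⟩

/-- The map `b ↦ θ b`. -/
def sqZeroInr (m : ℤ) : Λ →ₗ[ℝ] Λ.sqZero m :=
  ({ toFun := fun b => SqZero.mk 0 b
     map_add' := fun _ _ => Prod.ext (add_zero (0 : Λ)).symm rfl
     map_smul' := fun r _ => Prod.ext (smul_zero (A := Λ) r).symm rfl } : Λ →ₗ[ℝ] SqZero Λ m)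

theorem sqZeroInr_injective (m : ℤ) : Function.Injective (Λ.sqZeroInr m) :=
  fun _ _ h => congrArg Prod.snd h

theorem sqZeroGen_mul (m : ℤ) (b : Λ) :
    Λ.sqZeroGen m * (Λ.sqZeroInl m).toAlgHom b = Λ.sqZeroInr m b := by
  refine Prod.ext (zero_mul b) ?_
  change Λ.sign m 0 * 0 + 1 * b = b
  rw [mul_zero, one_mul, zero_add]

theorem Hom.map_sign {Λ Λ' : GCAlg} (φ : GCAlg.Hom Λ Λ') (l : ℤ) {i : ℤ} {a : Λ}
    (ha : a ∈ Λ.gr i) : φ.toAlgHom (Λ.sign l a) = Λ'.sign l (φ.toAlgHom a) := by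
  rw [sign_of_mem Λ l ha, sign_of_mem Λ' l (φ.map_gr i a ha), map_smul]

end GCAlg

/-! ### Separating families and tensor products -/

section Separation

variable {W L : Type*} [AddCommGroup W] [Module ℝ W] [AddCommGroup L] [Module ℝ L]

/-- A tensor vanishes if its images under a separating family of maps of one factor vanish. -/
theorem eq_zero_of_rTensor_eq_zero {ι : Type*} {W' : ι → Type*} [∀ j, AddCommGroup (W' j)]
    [∀ j, Module ℝ (W' j)] (f : ∀ j, W →ₗ[ℝ] W' j) (hf : ∀ w, (∀ j, f j w = 0) → w = 0)
    (t : W ⊗[ℝ] L) (ht : ∀ j, (f j).rTensor L t = 0) : t = 0 := by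
  classical
  -- A basis of the coefficients turns the tensor into finitely many elements of `W`, on which each
  -- `f j` acts coordinatewise.
  let b := Module.Basis.ofVectorSpace ℝ L
  apply (TensorProduct.equivFinsuppOfBasisRight (M := W) b).injective
  rw [map_zero]
  ext r
  refine hf _ fun j => ?_
  have key : ∀ s : W ⊗[ℝ] L, f j (TensorProduct.equivFinsuppOfBasisRight b s r) =
      TensorProduct.equivFinsuppOfBasisRight b ((f j).rTensor L s) r := by
    intro s
    induction s using TensorProduct.induction_on with
    | zero => simp
    | tmul w a => simp
    | add s s' hs hs' => simp only [map_add, Finsupp.add_apply, hs, hs']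
  rw [key, ht, map_zero]
  rfl

end Separation

/-! ### The algebra of superfields and of their pairing -/

section SuperForms

variable {n : ℕ} {H : Type*} [TopologicalSpace H]
  {I : ModelWithCorners ℝ (EuclideanSpace ℝ (Fin n)) H}
  {M : Type u} [TopologicalSpace M] [ChartedSpace H M] {Λ Λ' : GCAlg}

/-- The form `α` of degree `k` with the coefficient `a`. -/
def superTmul {k : ℕ} (α : DForm I M k) (a : Λ) : Forms I M ⊗[ℝ] Λ :=
  DirectSum.lof ℝ ℕ (fun k => DForm I M k) k α ⊗ₜ[ℝ] a

variable (I M Λ) in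
/-- The inhomogeneous forms with coefficients in `Λ` of total degree `p`. -/
def superDeg (p : ℤ) : Submodule ℝ (Forms I M ⊗[ℝ] Λ) :=
  Submodule.span ℝ {t | ∃ (k : ℕ) (α : DForm I M k), ∃ a ∈ Λ.gr (p - k), t = superTmul α a}

theorem superTmul_mem {p : ℤ} {k : ℕ} (α : DForm I M k) {a : Λ} (ha : a ∈ Λ.gr (p - k)) :
    superTmul α a ∈ superDeg I M Λ p :=
  Submodule.subset_span ⟨k, α, a, ha, rfl⟩

/-- Sign rules make sense only for homogeneous coefficients. On a superfield of fixed total degree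
they may be checked on a single form whose coefficient has the complementary degree. -/
theorem superDeg_ext {V : Type*} [AddCommGroup V] [Module ℝ V] {p : ℤ}
    {F G : Forms I M ⊗[ℝ] Λ →ₗ[ℝ] V}
    (h : ∀ (k : ℕ) (α : DForm I M k), ∀ a ∈ Λ.gr (p - k), F (superTmul α a) = G (superTmul α a))
    {X : Forms I M ⊗[ℝ] Λ} (hX : X ∈ superDeg I M Λ p) : F X = G X := by
  have : superDeg I M Λ p ≤ LinearMap.eqLocus F G := by
    refine Submodule.span_le.2 ?_
    rintro _ ⟨k, α, a, ha, rfl⟩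
    exact h k α a ha
  exact this hX

theorem superDeg_ext₂ {V : Type*} [AddCommGroup V] [Module ℝ V] {p q : ℤ}
    {F G : Forms I M ⊗[ℝ] Λ →ₗ[ℝ] Forms I M ⊗[ℝ] Λ →ₗ[ℝ] V}
    (h : ∀ (k l : ℕ) (α : DForm I M k) (β : DForm I M l), ∀ a ∈ Λ.gr (p - k), ∀ b ∈ Λ.gr (q - l),
      F (superTmul α a) (superTmul β b) = G (superTmul α a) (superTmul β b))
    {X Y : Forms I M ⊗[ℝ] Λ} (hX : X ∈ superDeg I M Λ p) (hY : Y ∈ superDeg I M Λ q) :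
    F X Y = G X Y := by
  refine superDeg_ext (F := F X) (G := G X) (fun l β b hb => ?_) hY
  exact superDeg_ext (F := F.flip (superTmul β b)) (G := G.flip (superTmul β b))
    (fun k α a ha => h k l α β a ha b hb) hX

theorem superDeg_mapsTo {H' : Type*} [TopologicalSpace H'] {m : ℕ}
    {J : ModelWithCorners ℝ (EuclideanSpace ℝ (Fin m)) H'}
    {N : Type v} [TopologicalSpace N] [ChartedSpace H' N] {p q : ℤ}
    {F : Forms I M ⊗[ℝ] Λ →ₗ[ℝ] Forms J N ⊗[ℝ] Λ'}
    (h : ∀ (k : ℕ) (α : DForm I M k), ∀ a ∈ Λ.gr (p - k), F (superTmul α a) ∈ superDeg J N Λ' q)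
    {X : Forms I M ⊗[ℝ] Λ} (hX : X ∈ superDeg I M Λ p) : F X ∈ superDeg J N Λ' q := by
  have : superDeg I M Λ p ≤ (superDeg J N Λ' q).comap F := by
    refine Submodule.span_le.2 ?_
    rintro _ ⟨k, α, a, ha, rfl⟩
    exact h k α a ha
  exact this hX

/-- Right multiplication by `ε`. -/
def superRmul (ε : Λ) : Forms I M ⊗[ℝ] Λ →ₗ[ℝ] Forms I M ⊗[ℝ] Λ :=
  (LinearMap.mulRight ℝ ε).lTensor _

/-- Change of parameters. -/
def superMap (φ : GCAlg.Hom Λ Λ') : Forms I M ⊗[ℝ] Λ →ₗ[ℝ] Forms I M ⊗[ℝ] Λ' :=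
  φ.toAlgHom.toLinearMap.lTensor _

theorem superRmul_superTmul {k : ℕ} (α : DForm I M k) (a ε : Λ) :
    superRmul ε (superTmul α a) = superTmul α (a * ε) := rfl

theorem superMap_superTmul {k : ℕ} (φ : GCAlg.Hom Λ Λ') (α : DForm I M k) (a : Λ) :
    superMap φ (superTmul α a) = superTmul α (φ.toAlgHom a) := rfl

theorem superRmul_mem {p e : ℤ} {ε : Λ} (hε : ε ∈ Λ.gr e) {X : Forms I M ⊗[ℝ] Λ}
    (hX : X ∈ superDeg I M Λ p) : superRmul ε X ∈ superDeg I M Λ (p + e) := by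
  refine superDeg_mapsTo (fun k α a ha => superTmul_mem α ?_) hX
  rw [add_sub_right_comm]
  exact SetLike.mul_mem_graded ha hε

theorem superMap_mem {p : ℤ} (φ : GCAlg.Hom Λ Λ') {X : Forms I M ⊗[ℝ] Λ}
    (hX : X ∈ superDeg I M Λ p) : superMap φ X ∈ superDeg I M Λ' p :=
  superDeg_mapsTo (F := superMap φ) (fun _ α _ ha => superTmul_mem α (φ.map_gr _ _ ha)) hX

section Derivative

variable [IsManifold I ∞ M]

theorem superD_superTmul {k : ℕ} (α : DForm I M k) (a : Λ) :
    superD (superTmul α a) = superTmul (DForm.d α) a := by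
  refine congrArg (· ⊗ₜ[ℝ] a) ?_
  exact DirectSum.toModule_lof ℝ k α

theorem superD_mem {p : ℤ} {X : Forms I M ⊗[ℝ] Λ} (hX : X ∈ superDeg I M Λ p) :
    superD X ∈ superDeg I M Λ (p + 1) := by
  refine superDeg_mapsTo (fun k α a ha => ?_) hX
  rw [superD_superTmul]
  refine superTmul_mem _ ?_
  push_cast
  rwa [add_sub_add_right_eq_sub]

theorem totalD_totalD (α : Forms I M) : totalD (totalD α) = 0 := by
  have h : (totalD ∘ₗ totalD : Forms I M →ₗ[ℝ] Forms I M) = 0 := by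
    refine DirectSum.linearMap_ext ℝ fun k => LinearMap.ext fun α => ?_
    have h1 : ∀ (k : ℕ) (α : DForm I M k), totalD (DirectSum.lof ℝ ℕ (fun k => DForm I M k) k α) =
        DirectSum.lof ℝ ℕ (fun k => DForm I M k) (k + 1) (DForm.d α) := fun k α =>
      DirectSum.toModule_lof ℝ k α
    simp only [LinearMap.comp_apply, h1, DForm.d_d, map_zero, LinearMap.zero_apply]
  exact LinearMap.congr_fun h α

theorem superD_superRmul (ε : Λ) (X : Forms I M ⊗[ℝ] Λ) :
    superD (superRmul ε X) = superRmul ε (superD X) := by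
  induction X using TensorProduct.induction_on with
  | zero => simp only [map_zero]
  | tmul α a => rfl
  | add X Y hX hY => simp only [map_add, hX, hY]

theorem superD_superMap (φ : GCAlg.Hom Λ Λ') (X : Forms I M ⊗[ℝ] Λ) :
    superD (superMap φ X) = superMap φ (superD X) := by
  induction X using TensorProduct.induction_on with
  | zero => simp only [map_zero]
  | tmul α a => rfl
  | add X Y hX hY => simp only [map_add, hX, hY]

end Derivative

section Pairing

variable [IsManifold I ∞ M] [T2Space M] [CompactSpace M]

variable (I M Λ) in
/-- The pairing of superfields as a bilinear map. -/
def pairingL : Forms I M ⊗[ℝ] Λ →ₗ[ℝ] Forms I M ⊗[ℝ] Λ →ₗ[ℝ] Λ :=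
  ∑ k : Fin (n + 1), ((superWedge (k := (k : ℕ)) (l := n - k) (m := n) (by omega)).compl₁₂
    (superComp k) (superComp (n - k))).compr₂ superIntegral

theorem pairingL_apply (X Y : Forms I M ⊗[ℝ] Λ) : pairingL I M Λ X Y = pairing X Y := by
  simp only [pairingL, LinearMap.sum_apply, pairing]
  rfl

theorem superComp_superTmul {k : ℕ} (α : DForm I M k) (a : Λ) :
    superComp k (superTmul α a) = α ⊗ₜ[ℝ] a := by
  refine congrArg (· ⊗ₜ[ℝ] a) ?_
  exact DirectSum.component.lof_self ℝ k α

theorem superComp_superTmul_of_ne {k l : ℕ} (h : k ≠ l) (α : DForm I M k) (a : Λ) :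
    superComp l (superTmul α a) = 0 := by
  have : DirectSum.component ℝ ℕ (fun k => DForm I M k) l
      (DirectSum.lof ℝ ℕ (fun k => DForm I M k) k α) = 0 := by
    rw [DirectSum.component.of]
    exact dif_neg h
  refine (congrArg (· ⊗ₜ[ℝ] a) this).trans ?_
  exact TensorProduct.zero_tmul _ _

theorem pairing_superTmul {k l : ℕ} (h : k + l = n) (α : DForm I M k) (β : DForm I M l)
    (a b : Λ) : pairing (superTmul α a) (superTmul β b) =
      integral (DForm.wedge h α β) • (Λ.sign l a * b) := by
  obtain rfl : l = n - k := by omega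
  rw [pairing, Finset.sum_eq_single (⟨k, by omega⟩ : Fin (n + 1))]
  · rw [superComp_superTmul, superComp_superTmul]
    rfl
  · intro k' _ hk'
    have : k ≠ k' := fun h => hk' (Fin.ext h.symm)
    rw [superComp_superTmul_of_ne this, map_zero, LinearMap.zero_apply, map_zero]
  · exact fun h => (h (Finset.mem_univ _)).elim

theorem pairing_superTmul_of_ne {k l : ℕ} (h : k + l ≠ n) (α : DForm I M k) (β : DForm I M l)
    (a b : Λ) : pairing (superTmul α a) (superTmul β b) = 0 := by
  refine Finset.sum_eq_zero fun k' _ => ?_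
  by_cases hk : k = k'
  · have : l ≠ n - k' := by have := k'.2; omega
    rw [superComp_superTmul_of_ne this, map_zero, map_zero]
  · rw [superComp_superTmul_of_ne hk, map_zero, LinearMap.zero_apply, map_zero]

theorem pairing_add_left (X X' Y : Forms I M ⊗[ℝ] Λ) :
    pairing (X + X') Y = pairing X Y + pairing X' Y := by
  simp only [← pairingL_apply, map_add, LinearMap.add_apply]

theorem pairing_add_right (X Y Y' : Forms I M ⊗[ℝ] Λ) :
    pairing X (Y + Y') = pairing X Y + pairing X Y' := by
  simp only [← pairingL_apply, map_add]

theorem pairing_smul_left (t : ℝ) (X Y : Forms I M ⊗[ℝ] Λ) :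
    pairing (t • X) Y = t • pairing X Y := by
  simp only [← pairingL_apply, map_smul, LinearMap.smul_apply]

theorem pairing_smul_right (t : ℝ) (X Y : Forms I M ⊗[ℝ] Λ) :
    pairing X (t • Y) = t • pairing X Y := by
  simp only [← pairingL_apply, map_smul]

theorem pairing_zero_left (Y : Forms I M ⊗[ℝ] Λ) : pairing 0 Y = 0 := by
  simp only [← pairingL_apply, map_zero, LinearMap.zero_apply]

theorem pairing_zero_right (X : Forms I M ⊗[ℝ] Λ) : pairing X 0 = 0 := by
  simp only [← pairingL_apply, map_zero]

variable {p q : ℤ} {X Y : Forms I M ⊗[ℝ] Λ}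

theorem pairing_mem (hX : X ∈ superDeg I M Λ p) (hY : Y ∈ superDeg I M Λ q) :
    pairing X Y ∈ Λ.gr (p + q - n) := by
  -- Passing to the quotient by the graded piece turns membership into an identity of bilinear maps.
  have h := superDeg_ext₂ (F := (pairingL I M Λ).compr₂ (Λ.gr (p + q - n)).mkQ) (G := 0)
    (fun k l α β a ha b hb => ?_) hX hY
  · rw [LinearMap.compr₂_apply, pairingL_apply] at h
    exact (Submodule.Quotient.mk_eq_zero _).1 h
  · rw [LinearMap.compr₂_apply, pairingL_apply]
    refine (Submodule.Quotient.mk_eq_zero _).2 ?_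
    by_cases hkl : k + l = n
    · rw [pairing_superTmul hkl, Λ.sign_of_mem l ha, smul_mul_assoc]
      have e : p + q - n = (p - k) + (q - l) := by rw [← hkl]; push_cast; ring
      rw [e]
      exact Submodule.smul_mem _ _ (Submodule.smul_mem _ _ (SetLike.mul_mem_graded ha hb))
    · rw [pairing_superTmul_of_ne hkl]
      exact Submodule.zero_mem _

/-- The sign from exchanging the forms, the sign from exchanging the coefficients, and those from
moving coefficients past forms combine into one depending on the total degrees only. -/
theorem pairing_comm (hX : X ∈ superDeg I M Λ p) (hY : Y ∈ superDeg I M Λ q) :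
    pairing X Y = sgn (p * q) • pairing Y X := by
  have h := superDeg_ext₂ (F := pairingL I M Λ) (G := sgn (p * q) • (pairingL I M Λ).flip)
    (fun k l α β a ha b hb => ?_) hX hY
  · simpa only [LinearMap.smul_apply, LinearMap.flip_apply, pairingL_apply] using h
  · simp only [LinearMap.smul_apply, LinearMap.flip_apply, pairingL_apply]
    by_cases hkl : k + l = n
    · have hlk : l + k = n := by omega
      rw [pairing_superTmul hkl, pairing_superTmul hlk, Λ.sign_of_mem l ha, Λ.sign_of_mem k hb,
        DForm.wedge_comm hkl hlk, map_smul, smul_mul_assoc, smul_mul_assoc, Λ.comm_of_mem ha hb,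
        smul_eq_mul]
      have e1 : ((-1 : ℝ) ^ (k * l)) = sgn (k * l) := by rw [← sgn_natCast]; push_cast; rfl
      rw [e1]
      simp only [smul_smul]
      congr 1
      have e2 : sgn ((p - k) * l) * sgn ((p - k) * (q - l)) =
          sgn (p * q) * sgn (k * l) * sgn ((q - l) * k) := by
        simp only [← sgn_add]
        exact sgn_congr ⟨-(k * q), by ring⟩
      linear_combination (integral (DForm.wedge hkl α β)) * e2
    · rw [pairing_superTmul_of_ne hkl, pairing_superTmul_of_ne (by omega), smul_zero]

theorem pairing_superRmul_right (ε : Λ) (hX : X ∈ superDeg I M Λ p)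
    (hY : Y ∈ superDeg I M Λ q) : pairing X (superRmul ε Y) = pairing X Y * ε := by
  have h := superDeg_ext₂ (F := (pairingL I M Λ).compl₂ (superRmul ε))
    (G := (pairingL I M Λ).compr₂ (LinearMap.mulRight ℝ ε)) (fun k l α β a ha b hb => ?_) hX hY
  · simpa only [LinearMap.compl₂_apply, LinearMap.compr₂_apply, pairingL_apply,
      LinearMap.mulRight_apply] using h
  · simp only [LinearMap.compl₂_apply, LinearMap.compr₂_apply, pairingL_apply,
      superRmul_superTmul, LinearMap.mulRight_apply]
    by_cases hkl : k + l = n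
    · rw [pairing_superTmul hkl, pairing_superTmul hkl, smul_mul_assoc, mul_assoc]
    · rw [pairing_superTmul_of_ne hkl, pairing_superTmul_of_ne hkl, zero_mul]

/-- The parameter has to pass the second factor. Exchanging the factors twice reduces this to the
right multiplication of the second factor, which costs no sign. -/
theorem pairing_superRmul_left {e : ℤ} {ε : Λ} (hε : ε ∈ Λ.gr e) (hX : X ∈ superDeg I M Λ p)
    (hY : Y ∈ superDeg I M Λ q) : pairing (superRmul ε X) Y = sgn (e * q) • (pairing X Y * ε) := by
  rw [pairing_comm (superRmul_mem hε hX) hY, pairing_superRmul_right ε hY hX, pairing_comm hX hY,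
    smul_mul_assoc, smul_smul, ← sgn_add]
  congr 1
  exact sgn_congr ⟨0, by ring⟩

theorem pairing_superMap (φ : GCAlg.Hom Λ Λ') (hX : X ∈ superDeg I M Λ p)
    (hY : Y ∈ superDeg I M Λ q) :
    pairing (superMap φ X) (superMap φ Y) = φ.toAlgHom (pairing X Y) := by
  have h := superDeg_ext₂ (F := (pairingL I M Λ').compl₁₂ (superMap φ) (superMap φ))
    (G := (pairingL I M Λ).compr₂ φ.toAlgHom.toLinearMap) (fun k l α β a ha b hb => ?_) hX hY
  · simpa only [LinearMap.compl₁₂_apply, LinearMap.compr₂_apply, pairingL_apply,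
      AlgHom.toLinearMap_apply] using h
  · simp only [LinearMap.compl₁₂_apply, LinearMap.compr₂_apply, pairingL_apply,
      superMap_superTmul, AlgHom.toLinearMap_apply]
    by_cases hkl : k + l = n
    · rw [pairing_superTmul hkl, pairing_superTmul hkl, map_smul, map_mul, φ.map_sign l ha]
    · rw [pairing_superTmul_of_ne hkl, pairing_superTmul_of_ne hkl, map_zero]

/-- The pairing is nondegenerate, after extension of parameters. -/
theorem eq_zero_of_pairing_eq_zero (hM : IsOrientedAtlas I M) (hY : Y ∈ superDeg I M Λ q)
    (h : ∀ (Λ' : GCAlg) (φ : GCAlg.Hom Λ Λ'), ∀ X ∈ superDeg I M Λ' p,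
      pairing X (superMap φ Y) = 0) : Y = 0 := by
  refine eq_zero_of_rTensor_eq_zero (fun l : ℕ => DirectSum.component ℝ ℕ (fun k => DForm I M k) l)
    (fun w hw => DFinsupp.ext hw) Y fun l => ?_
  by_cases hl : l ≤ n
  · have hkl : (n - l) + l = n := by omega
    refine eq_zero_of_rTensor_eq_zero
      (fun α : DForm I M (n - l) => integral ∘ₗ DForm.wedge hkl α)
      (fun β hβ => DForm.eq_zero_of_integral_wedge hM hkl β hβ) _ fun α => ?_
    -- This degree makes `α θ` a superfield of total degree `p` for an arbitrary form `α`. Pairing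
    -- with it isolates the part of `Y` of form degree `l`, placed injectively behind `θ`.
    set m : ℤ := p - (n - l : ℕ) with hm
    have h1 := h (Λ.sqZero m) (Λ.sqZeroInl m) (superTmul α (Λ.sqZeroGen m))
      (superTmul_mem α (Λ.sqZeroGen_mem m))
    let P : Forms I M ⊗[ℝ] Λ →ₗ[ℝ] Λ := (TensorProduct.lid ℝ Λ).toLinearMap ∘ₗ
      (integral ∘ₗ DForm.wedge hkl α).rTensor Λ ∘ₗ superComp l
    have h2 := superDeg_ext (F := (pairingL I M (Λ.sqZero m)
        (superTmul α (Λ.sqZeroGen m))) ∘ₗ superMap (Λ.sqZeroInl m))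
      (G := Λ.sqZeroInr m ∘ₗ (sgn (m * l) • P))
      (fun l' β b hb => ?_) hY
    · rw [LinearMap.comp_apply, pairingL_apply, h1, LinearMap.comp_apply] at h2
      have h3 : (sgn (m * l) • P) Y = 0 := (map_eq_zero_iff _ (Λ.sqZeroInr_injective m)).1 h2.symm
      have h4 : P Y = 0 := (smul_eq_zero.1 h3).resolve_left (sgn_ne_zero _)
      exact (TensorProduct.lid ℝ Λ).map_eq_zero_iff.1 h4
    · rw [LinearMap.comp_apply, pairingL_apply, superMap_superTmul]
      by_cases hll : l = l'
      · subst hll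
        rw [pairing_superTmul hkl, GCAlg.sign_of_mem _ l (Λ.sqZeroGen_mem m), smul_mul_assoc,
          GCAlg.sqZeroGen_mul]
        have h5 : P (superTmul β b) = integral (DForm.wedge hkl α β) • b := by
          simp only [P, LinearMap.comp_apply, superComp_superTmul]
          rfl
        rw [LinearMap.comp_apply, LinearMap.smul_apply, h5, map_smul, map_smul]
        exact smul_comm _ _ _
      · have h5 : P (superTmul β b) = 0 := by
          simp only [P, LinearMap.comp_apply, superComp_superTmul_of_ne (Ne.symm hll), map_zero]
        rw [pairing_superTmul_of_ne (by omega), LinearMap.comp_apply, LinearMap.smul_apply, h5,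
          smul_zero, map_zero]
  -- Above the dimension the pairing sees nothing, but there are no nonzero forms either.
  · have h0 : DirectSum.component ℝ ℕ (fun k => DForm I M k) l = 0 := LinearMap.ext fun w =>
      DForm.eq_zero_of_finrank_lt (by rw [finrank_euclideanSpace_fin]; omega) _
    rw [h0, LinearMap.rTensor_zero, LinearMap.zero_apply]

end Pairing

end SuperForms

/-! ### Stokes' theorem and pullback for superfields -/

section SuperStokes

variable {m : ℕ} {H : Type*} [TopologicalSpace H] {Λ Λ' : GCAlg}

/-- The Leibniz sign of a `k`-form becomes `(-1)^p` with the total degree `p`: in the second term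
the coefficient, of degree `p - k`, passes a form of one degree more. -/
theorem pairing_superD_superTmul {I : ModelWithCorners ℝ (EuclideanSpace ℝ (Fin (m + 1))) H}
    {M : Type u} [TopologicalSpace M] [ChartedSpace H M] [IsManifold I ∞ M] [T2Space M]
    [CompactSpace M] {p : ℤ} {k l : ℕ} (h : k + l = m) (α : DForm I M k) (β : DForm I M l)
    {a : Λ} (ha : a ∈ Λ.gr (p - k)) (b : Λ) :
    pairing (superD (superTmul α a)) (superTmul β b) +
      sgn p • pairing (superTmul α a) (superD (superTmul β b)) =
      integral (DForm.d (DForm.wedge h α β)) • (Λ.sign l a * b) := by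
  have h₁ : k + 1 + l = m + 1 := by omega
  have h₂ : k + (l + 1) = m + 1 := by omega
  rw [superD_superTmul, superD_superTmul, pairing_superTmul h₁, pairing_superTmul h₂,
    DForm.d_wedge h h₁ h₂, map_add, map_smul, Λ.sign_of_mem _ ha, Λ.sign_of_mem _ ha,
    ← sgn_natCast, add_smul]
  simp only [smul_mul_assoc, smul_smul, smul_eq_mul]
  congr 2
  have e : sgn p * sgn ((p - k) * (l + 1 : ℕ)) = sgn k * sgn ((p - k) * l) := by
    simp only [← sgn_add]
    refine sgn_congr ⟨p - k, ?_⟩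
    push_cast
    ring
  linear_combination integral (DForm.wedge h₂ α (DForm.d β)) * e

theorem pairing_superD_superTmul_of_ne
    {I : ModelWithCorners ℝ (EuclideanSpace ℝ (Fin (m + 1))) H}
    {M : Type u} [TopologicalSpace M] [ChartedSpace H M] [IsManifold I ∞ M] [T2Space M]
    [CompactSpace M] (c : ℝ) {k l : ℕ} (h : k + l ≠ m) (α : DForm I M k) (β : DForm I M l)
    (a b : Λ) :
    pairing (superD (superTmul α a)) (superTmul β b) +
      c • pairing (superTmul α a) (superD (superTmul β b)) = 0 := by
  rw [superD_superTmul, superD_superTmul, pairing_superTmul_of_ne (by omega),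
    pairing_superTmul_of_ne (by omega), smul_zero, add_zero]

/-- Integration by parts for superfields on closed manifolds. -/
theorem pairing_superD_closed {N : Type u} [TopologicalSpace N]
    [ChartedSpace (EuclideanSpace ℝ (Fin (m + 1))) N] [IsManifold (𝓡 (m + 1)) ∞ N] [T2Space N]
    [CompactSpace N] (hN : IsOrientedAtlas (𝓡 (m + 1)) N) {p q : ℤ}
    {X Y : Forms (𝓡 (m + 1)) N ⊗[ℝ] Λ} (hX : X ∈ superDeg (𝓡 (m + 1)) N Λ p)
    (hY : Y ∈ superDeg (𝓡 (m + 1)) N Λ q) :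
    pairing (superD X) Y + sgn p • pairing X (superD Y) = 0 := by
  have h := superDeg_ext₂ (F := (pairingL (𝓡 (m + 1)) N Λ).comp superD +
    sgn p • (pairingL (𝓡 (m + 1)) N Λ).compl₂ superD) (G := 0)
    (fun k l α β a ha b hb => ?_) hX hY
  · simpa only [LinearMap.add_apply, LinearMap.comp_apply, LinearMap.smul_apply,
      LinearMap.compl₂_apply, LinearMap.zero_apply, pairingL_apply] using h
  · simp only [LinearMap.add_apply, LinearMap.comp_apply, LinearMap.smul_apply,
      LinearMap.compl₂_apply, LinearMap.zero_apply, pairingL_apply]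
    by_cases hkl : k + l = m
    · rw [pairing_superD_superTmul hkl α β ha b, integral_d_eq_zero hN, zero_smul]
    · exact pairing_superD_superTmul_of_ne _ hkl α β a b

section Pullback

variable {n : ℕ} {I : ModelWithCorners ℝ (EuclideanSpace ℝ (Fin n)) H}
  {M : Type u} [TopologicalSpace M] [ChartedSpace H M] [IsManifold I ∞ M]
  {H' : Type*} [TopologicalSpace H'] {J : ModelWithCorners ℝ (EuclideanSpace ℝ (Fin m)) H'}
  {N : Type v} [TopologicalSpace N] [ChartedSpace H' N] [IsManifold J ∞ N]
  (f : N → M) (hf : ContMDiff J I ∞ f)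

/-- The pullback of superfields. -/
def superPullback : Forms I M ⊗[ℝ] Λ →ₗ[ℝ] Forms J N ⊗[ℝ] Λ :=
  (totalPullback f hf).rTensor Λ

theorem superPullback_superTmul {k : ℕ} (α : DForm I M k) (a : Λ) :
    superPullback f hf (superTmul α a) = superTmul (DForm.pullback f hf α) a := by
  refine congrArg (· ⊗ₜ[ℝ] a) ?_
  exact DirectSum.lmap_lof _ _ _

theorem superPullback_mem {p : ℤ} {X : Forms I M ⊗[ℝ] Λ} (hX : X ∈ superDeg I M Λ p) :
    superPullback f hf X ∈ superDeg J N Λ p := by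
  refine superDeg_mapsTo (fun k α a ha => ?_) hX
  rw [superPullback_superTmul]
  exact superTmul_mem _ ha

theorem superPullback_superRmul (ε : Λ) (X : Forms I M ⊗[ℝ] Λ) :
    superPullback f hf (superRmul ε X) = superRmul ε (superPullback f hf X) := by
  induction X using TensorProduct.induction_on with
  | zero => simp only [map_zero]
  | tmul α a => rfl
  | add X Y hX hY => simp only [map_add, hX, hY]

theorem superPullback_superMap (φ : GCAlg.Hom Λ Λ') (X : Forms I M ⊗[ℝ] Λ) :
    superPullback f hf (superMap φ X) = superMap φ (superPullback f hf X) := by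
  induction X using TensorProduct.induction_on with
  | zero => simp only [map_zero]
  | tmul α a => rfl
  | add X Y hX hY => simp only [map_add, hX, hY]

theorem superPullback_superD {p : ℤ} {X : Forms I M ⊗[ℝ] Λ} (hX : X ∈ superDeg I M Λ p) :
    superPullback f hf (superD X) = superD (superPullback f hf X) := by
  refine superDeg_ext (F := superPullback f hf ∘ₗ superD) (G := superD ∘ₗ superPullback f hf)
    (fun k α a _ => ?_) hX
  simp only [LinearMap.comp_apply, superD_superTmul, superPullback_superTmul, DForm.pullback_d]

/-- Spanning elements are lifted by extending the form and keeping the coefficient, so the total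
degree is preserved. -/
theorem exists_superPullback_eq
    (hsurj : ∀ k, Function.Surjective (DForm.pullback (k := k) f hf)) {p : ℤ}
    {Y : Forms J N ⊗[ℝ] Λ} (hY : Y ∈ superDeg J N Λ p) :
    ∃ X ∈ superDeg I M Λ p, superPullback f hf X = Y := by
  have : superDeg J N Λ p ≤ (superDeg I M Λ p).map (superPullback f hf) := by
    refine Submodule.span_le.2 ?_
    rintro _ ⟨k, β, a, ha, rfl⟩
    obtain ⟨α, rfl⟩ := hsurj k β
    exact ⟨superTmul α a, superTmul_mem α ha, superPullback_superTmul f hf α a⟩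
  exact this hY

end Pullback

/-- Stokes' theorem for superfields. -/
theorem pairing_superD_boundary {M : Type u} [TopologicalSpace M] [T2Space M] [CompactSpace M]
    [ChartedSpace (EuclideanHalfSpace 3) M] [IsManifold (𝓡∂ 3) ∞ M]
    {N : Type v} [TopologicalSpace N] [T2Space N] [CompactSpace N]
    [ChartedSpace (EuclideanSpace ℝ (Fin 2)) N] [IsManifold (𝓡 2) ∞ N] {i : N → M}
    (hM : IsOrientedAtlas (𝓡∂ 3) M) (hN : IsOrientedAtlas (𝓡 2) N) (hi : Topology.IsEmbedding i)
    (his : ContMDiff (𝓡 2) (𝓡∂ 3) ∞ i) (hrange : range i = (𝓡∂ 3).boundary M)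
    (hor : IsBoundaryOriented i) {p q : ℤ} {X Y : Forms (𝓡∂ 3) M ⊗[ℝ] Λ}
    (hX : X ∈ superDeg (𝓡∂ 3) M Λ p) (hY : Y ∈ superDeg (𝓡∂ 3) M Λ q) :
    pairing (superD X) Y + sgn p • pairing X (superD Y) =
      pairing (superPullback i his X) (superPullback i his Y) := by
  have h := superDeg_ext₂ (F := (pairingL (𝓡∂ 3) M Λ).comp superD +
    sgn p • (pairingL (𝓡∂ 3) M Λ).compl₂ superD)
    (G := (pairingL (𝓡 2) N Λ).compl₁₂ (superPullback i his) (superPullback i his))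
    (fun k l α β a ha b hb => ?_) hX hY
  · simpa only [LinearMap.add_apply, LinearMap.comp_apply, LinearMap.smul_apply,
      LinearMap.compl₂_apply, LinearMap.compl₁₂_apply, pairingL_apply] using h
  · simp only [LinearMap.add_apply, LinearMap.comp_apply, LinearMap.smul_apply,
      LinearMap.compl₂_apply, LinearMap.compl₁₂_apply, pairingL_apply, superPullback_superTmul]
    by_cases hkl : k + l = 2
    · rw [pairing_superTmul hkl, ← DForm.pullback_wedge,
        ← integral_d_eq_integral_pullback hM hN hi his hrange hor]
      exact pairing_superD_superTmul (m := 2) hkl α β ha b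
    · rw [pairing_superTmul_of_ne hkl]
      exact pairing_superD_superTmul_of_ne (m := 2) _ hkl α β a b

end SuperStokes

/-! ### Fields as pairs of superfields -/

section Fields

variable {n : ℕ} {H : Type*} [TopologicalSpace H]
  {I : ModelWithCorners ℝ (EuclideanSpace ℝ (Fin n)) H}
  {M : Type u} [TopologicalSpace M] [ChartedSpace H M] {Λ Λ' : GCAlg}

theorem superA_add (x y : bfFields I M ⊗[ℝ] Λ) : superA (x + y) = superA x + superA y :=
  map_add _ _ _

theorem superB_add (x y : bfFields I M ⊗[ℝ] Λ) : superB (x + y) = superB x + superB y :=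
  map_add _ _ _

theorem superA_smul (t : ℝ) (x : bfFields I M ⊗[ℝ] Λ) : superA (t • x) = t • superA x :=
  map_smul _ _ _

theorem superB_smul (t : ℝ) (x : bfFields I M ⊗[ℝ] Λ) : superB (t • x) = t • superB x :=
  map_smul _ _ _

theorem superA_zero : superA (0 : bfFields I M ⊗[ℝ] Λ) = 0 := map_zero _

theorem superB_zero : superB (0 : bfFields I M ⊗[ℝ] Λ) = 0 := map_zero _

theorem superA_map (φ : GCAlg.Hom Λ Λ') (x : bfFields I M ⊗[ℝ] Λ) :
    superA ((bfFields I M).map φ x) = superMap φ (superA x) := by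
  induction x using TensorProduct.induction_on with
  | zero => simp only [map_zero, superA_zero]
  | tmul v a => rfl
  | add x y hx hy => simp only [map_add, superA_add, hx, hy]

theorem superB_map (φ : GCAlg.Hom Λ Λ') (x : bfFields I M ⊗[ℝ] Λ) :
    superB ((bfFields I M).map φ x) = superMap φ (superB x) := by
  induction x using TensorProduct.induction_on with
  | zero => simp only [map_zero, superB_zero]
  | tmul v a => rfl
  | add x y hx hy => simp only [map_add, superB_add, hx, hy]

theorem rmul_add (V : GVect.{u}) (x y : V ⊗[ℝ] Λ) (ε : Λ) :
    V.rmul (x + y) ε = V.rmul x ε + V.rmul y ε := map_add _ _ _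

theorem rmul_zero (V : GVect.{u}) (ε : Λ) : V.rmul (0 : V ⊗[ℝ] Λ) ε = 0 := map_zero _

theorem superA_rmul (x : bfFields I M ⊗[ℝ] Λ) (ε : Λ) :
    superA ((bfFields I M).rmul x ε) = superRmul ε (superA x) := by
  induction x using TensorProduct.induction_on with
  | zero => simp only [rmul_zero, superA_zero, map_zero]
  | tmul v a => rfl
  | add x y hx hy => simp only [rmul_add, map_add, superA_add, hx, hy]

theorem superB_rmul (x : bfFields I M ⊗[ℝ] Λ) (ε : Λ) :
    superB ((bfFields I M).rmul x ε) = superRmul ε (superB x) := by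
  induction x using TensorProduct.induction_on with
  | zero => simp only [rmul_zero, superB_zero, map_zero]
  | tmul v a => rfl
  | add x y hx hy => simp only [rmul_add, map_add, superB_add, hx, hy]

/-- The field with given components. -/
def fieldOf (X Y : Forms I M ⊗[ℝ] Λ) : bfFields I M ⊗[ℝ] Λ :=
  (LinearMap.inl ℝ (Forms I M) (Forms I M)).rTensor Λ X +
    (LinearMap.inr ℝ (Forms I M) (Forms I M)).rTensor Λ Y

theorem superA_fieldOf (X Y : Forms I M ⊗[ℝ] Λ) : superA (fieldOf X Y) = X := by
  have h : ∀ {P Q R : Type u} [AddCommGroup P] [AddCommGroup Q] [AddCommGroup R] [Module ℝ P]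
      [Module ℝ Q] [Module ℝ R] (f : Q →ₗ[ℝ] R) (g : P →ₗ[ℝ] Q) (x : P ⊗[ℝ] Λ),
      f.rTensor Λ (g.rTensor Λ x) = (f ∘ₗ g).rTensor Λ x := fun f g x =>
    (LinearMap.rTensor_comp_apply Λ f g x).symm
  refine (map_add _ _ _).trans ?_
  rw [h, h, LinearMap.fst_comp_inl, LinearMap.fst_comp_inr, LinearMap.rTensor_id,
    LinearMap.rTensor_zero]
  exact add_zero X

theorem superB_fieldOf (X Y : Forms I M ⊗[ℝ] Λ) : superB (fieldOf X Y) = Y := by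
  have h : ∀ {P Q R : Type u} [AddCommGroup P] [AddCommGroup Q] [AddCommGroup R] [Module ℝ P]
      [Module ℝ Q] [Module ℝ R] (f : Q →ₗ[ℝ] R) (g : P →ₗ[ℝ] Q) (x : P ⊗[ℝ] Λ),
      f.rTensor Λ (g.rTensor Λ x) = (f ∘ₗ g).rTensor Λ x := fun f g x =>
    (LinearMap.rTensor_comp_apply Λ f g x).symm
  refine (map_add _ _ _).trans ?_
  rw [h, h, LinearMap.snd_comp_inl, LinearMap.snd_comp_inr, LinearMap.rTensor_id,
    LinearMap.rTensor_zero]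
  exact zero_add Y

theorem fieldOf_superA_superB (x : bfFields I M ⊗[ℝ] Λ) : fieldOf (superA x) (superB x) = x := by
  induction x using TensorProduct.induction_on with
  | zero =>
    rw [superA_zero, superB_zero, fieldOf, map_zero, map_zero]
    exact add_zero 0
  | tmul v a =>
    refine (TensorProduct.add_tmul (v.1, (0 : Forms I M)) ((0 : Forms I M), v.2) a).symm.trans ?_
    refine congrArg (· ⊗ₜ[ℝ] a) ?_
    exact Prod.ext (add_zero v.1) (zero_add v.2)
  | add x y hx hy =>
    nth_rewrite 3 [← hx]
    nth_rewrite 3 [← hy]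
    rw [superA_add, superB_add]
    simp only [fieldOf, map_add]
    exact add_add_add_comm _ _ _ _

theorem field_ext {x y : bfFields I M ⊗[ℝ] Λ} (hA : superA x = superA y)
    (hB : superB x = superB y) : x = y := by
  rw [← fieldOf_superA_superB x, hA, hB, fieldOf_superA_superB]

theorem tmul_mem_superDeg {j d : ℤ} {α : Forms I M} (hα : α ∈ shiftedForms I M j) {a : Λ}
    (ha : a ∈ Λ.gr (d - j)) : α ⊗ₜ[ℝ] a ∈ superDeg I M Λ (d + 1) := by
  classical
  have hsum : α = ∑ k ∈ DFinsupp.support α, DirectSum.lof ℝ ℕ (fun k => DForm I M k) k (α k) :=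
    (DirectSum.sum_support_of α).symm
  rw [hsum, TensorProduct.sum_tmul]
  refine Submodule.sum_mem _ fun k hk => ?_
  have hkj : (k : ℤ) = j + 1 := by
    by_contra h
    exact (DFinsupp.mem_support_iff.1 hk) (hα k h)
  refine superTmul_mem (α k) ?_
  rw [hkj, add_sub_add_right_eq_sub]
  exact ha

theorem superA_mem {d : ℤ} {x : bfFields I M ⊗[ℝ] Λ} (hx : x ∈ (bfFields I M).points Λ d) :
    superA x ∈ superDeg I M Λ (d + 1) := by
  have : (bfFields I M).points Λ d ≤ (superDeg I M Λ (d + 1)).comap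
      ((LinearMap.fst ℝ (Forms I M) (Forms I M)).rTensor Λ) := by
    refine Submodule.span_le.2 ?_
    rintro _ ⟨j, v, hv, a, ha, rfl⟩
    exact tmul_mem_superDeg hv.1 ha
  exact this hx

theorem superB_mem {d : ℤ} {x : bfFields I M ⊗[ℝ] Λ} (hx : x ∈ (bfFields I M).points Λ d) :
    superB x ∈ superDeg I M Λ (d + 1) := by
  have : (bfFields I M).points Λ d ≤ (superDeg I M Λ (d + 1)).comap
      ((LinearMap.snd ℝ (Forms I M) (Forms I M)).rTensor Λ) := by
    refine Submodule.span_le.2 ?_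
    rintro _ ⟨j, v, hv, a, ha, rfl⟩
    exact tmul_mem_superDeg hv.2 ha
  exact this hx

theorem lof_mem_shiftedForms {k : ℕ} (α : DForm I M k) :
    DirectSum.lof ℝ ℕ (fun k => DForm I M k) k α ∈ shiftedForms I M ((k : ℤ) - 1) := by
  intro k' hk'
  refine DirectSum.of_eq_of_ne _ _ _ fun h => hk' ?_
  rw [h]
  ring

theorem fieldOf_mem {d : ℤ} {X Y : Forms I M ⊗[ℝ] Λ} (hX : X ∈ superDeg I M Λ (d + 1))
    (hY : Y ∈ superDeg I M Λ (d + 1)) : fieldOf X Y ∈ (bfFields I M).points Λ d := by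
  refine Submodule.add_mem _ ?_ ?_
  · have : superDeg I M Λ (d + 1) ≤ ((bfFields I M).points Λ d).comap
        ((LinearMap.inl ℝ (Forms I M) (Forms I M)).rTensor Λ) := by
      refine Submodule.span_le.2 ?_
      rintro _ ⟨k, α, a, ha, rfl⟩
      refine Submodule.subset_span ⟨(k : ℤ) - 1, _, ⟨lof_mem_shiftedForms α,
        Submodule.zero_mem _⟩, a, ?_, rfl⟩
      have e : d - ((k : ℤ) - 1) = d + 1 - k := by ring
      rwa [e]
    exact this hX
  · have : superDeg I M Λ (d + 1) ≤ ((bfFields I M).points Λ d).comap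
        ((LinearMap.inr ℝ (Forms I M) (Forms I M)).rTensor Λ) := by
      refine Submodule.span_le.2 ?_
      rintro _ ⟨k, α, a, ha, rfl⟩
      refine Submodule.subset_span ⟨(k : ℤ) - 1, _, ⟨Submodule.zero_mem _,
        lof_mem_shiftedForms α⟩, a, ?_, rfl⟩
      have e : d - ((k : ℤ) - 1) = d + 1 - k := by ring
      rwa [e]
    exact this hY

/-- The offset by one comes from the shift in `Ω^•[1]`: a `k`-form has internal degree `k - 1`.
Points thus have superfields of total degree 1, and tangent vectors of degree 1 have superfields of
total degree 2. -/
theorem mem_points_iff {d : ℤ} {x : bfFields I M ⊗[ℝ] Λ} :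
    x ∈ (bfFields I M).points Λ d ↔
      superA x ∈ superDeg I M Λ (d + 1) ∧ superB x ∈ superDeg I M Λ (d + 1) :=
  ⟨fun h => ⟨superA_mem h, superB_mem h⟩, fun h => by
    rw [← fieldOf_superA_superB x]
    exact fieldOf_mem h.1 h.2⟩

section

variable [IsManifold I ∞ M]

theorem bfQ_add (x y : bfFields I M ⊗[ℝ] Λ) : bfQ I M Λ (x + y) = bfQ I M Λ x + bfQ I M Λ y :=
  map_add _ _ _

theorem bfQ_zero : bfQ I M Λ 0 = 0 := map_zero _

theorem superA_bfQ (x : bfFields I M ⊗[ℝ] Λ) : superA (bfQ I M Λ x) = superD (superA x) := by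
  induction x using TensorProduct.induction_on with
  | zero => rw [bfQ_zero, superA_zero, map_zero]
  | tmul v a => rfl
  | add x y hx hy =>
    rw [bfQ_add, superA_add, superA_add, map_add, hx, hy]

theorem superB_bfQ (x : bfFields I M ⊗[ℝ] Λ) : superB (bfQ I M Λ x) = superD (superB x) := by
  induction x using TensorProduct.induction_on with
  | zero => rw [bfQ_zero, superB_zero, map_zero]
  | tmul v a => rfl
  | add x y hx hy =>
    rw [bfQ_add, superB_add, superB_add, map_add, hx, hy]

theorem superD_superD (X : Forms I M ⊗[ℝ] Λ) : superD (superD X) = 0 := by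
  induction X using TensorProduct.induction_on with
  | zero => simp only [map_zero]
  | tmul α a =>
    refine (congrArg (· ⊗ₜ[ℝ] a) (totalD_totalD α)).trans ?_
    exact TensorProduct.zero_tmul _ _
  | add X Y hX hY => simp only [map_add, hX, hY, add_zero]

variable (I M) in
-- The vector field is linear, so its derivative along itself is `d` applied twice.
theorem isCohomological_bfQ : IsCohomological (bfFields I M) (bfQ I M) where
  isVectorField :=
    { degree := fun Λ x hx => by
        have hA := superD_mem (superA_mem hx)
        have hB := superD_mem (superB_mem hx)
        rw [zero_add] at hA hB
        rw [mem_points_iff, superA_bfQ, superB_bfQ]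
        exact ⟨hA, hB⟩
      natural := fun Λ Λ' φ x _ => field_ext
        (by simp only [superA_bfQ, superA_map, superD_superMap])
        (by simp only [superB_bfQ, superB_map, superD_superMap]) }
  sq_zero := fun Λ x _ ε _ => field_ext
    (by rw [superA_bfQ, superA_bfQ, superA_add, superA_rmul, superA_bfQ, map_add, superD_superRmul,
      superD_superD, map_zero, add_zero])
    (by rw [superB_bfQ, superB_bfQ, superB_add, superB_rmul, superB_bfQ, map_add, superD_superRmul,
      superD_superD, map_zero, add_zero])

end

end Fields

/-! ### Forms on the spaces of fields, and the BFV structure -/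

section Structures

variable {n : ℕ} {H : Type*} [TopologicalSpace H]
  {I : ModelWithCorners ℝ (EuclideanSpace ℝ (Fin n)) H}
  {M : Type u} [TopologicalSpace M] [ChartedSpace H M] [IsManifold I ∞ M] [T2Space M]
  [CompactSpace M] {Λ Λ' : GCAlg}

theorem isForm_zeroForm (V : GVect.{u}) (k : ℕ) (j : ℤ) : IsForm V k j (zeroForm V) where
  degree _ _ _ _ _ := Submodule.zero_mem _
  natural _ _ φ _ _ _ _ := (map_zero φ.toAlgHom).symm
  homogeneous _ t _ _ _ _ := (smul_zero (t ^ k)).symm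

theorem pairing_mem_of_eq {p q j : ℤ} (h : p + q - n = j) {X Y : Forms I M ⊗[ℝ] Λ}
    (hX : X ∈ superDeg I M Λ p) (hY : Y ∈ superDeg I M Λ q) : pairing X Y ∈ Λ.gr j :=
  h ▸ pairing_mem hX hY

theorem pairing_comm_of_even {p q : ℤ} (hp : Even p) {X Y : Forms I M ⊗[ℝ] Λ}
    (hX : X ∈ superDeg I M Λ p) (hY : Y ∈ superDeg I M Λ q) : pairing X Y = pairing Y X := by
  rw [pairing_comm hX hY, sgn_even (hp.mul_right q), one_smul]

theorem pairing_superRmul_left_of_even {p q e : ℤ} (he : Even (e * q)) {ε : Λ}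
    (hε : ε ∈ Λ.gr e) {X Y : Forms I M ⊗[ℝ] Λ} (hX : X ∈ superDeg I M Λ p)
    (hY : Y ∈ superDeg I M Λ q) : pairing (superRmul ε X) Y = pairing X Y * ε := by
  rw [pairing_superRmul_left hε hX hY, sgn_even he, one_smul]

/-- Two factors of total degree 2 and an integral of degree `-n` give `4 - n = j + 2`. Closedness
holds because the form has constant coefficients; nondegeneracy is tested on fields with one
vanishing component. -/
theorem isSymplectic_bfOmega (hM : IsOrientedAtlas I M) {j : ℤ} (hj : j = 2 - n) :
    IsSymplectic (bfFields I M) j (bfOmega I M) where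
  isForm :=
    { degree := fun Λ x _ ξ hξ => pairing_mem_of_eq (by rw [hj]; push_cast; ring)
        (superA_mem hξ) (superB_mem hξ)
      natural := fun Λ Λ' φ x _ ξ hξ => by
        simp only [bfOmega, superA_map, superB_map]
        exact pairing_superMap φ (superA_mem hξ) (superB_mem hξ)
      homogeneous := fun Λ t x _ ξ _ => by
        simp only [bfOmega, superA_smul, superB_smul, pairing_smul_left, pairing_smul_right,
          smul_smul, pow_two] }
  closed := fun Λ x _ ξ _ ε _ => by
    simp only [bfOmega, zeroForm, zero_mul, add_zero]
  nondegenerate := by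
    intro Λ x hx v hv h
    have h' : ∀ (Λ' : GCAlg) (φ : GCAlg.Hom Λ Λ') (X Y : Forms I M ⊗[ℝ] Λ'),
        X ∈ superDeg I M Λ' (1 + 1) → Y ∈ superDeg I M Λ' (1 + 1) →
        pairing X (superMap φ (superB v)) + pairing (superMap φ (superA v)) Y = 0 := by
      intro Λ' φ X Y hX hY
      have h1 := h Λ' φ (fieldOf X Y) (fieldOf_mem hX hY)
      simp only [bfOmega, superA_add, superB_add, superA_fieldOf, superB_fieldOf, superA_map,
        superB_map, pairing_add_left, pairing_add_right] at h1
      rw [← h1]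
      abel
    refine field_ext ?_ ?_
    · rw [superA_zero]
      refine eq_zero_of_pairing_eq_zero (p := 1 + 1) hM (superA_mem hv) fun Λ' φ X hX => ?_
      have h1 := h' Λ' φ 0 X (Submodule.zero_mem _) hX
      rw [pairing_zero_left, zero_add] at h1
      rw [pairing_comm_of_even ⟨1, rfl⟩ hX (superMap_mem φ (superA_mem hv)), h1]
    · rw [superB_zero]
      refine eq_zero_of_pairing_eq_zero (p := 1 + 1) hM (superB_mem hv) fun Λ' φ X hX => ?_
      have h1 := h' Λ' φ X 0 hX (Submodule.zero_mem _)
      rwa [pairing_zero_right, add_zero] at h1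

theorem isForm_bfAlpha {j : ℤ} (hj : j = 2 - n) : IsForm (bfFields I M) 1 j (bfAlpha I M) where
  degree Λ x hx ξ hξ := pairing_mem_of_eq (by rw [hj]; push_cast; ring)
    (superB_mem hx) (superA_mem hξ)
  natural Λ Λ' φ x hx ξ hξ := by
    simp only [bfAlpha, superA_map, superB_map]
    exact pairing_superMap φ (superB_mem hx) (superA_mem hξ)
  homogeneous Λ t x _ ξ _ := by
    simp only [bfAlpha, superA_smul, pairing_smul_right, pow_one]

variable (I M) in
-- No sign arises: `ε` passes δA, of even total degree, and δB ∧ δA = δA ∧ δB under the integral for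
-- the same reason.
theorem isDifferential_bfAlpha : IsDifferential (bfFields I M) (bfAlpha I M) (bfOmega I M) := by
  intro Λ x hx ξ hξ ε hε
  simp only [bfAlpha, bfOmega, superB_add, superB_rmul, pairing_add_left]
  rw [pairing_superRmul_left_of_even ⟨-1, rfl⟩ hε (superB_mem hξ) (superA_mem hξ),
    pairing_comm_of_even ⟨1, rfl⟩ (superB_mem hξ) (superA_mem hξ)]

variable (I M) in
/-- The 1-form `∫ dA ∧ δB + δA ∧ dB`. -/
def bfContraction : FormData (bfFields I M) := fun _ x ξ =>
  pairing (superD (superA x)) (superB ξ) + pairing (superA ξ) (superD (superB x))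

theorem isForm_bfContraction {j : ℤ} (hj : j = 3 - n) :
    IsForm (bfFields I M) 1 j (bfContraction I M) where
  degree Λ x hx ξ hξ := Submodule.add_mem _
    (pairing_mem_of_eq (by rw [hj]; push_cast; ring) (superD_mem (superA_mem hx)) (superB_mem hξ))
    (pairing_mem_of_eq (by rw [hj]; push_cast; ring) (superA_mem hξ) (superD_mem (superB_mem hx)))
  natural Λ Λ' φ x hx ξ hξ := by
    simp only [bfContraction, superA_map, superB_map, superD_superMap, map_add]
    rw [pairing_superMap φ (superD_mem (superA_mem hx)) (superB_mem hξ),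
      pairing_superMap φ (superA_mem hξ) (superD_mem (superB_mem hx))]
  homogeneous Λ t x _ ξ _ := by
    simp only [bfContraction, superA_smul, superB_smul, pairing_smul_left, pairing_smul_right,
      smul_add, pow_one]

variable (I M) in
-- Expanding the square gives the two mixed terms of `bfContraction` and a quadratic term dA ∧ dB,
-- killed by `ε² = 0`.
theorem isContraction_bfOmega :
    IsContraction (bfFields I M) (bfQ I M) (bfOmega I M) (bfContraction I M) := by
  intro Λ x hx ξ hξ ε hε hεε
  have hA := superD_mem (superA_mem hx)
  have hB := superD_mem (superB_mem hx)
  simp only [bfOmega, bfContraction, superA_add, superB_add, superA_rmul, superB_rmul, superA_bfQ,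
    superB_bfQ, pairing_add_left, pairing_add_right]
  rw [pairing_superRmul_left_of_even ⟨0, by ring⟩ hε hA (superB_mem hξ),
    pairing_superRmul_left_of_even ⟨0, by ring⟩ hε hA (superRmul_mem hε hB),
    pairing_superRmul_right ε hA hB, pairing_superRmul_right ε (superA_mem hξ) hB, mul_assoc, hεε,
    mul_zero, add_mul]
  abel

/-- The fields on a closed oriented surface form a BFV manifold. -/
theorem isBFVManifold_bfFields {N : Type u} [TopologicalSpace N] [T2Space N] [CompactSpace N]
    [ChartedSpace (EuclideanSpace ℝ (Fin 2)) N] [IsManifold (𝓡 2) ∞ N]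
    (hN : IsOrientedAtlas (𝓡 2) N) :
    IsBFVManifold (bfFields (𝓡 2) N) (bfOmega (𝓡 2) N) (bfAlpha (𝓡 2) N) (bfQ (𝓡 2) N) where
  symplectic := isSymplectic_bfOmega hN (by norm_num)
  primitive_isForm := isForm_bfAlpha (by norm_num)
  exact := isDifferential_bfAlpha (𝓡 2) N
  cohomological := isCohomological_bfQ (𝓡 2) N
  lie := by
    refine ⟨zeroForm _, zeroForm _, bfContraction (𝓡 2) N, zeroForm _, isForm_zeroForm _ _ _,
      (isSymplectic_bfOmega hN (by norm_num : (0 : ℤ) = 2 - (2 : ℕ))).closed,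
      isForm_zeroForm _ _ _, fun Λ x _ ξ _ ε _ _ => ?_, isForm_bfContraction (by norm_num),
      isContraction_bfOmega (𝓡 2) N, isForm_zeroForm _ _ _, fun Λ x hx ξ hξ ε hε => ?_,
      fun Λ x _ ξ _ => (sub_zero 0).symm⟩
    · simp only [zeroForm, zero_mul, add_zero]
    · have hA := superD_mem (superA_mem hξ)
      have hB := superD_mem (superB_mem hξ)
      simp only [bfContraction, zeroForm, superA_add, superB_add, superA_rmul, superB_rmul,
        map_add, superD_superRmul, pairing_add_left, pairing_add_right, zero_mul, add_zero]
      rw [pairing_superRmul_left_of_even ⟨-1, rfl⟩ hε hA (superB_mem hξ),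
        pairing_superRmul_right ε (superA_mem hξ) hB]
      -- The coefficient of `ε` in δ ι_Q ω is the integral of d(δA ∧ δB), zero because the surface
      -- has no boundary.
      have h := pairing_superD_closed (m := 1) hN (superA_mem hξ) (superB_mem hξ)
      rw [sgn_even ⟨1, rfl⟩, one_smul] at h
      have h2 : pairing (superD (superA ξ)) (superB ξ) * ε +
          pairing (superA ξ) (superD (superB ξ)) * ε = 0 := by
        rw [← add_mul, h, zero_mul]
      rw [add_add_add_comm, h2, add_zero]

variable (I M) in
/-- The differential `∫ δB ∧ dA + B ∧ d(δA)` of the action. -/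
def bfActionDifferential : FormData (bfFields I M) := fun _ x ξ =>
  pairing (superB ξ) (superD (superA x)) + pairing (superB x) (superD (superA ξ))

theorem isForm_bfAction {j : ℤ} (hj : j = 3 - n) : IsForm (bfFields I M) 0 j (bfAction I M) where
  degree Λ x hx ξ _ := pairing_mem_of_eq (by rw [hj]; push_cast; ring)
    (superB_mem hx) (superD_mem (superA_mem hx))
  natural Λ Λ' φ x hx ξ _ := by
    simp only [bfAction, superA_map, superB_map, superD_superMap]
    exact pairing_superMap φ (superB_mem hx) (superD_mem (superA_mem hx))
  homogeneous Λ t x _ ξ _ := by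
    simp only [bfAction, pow_zero, one_smul]

theorem isForm_bfActionDifferential {j : ℤ} (hj : j = 3 - n) :
    IsForm (bfFields I M) 1 j (bfActionDifferential I M) where
  degree Λ x hx ξ hξ := Submodule.add_mem _
    (pairing_mem_of_eq (by rw [hj]; push_cast; ring) (superB_mem hξ) (superD_mem (superA_mem hx)))
    (pairing_mem_of_eq (by rw [hj]; push_cast; ring) (superB_mem hx) (superD_mem (superA_mem hξ)))
  natural Λ Λ' φ x hx ξ hξ := by
    simp only [bfActionDifferential, superA_map, superB_map, superD_superMap, map_add]
    rw [pairing_superMap φ (superB_mem hξ) (superD_mem (superA_mem hx)),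
      pairing_superMap φ (superB_mem hx) (superD_mem (superA_mem hξ))]
  homogeneous Λ t x _ ξ _ := by
    simp only [bfActionDifferential, superA_smul, superB_smul, map_smul, pairing_smul_left,
      pairing_smul_right, smul_add, pow_one]

variable (I M) in
-- The term quadratic in the variation contains `ε * ε`, which vanishes because `ε` is odd; the
-- linear terms carry no sign because dA has even total degree.
theorem isDifferential_bfAction :
    IsDifferential (bfFields I M) (bfAction I M) (bfActionDifferential I M) := by
  intro Λ x hx ξ hξ ε hε
  have hA := superD_mem (superA_mem hx)
  have hA' := superD_mem (superA_mem hξ)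
  simp only [bfAction, bfActionDifferential, superA_add, superB_add, superA_rmul, superB_rmul,
    map_add, superD_superRmul, pairing_add_left, pairing_add_right]
  rw [pairing_superRmul_left_of_even ⟨-1, rfl⟩ hε (superB_mem hξ) hA,
    pairing_superRmul_right ε (superB_mem hx) hA',
    pairing_superRmul_right ε (superRmul_mem hε (superB_mem hξ)) hA',
    pairing_superRmul_left hε (superB_mem hξ) hA', smul_mul_assoc, mul_assoc,
    Λ.mul_self_eq_zero ⟨-1, rfl⟩ hε, mul_zero, smul_zero, add_mul]
  abel

section Pullback

variable {m : ℕ} {H' : Type*} [TopologicalSpace H']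
  {J : ModelWithCorners ℝ (EuclideanSpace ℝ (Fin m)) H'}
  {N : Type v} [TopologicalSpace N] [ChartedSpace H' N] [IsManifold J ∞ N]
  (f : N → M) (hf : ContMDiff J I ∞ f)

theorem bfPullback_add (x y : bfFields I M ⊗[ℝ] Λ) :
    bfPullback f hf Λ (x + y) = bfPullback f hf Λ x + bfPullback f hf Λ y := map_add _ _ _

theorem bfPullback_zero : bfPullback f hf Λ 0 = 0 := map_zero _

theorem superA_bfPullback (x : bfFields I M ⊗[ℝ] Λ) :
    superA (bfPullback f hf Λ x) = superPullback f hf (superA x) := by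
  induction x using TensorProduct.induction_on with
  | zero => rw [bfPullback_zero, superA_zero, superA_zero, map_zero]
  | tmul v a => rfl
  | add x y hx hy => rw [bfPullback_add, superA_add, superA_add, map_add, hx, hy]

theorem superB_bfPullback (x : bfFields I M ⊗[ℝ] Λ) :
    superB (bfPullback f hf Λ x) = superPullback f hf (superB x) := by
  induction x using TensorProduct.induction_on with
  | zero => rw [bfPullback_zero, superB_zero, superB_zero, map_zero]
  | tmul v a => rfl
  | add x y hx hy => rw [bfPullback_add, superB_add, superB_add, map_add, hx, hy]

theorem bfPullback_mem {d : ℤ} {x : bfFields I M ⊗[ℝ] Λ}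
    (hx : x ∈ (bfFields I M).points Λ d) : bfPullback f hf Λ x ∈ (bfFields J N).points Λ d :=
  mem_points_iff.2 (by
    rw [superA_bfPullback, superB_bfPullback]
    exact ⟨superPullback_mem f hf (superA_mem hx), superPullback_mem f hf (superB_mem hx)⟩)

theorem bfPullback_map (φ : GCAlg.Hom Λ Λ') (x : bfFields I M ⊗[ℝ] Λ) :
    bfPullback f hf Λ' ((bfFields I M).map φ x) = (bfFields J N).map φ (bfPullback f hf Λ x) :=
  field_ext (by simp only [superA_bfPullback, superA_map, superPullback_superMap])
    (by simp only [superB_bfPullback, superB_map, superPullback_superMap])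

theorem bfPullback_rmul (x : bfFields I M ⊗[ℝ] Λ) (ε : Λ) :
    bfPullback f hf Λ ((bfFields I M).rmul x ε) = (bfFields J N).rmul (bfPullback f hf Λ x) ε :=
  field_ext (by simp only [superA_bfPullback, superA_rmul, superPullback_superRmul])
    (by simp only [superB_bfPullback, superB_rmul, superPullback_superRmul])

theorem bfPullback_bfQ {d : ℤ} {x : bfFields I M ⊗[ℝ] Λ}
    (hx : x ∈ (bfFields I M).points Λ d) :
    bfPullback f hf Λ (bfQ I M Λ x) = bfQ J N Λ (bfPullback f hf Λ x) :=
  field_ext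
    (by simp only [superA_bfPullback, superA_bfQ, superPullback_superD f hf (superA_mem hx)])
    (by simp only [superB_bfPullback, superB_bfQ, superPullback_superD f hf (superB_mem hx)])

theorem exists_bfPullback_eq
    (hsurj : ∀ k, Function.Surjective (DForm.pullback (k := k) f hf)) {d : ℤ}
    {y : bfFields J N ⊗[ℝ] Λ} (hy : y ∈ (bfFields J N).points Λ d) :
    ∃ x ∈ (bfFields I M).points Λ d, bfPullback f hf Λ x = y := by
  obtain ⟨X, hX, hXy⟩ := exists_superPullback_eq f hf hsurj (superA_mem hy)
  obtain ⟨Y, hY, hYy⟩ := exists_superPullback_eq f hf hsurj (superB_mem hy)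
  refine ⟨fieldOf X Y, fieldOf_mem hX hY, field_ext ?_ ?_⟩
  · rw [superA_bfPullback, superA_fieldOf, hXy]
  · rw [superB_bfPullback, superB_fieldOf, hYy]

/-- A linear map is its own differential at every point. -/
theorem isTangentMap_bfPullback :
    IsTangentMap (bfFields I M) (bfFields J N) (bfPullback f hf)
      (fun Λ _ ξ => bfPullback f hf Λ ξ) where
  degree _ _ _ _ hξ := bfPullback_mem f hf hξ
  natural _ _ φ _ _ ξ _ := bfPullback_map f hf φ ξ
  deriv Λ x _ ξ _ ε _ := by rw [bfPullback_add, bfPullback_rmul]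

end Pullback

end Structures

end

end BF

/-! ### The BV-BFV structure -/

theorem mainTheorem4 {M N : Type*}
    [TopologicalSpace M] [T2Space M] [CompactSpace M]
    [ChartedSpace (EuclideanHalfSpace 3) M] [IsManifold (𝓡∂ 3) ∞ M]
    [TopologicalSpace N] [T2Space N] [CompactSpace N]
    [ChartedSpace (EuclideanSpace ℝ (Fin 2)) N] [IsManifold (𝓡 2) ∞ N]
    (hM : IsOrientedAtlas (𝓡∂ 3) M) (hN : IsOrientedAtlas (𝓡 2) N)
    (i : N → M) (hi : Manifold.IsSmoothEmbedding (𝓡 2) (𝓡∂ 3) ∞ i)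
    (hrange : Set.range i = (𝓡∂ 3).boundary M) (hor : IsBoundaryOriented i) :
    IsBVBFVManifold
      (bfFields (𝓡∂ 3) M) (bfOmega (𝓡∂ 3) M) (bfQ (𝓡∂ 3) M) (bfAction (𝓡∂ 3) M)
      (bfFields (𝓡 2) N) (bfPullback i hi.contMDiff)
      (bfOmega (𝓡 2) N) (bfAlpha (𝓡 2) N) (bfQ (𝓡 2) N) := by
  have hsurj : ∀ k, Function.Surjective (DForm.pullback (k := k) i hi.contMDiff) := fun k =>
    DForm.pullback_boundary_surjective hM hN hi.isEmbedding hi.contMDiff hrange hor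
  refine ⟨isBFVManifold_bfFields hN, isSymplectic_bfOmega hM (by norm_num),
    isCohomological_bfQ (𝓡∂ 3) M, isForm_bfAction (by norm_num),
    ⟨fun Λ x hx => bfPullback_mem i hi.contMDiff hx,
      fun Λ Λ' φ x _ => bfPullback_map i hi.contMDiff φ x⟩,
    fun Λ y hy => exists_bfPullback_eq i hi.contMDiff hsurj hy,
    fun Λ _ ξ => bfPullback i hi.contMDiff Λ ξ, isTangentMap_bfPullback i hi.contMDiff,
    fun Λ x _ η hη => exists_bfPullback_eq i hi.contMDiff hsurj hη,
    fun Λ x hx => bfPullback_bfQ i hi.contMDiff hx,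
    bfActionDifferential (𝓡∂ 3) M, isForm_bfActionDifferential (by norm_num),
    isDifferential_bfAction (𝓡∂ 3) M, ?_⟩
  intro Λ x hx ξ hξ ε hε hεε
  rw [isContraction_bfOmega (𝓡∂ 3) M Λ x hx ξ hξ ε hε hεε]
  congr 2
  have hA := superD_mem (superA_mem hx)
  have hB := superD_mem (superB_mem hx)
  -- Stokes' theorem for B ∧ δA. The total degree `0 + 1` of B is odd, so it reads ∫ dB ∧ δA - ∫ B ∧
  -- d(δA) = ∫ B ∧ δA over the boundary.
  have h := pairing_superD_boundary hM hN hi.isEmbedding hi.contMDiff hrange hor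
    (superB_mem hx) (superA_mem hξ)
  rw [sgn_odd (i := 0 + 1) ⟨0, rfl⟩, neg_smul, one_smul] at h
  simp only [bfContraction, bfActionDifferential, bfAlpha, superA_bfPullback, superB_bfPullback]
  -- dA and δA have even total degree, so both terms of ι_Q ω can be reordered to match those of δS
  -- and of the Stokes identity.
  rw [← h, pairing_comm_of_even ⟨1, rfl⟩ hA (superB_mem hξ),
    pairing_comm_of_even ⟨1, rfl⟩ (superA_mem hξ) hB]
  abel
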